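/- \textbf{Setting.} Let $\Delta_t\subset\mathbb C^2$, $t\in\mathbb C^m$ near $0$, be an equisingular family of reduced plane curve germs at the origin, for instance the discriminant curves of a generic linear projection of a family of isolated surface singularities in $\mathbb C^3$ that is Zariski equisingular. Choose coordinates $(x,y)$ such that the $y$-axis is transverse to $\Delta_0$. Thus the total space of the family is a hypersurface germ in $\mathbb C^2\times\mathbb C^m$ containing $\{0\}\times\mathbb C^m$, given by a Weierstrass polynomial of some degree $d$ in $y$ with coefficients holomorphic in $(x,t)$, whose projection $(x,y,t)\mapsto(x,t)$ is unbranched outside $\{x=0\}$. \textbf{Carrousels.} Write the Puiseux series of the components of $\Delta_t$ as $y=\sum_{l}a_l(t)x^{l/N}$ with $a_l$ holomorphic near $t=0$. Tangent lines are $y=a_N(t)x$. Choose any truncation of the series of each component (the same for all determinations of one series). Choose $\eta,R>0$ such that for all small $t$ the cones $V_t^{(j)}=\{|y-a^{(j)}_N(t)x|\le\eta|x|,\ |x|\le\epsilon\}$ about the different tangent lines are disjoint outside $0$ and $|a_N^{(j)}(t)|+\eta<R$. Put $B^4_\epsilon=\{|x|\le\epsilon,\ |y|\le R\epsilon\}$.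 For each pair $\kappa=(f,p)$ of an exponent $p>1$ kept in the truncation and a Puiseux polynomial $f=\sum_{l/N<p}a_l(t)x^{l/N}$ such that some of the series start with $f$ followed by a kept term $a_{\kappa j}(t)x^{p}$ with $a_{\kappa j}\not\equiv0$, let $a_{\kappa 1}(t),\dots,a_{\kappa m_\kappa}(t)$ be all these coefficients, and choose $\alpha_\kappa,\beta_\kappa,\gamma_\kappa>0$ such that, for all small $t$, $\alpha_\kappa<|a_{\kappa j}(t)|-\gamma_\kappa$ and $|a_{\kappa j}(t)|+\gamma_\kappa<\beta_\kappa$ for all $j$, and the disks of radius $\gamma_\kappa$ about the different $a_{\kappa j}(t)$ are disjoint. Let $$B_{\kappa,t}=\{\alpha_\kappa|x^{p}|\le|y-f|\le\beta_\kappa|x^{p}|,\ |y-f-a_{\kappa j}(t)x^{p}|\ge\gamma_\kappa|x^{p}|\ \text{for all } j\}.$$ (If some $a_{\kappa j}\not\equiv0$ vanishes at $t=0$, the conditions that involve $\alpha_\kappa$ are omitted.) The \emph{carrousel decomposition} of $B^4_\epsilon$ for $\Delta_t$ consists, over $|x|\le\epsilon$, of the pieces $B_{\kappa,t}$; the conical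 piece $\overline{B^4_\epsilon\setminus\bigcup_jV^{(j)}_t}$; and, for each neighbourhood $|y-g|\le\rho|x^{p}|$ that is a cone $V_t^{(j)}$ ($p=1$, $\rho=\eta$), one of the removed disks $|y-f-a_{\kappa j}(t)x^p|\le\gamma_\kappa|x^p|$, or a removed disk $|y-f|\le\alpha_\kappa|x^p|$: the $A$-piece $\{\beta_{\kappa'}|x^{p'}|\le|y-g|\le\rho|x^{p}|\}$ if there is a next pair $\kappa'=(g,p')$ inside, and otherwise the whole neighbourhood, as a $D$-piece. The pieces are foliated by complex curves: the conical piece by complex lines through $0$; $B_{\kappa,t}$ by the curves $y=f+ax^{p}$; a $D$-piece by the curves $y=g+ax^{p}$, $|a|\le\rho$; an $A$-piece by the immersed curves $y=g+b(r)e^{i\theta}x^{r}$, $p\le r\le p'$, $\theta\in\mathbb R$, where $b$ is affine with $b(p)=\rho$, $b(p')=\beta_{\kappa'}$. \textbf{Proposition.} The components of the $\Delta_t$ have Puiseux expansions as above, depending holomorphically on $t$. For every choice of them and of a truncation, constants as above exist. For every choice of such constants there is $\epsilon_0>0$ such that for every $0<\epsilon\le\epsilon_0$ there is $\delta_0>0$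 such that for every $0<\delta\le\delta_0$ there is a bijective bilipschitz map $\phi$ of $B^4_\epsilon\times D_\delta$ onto itself, where $D_\delta\subset\mathbb C^m$ is the ball of radius $\delta$ about $0$, with the following properties. \begin{enumerate} \item $\phi$ preserves the $x$ and $t$ coordinates. \item For each $t\in D_\delta$ the map $\phi_t=\phi(\cdot,t)$ maps each cone $V^{(j)}_t$ onto $V^{(j)}_0$ and each piece of the carrousel decomposition for $\Delta_t$ onto the corresponding piece for $\Delta_0$, and it maps the leaves of the foliation of each piece for $\Delta_t$ onto the leaves of the corresponding piece for $\Delta_0$, giving all of them. \item On $\{|y-a^{(j)}_N(t)x|=\eta|x|,\ |x|\le\epsilon\}\subset\partial V_t^{(j)}$, $\phi_t$ maps complex lines through $0$ to complex lines through $0$ in $\partial V_0^{(j)}$. \item Each $\phi_t$ is semi-algebraic. If the family is semi-algebraic (the coefficients of the Weierstrass polynomial are semi-algebraic functions near $0$), then $\phi$ is semi-algebraic. \end{enumerate} -/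

import Mathlib

open Filter Topology
open scoped Polynomial

namespace Carrousel

/-! ### Semi-algebraic sets and maps -/

/-- Semi-algebraic subsets of `ℝⁿ`: the smallest collection of subsets of the spaces `ℝⁿ` that
contains the sets `{p > 0}` for real polynomials `p` and is closed under complements, finite
unions and coordinate projections (by Tarski-Seidenberg these are the finite Boolean combinations
of the sets `{p > 0}`). -/
inductive SemialgebraicSet : ∀ {n : ℕ}, Set (Fin n → ℝ) → Prop
  | pos {n : ℕ} (p : MvPolynomial (Fin n) ℝ) :
      SemialgebraicSet {v : Fin n → ℝ | 0 < MvPolynomial.eval v p}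
  | compl {n : ℕ} {s : Set (Fin n → ℝ)} : SemialgebraicSet s → SemialgebraicSet sᶜ
  | union {n : ℕ} {s s' : Set (Fin n → ℝ)} :
      SemialgebraicSet s → SemialgebraicSet s' → SemialgebraicSet (s ∪ s')
  | proj {n : ℕ} {s : Set (Fin (n + 1) → ℝ)} :
      SemialgebraicSet s → SemialgebraicSet ((fun v (i : Fin n) => v i.castSucc) '' s)

/-- A subset of a finite dimensional real vector space is semi-algebraic if it is so in linear
coordinates (the choice of the coordinates does not matter). -/
def IsSemialgebraic {E : Type*} [AddCommGroup E] [Module ℝ E] (S : Set E) : Prop :=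
  ∃ (n : ℕ) (e : E ≃ₗ[ℝ] (Fin n → ℝ)), SemialgebraicSet (e '' S)

/-- `f` is a semi-algebraic map on `S`: its graph over `S` is semi-algebraic. -/
def IsSemialgebraicMapOn {E F : Type*} [AddCommGroup E] [Module ℝ E] [AddCommGroup F] [Module ℝ F]
    (f : E → F) (S : Set E) : Prop :=
  IsSemialgebraic {p : E × F | p.1 ∈ S ∧ p.2 = f p.1}

/-! ### Equisingular families of plane curve germs -/

/-- The parameter space `ℂᵐ`. -/
abbrev Param (m : ℕ) : Type := EuclideanSpace ℂ (Fin m)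

/-- `Δ_t = {(x, y) | P t x y = 0}` is an equisingular family of reduced plane curve germs at the
origin, in coordinates such that the `y`-axis is transverse to `Δ_0`. The total space of the
family is the hypersurface germ in `ℂ² × ℂᵐ` given by the Weierstrass polynomial `P t x ∈ ℂ[y]` of
degree `d`, whose coefficients are holomorphic in `(t, x)`. Equisingularity along `{0} × ℂᵐ`, which
has codimension one in this hypersurface, means that the branch locus of the projection
`(x, y, t) ↦ (x, t)` is nonsingular along the image `{x = 0}` of `{0} × ℂᵐ`, that is, there is no
branching outside `{x = 0}`. -/
structure IsEquisingularFamily {m : ℕ} (d : ℕ) (P : Param m → ℂ → ℂ[X]) : Prop where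
  monic : ∀ᶠ q in 𝓝 (0 : Param m × ℂ), (P q.1 q.2).Monic ∧ (P q.1 q.2).natDegree = d
  analytic : ∀ k : ℕ, AnalyticAt ℂ (fun q : Param m × ℂ => (P q.1 q.2).coeff k) 0
  weierstrass : P 0 0 = Polynomial.X ^ d
  zero_mem : ∀ᶠ t in 𝓝 (0 : Param m), (P t 0).IsRoot 0
  transverse : ∃ K : ℝ, ∀ᶠ x in 𝓝 (0 : ℂ), ∀ y : ℂ, (P 0 x).IsRoot y → ‖y‖ ≤ K * ‖x‖
  branch_locus : ∀ᶠ q in 𝓝 (0 : Param m × ℂ), q.2 ≠ 0 → (P q.1 q.2).Separable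

/-- Puiseux expansions of the components of the curves `Δ_t`, depending holomorphically on `t`:
with `x = w ^ N`, the roots of `P t x` are the holomorphic functions `root i t w`. All the
determinations of the Puiseux series of a component (that is, the series obtained from each other
by `w ↦ ζ w` with `ζ ^ N = 1`) occur among the roots. -/
structure PuiseuxExpansion {m : ℕ} (d : ℕ) (P : Param m → ℂ → ℂ[X]) where
  N : ℕ
  N_pos : 0 < N
  root : Fin d → Param m → ℂ → ℂ
  analytic : ∀ i, AnalyticAt ℂ (fun q : Param m × ℂ => root i q.1 q.2) 0
  factor : ∀ᶠ q in 𝓝 (0 : Param m × ℂ),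
    P q.1 (q.2 ^ N) = ∏ i, (Polynomial.X - Polynomial.C (root i q.1 q.2))

namespace PuiseuxExpansion

variable {m d : ℕ} {P : Param m → ℂ → ℂ[X]} (E : PuiseuxExpansion d P)

/-- The coefficient of `w ^ l = x ^ (l / N)` in the `i`-th Puiseux series. -/
noncomputable def coeff (i : Fin d) (l : ℕ) (t : Param m) : ℂ :=
  iteratedDeriv l (E.root i t) 0 / (l.factorial : ℂ)

/-- The Puiseux polynomial formed by the terms of exponent `< k / N` of the `i`-th series. -/
noncomputable def partialSum (i : Fin d) (k : ℕ) (t : Param m) (w : ℂ) : ℂ :=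
  ∑ l ∈ Finset.range k, E.coeff i l t * w ^ l

/-- The `i`-th and the `j`-th series have the same terms of exponent `< k / N`. -/
def Agree (i j : Fin d) (k : ℕ) : Prop :=
  ∀ l < k, ∀ᶠ t in 𝓝 (0 : Param m), E.coeff j l t = E.coeff i l t

end PuiseuxExpansion

/-- A truncation of the Puiseux series of each component: in the `i`-th series the terms of
exponent `≤ last i / N` are kept. All the determinations of one series are truncated alike. -/
structure Truncation {m d : ℕ} {P : Param m → ℂ → ℂ[X]} (E : PuiseuxExpansion d P) where
  last : Fin d → ℕ
  conj : ∀ (i j : Fin d) (ζ : ℂ), ζ ^ E.N = 1 →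
    (∀ᶠ q in 𝓝 (0 : Param m × ℂ), E.root j q.1 q.2 = E.root i q.1 (ζ * q.2)) → last i = last j

namespace Truncation

variable {m d : ℕ} {P : Param m → ℂ → ℂ[X]} {E : PuiseuxExpansion d P} (M : Truncation E)

/-- `(i, k)` represents the pair `κ = (f, k / N)`, where `f` is the sum of the terms of exponent
`< k / N` of the `i`-th series: the exponent `k / N` is `> 1`, it is kept in the truncation, and it
occurs in the `i`-th series. -/
def IsNode (i : Fin d) (k : ℕ) : Prop :=
  E.N < k ∧ k ≤ M.last i ∧ ¬ ∀ᶠ t in 𝓝 (0 : Param m), E.coeff i k t = 0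

/-- The series number `j` fits the pair `κ` represented by `(i, k)`: it starts with `f`, followed by
a term of exponent `k / N`. The coefficients `a_{kj}` of `κ` are the `coeff j k` for these `j`. -/
def Fits (i : Fin d) (k : ℕ) (j : Fin d) : Prop :=
  M.IsNode j k ∧ E.Agree i j k

/-- The disk `|y - f| < α |x ^ (k / N)|` is removed from the piece `B_κ`. The requirement
`α < |a_{kj}(t)| - γ` can be met for all small `t` exactly if no coefficient `a_{kj}` vanishes at
`t = 0`. If some `a_{kj}`, without being identically zero, vanishes at `t = 0`, then only the disks
about the `a_{kj}(t)` are removed. -/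
def HasCore (i : Fin d) (k : ℕ) : Prop :=
  ∀ j, M.Fits i k j → E.coeff j k 0 ≠ 0

end Truncation

/-! ### Carrousel decompositions -/

/-- The constants that enter a carrousel decomposition: the width `η` of the cones about the tangent
lines, the shape `R` of the balls `|x| ≤ ε`, `|y| ≤ R ε`, and `α_κ`, `β_κ`, `γ_κ`. -/
structure Constants (d : ℕ) where
  η : ℝ
  R : ℝ
  α : Fin d → ℕ → ℝ
  β : Fin d → ℕ → ℝ
  γ : Fin d → ℕ → ℝ

/-- The requirements on the constants, for all small `t`. -/
structure Constants.Admissible {m d : ℕ} {P : Param m → ℂ → ℂ[X]} {E : PuiseuxExpansion d P}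
    (c : Constants d) (M : Truncation E) : Prop where
  η_pos : 0 < c.η
  /-- the cones about different tangent lines meet only at the origin -/
  cones_disjoint : ∀ᶠ t in 𝓝 (0 : Param m), ∀ i j, E.coeff i E.N t ≠ E.coeff j E.N t →
    2 * c.η < ‖E.coeff i E.N t - E.coeff j E.N t‖
  /-- the cones meet the boundary of a ball only in the part `|x| = ε` -/
  cones_lt : ∀ᶠ t in 𝓝 (0 : Param m), ∀ i, ‖E.coeff i E.N t‖ + c.η < c.R
  α_pos : ∀ i k, M.IsNode i k → 0 < c.α i k
  γ_pos : ∀ i k, M.IsNode i k → 0 < c.γ i k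
  /-- the constants depend only on `κ = (f, k / N)`, not on the determination of `f` -/
  well_defined : ∀ i j k, M.IsNode i k → M.IsNode j k →
    (∃ ζ : ℂ, ζ ^ E.N = 1 ∧
      ∀ l < k, ∀ᶠ t in 𝓝 (0 : Param m), E.coeff j l t = ζ ^ l * E.coeff i l t) →
    c.α i k = c.α j k ∧ c.β i k = c.β j k ∧ c.γ i k = c.γ j k
  α_lt : ∀ᶠ t in 𝓝 (0 : Param m), ∀ i k j, M.IsNode i k → M.HasCore i k → M.Fits i k j →
    c.α i k < ‖E.coeff j k t‖ - c.γ i k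
  lt_β : ∀ᶠ t in 𝓝 (0 : Param m), ∀ i k j, M.IsNode i k → M.Fits i k j →
    ‖E.coeff j k t‖ + c.γ i k < c.β i k
  /-- the disks of radius `γ_κ` about the different `a_{kj}` are disjoint -/
  disks_disjoint : ∀ᶠ t in 𝓝 (0 : Param m), ∀ i k j j', M.IsNode i k → M.Fits i k j →
    M.Fits i k j' → E.coeff j k t ≠ E.coeff j' k t →
    2 * c.γ i k < ‖E.coeff j k t - E.coeff j' k t‖

/-- The neighbourhoods `|y - g| ≤ ρ |x ^ p|` of Puiseux polynomials `g` that bound `A`- and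
`D`-pieces from outside: the cone about the tangent line of the `i`-th series; the disk of radius
`γ_κ` about `f + a_{ki} x ^ (k / N)`, and the disk of radius `α_κ` about `f`, for the pair
`κ = (f, k / N)` represented by `(i, k)`. -/
inductive Disk (d : ℕ) : Type
  | cone (i : Fin d)
  | around (i : Fin d) (k : ℕ)
  | core (i : Fin d) (k : ℕ)

namespace Disk

variable {m d : ℕ} {P : Param m → ℂ → ℂ[X]} {E : PuiseuxExpansion d P}

/-- The disk is present in the carrousel. -/
def Valid (M : Truncation E) : Disk d → Prop
  | cone _ => True
  | around i k => M.IsNode i k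
  | core i k => M.IsNode i k ∧ M.HasCore i k

/-- The exponent `p`, multiplied by `N`. -/
def order (E : PuiseuxExpansion d P) : Disk d → ℕ
  | cone _ => E.N
  | around _ k => k
  | core _ k => k

/-- The constant `ρ`. -/
def radius (c : Constants d) : Disk d → ℝ
  | cone _ => c.η
  | around i k => c.γ i k
  | core i k => c.α i k

/-- The Puiseux polynomial `g`. -/
noncomputable def center (E : PuiseuxExpansion d P) : Disk d → Param m → ℂ → ℂ
  | cone i => fun t w => E.coeff i E.N t * w ^ E.N
  | around i k => fun t w => E.partialSum i (k + 1) t w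
  | core i k => fun t w => E.partialSum i k t w

/-- The `j`-th series starts with `g`: its terms of exponent `≤ p` are those of `g`. -/
def Enters (E : PuiseuxExpansion d P) : Disk d → Fin d → Prop
  | cone i, j => E.Agree i j (E.N + 1)
  | around i k, j => E.Agree i j (k + 1)
  | core i k, j => E.Agree i j k ∧ ∀ᶠ t in 𝓝 (0 : Param m), E.coeff j k t = 0

/-- `κ' = (g, k' / N)`, represented by `(j, k')`, is the next pair inside the disk. -/
def IsNext (M : Truncation E) (D : Disk d) (j : Fin d) (k' : ℕ) : Prop :=
  D.Enters E j ∧ M.IsNode j k' ∧ D.order E < k' ∧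
    ∀ j' k'', D.Enters E j' → M.IsNode j' k'' → D.order E < k'' → k' ≤ k''

end Disk

/-- Labels of the pieces of a carrousel decomposition, the same for all `t`: the conical piece
outside the cones about the tangent lines; the piece `B_κ` for `κ` represented by `(i, k)`; the
`A`-piece between a disk and the next piece `B_κ'` inside it, with `κ'` represented by `(j, k')`;
the `D`-piece formed by a disk without such a piece inside. -/
inductive Piece (d : ℕ) : Type
  | conical
  | B (i : Fin d) (k : ℕ)
  | A (K : Disk d) (j : Fin d) (k' : ℕ)
  | D (K : Disk d)

/-- The ball `|x| ≤ ε`, `|y| ≤ R ε`. -/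
def ball (R ε : ℝ) : Set (ℂ × ℂ) := {p | ‖p.1‖ ≤ ε ∧ ‖p.2‖ ≤ R * ε}

/-- The cone `|y - a₁(t) x| ≤ η |x|`, `|x| ≤ ε` about the tangent line of the `i`-th series. -/
def cone {m d : ℕ} {P : Param m → ℂ → ℂ[X]} (E : PuiseuxExpansion d P) (c : Constants d) (ε : ℝ)
    (t : Param m) (i : Fin d) : Set (ℂ × ℂ) :=
  {p | ‖p.1‖ ≤ ε ∧ ‖p.2 - E.coeff i E.N t * p.1‖ ≤ c.η * ‖p.1‖}

namespace Piece

variable {m d : ℕ} {P : Param m → ℂ → ℂ[X]} {E : PuiseuxExpansion d P}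

/-- The labels that occur. -/
def Valid (M : Truncation E) : Piece d → Prop
  | conical => True
  | B i k => M.IsNode i k
  | A K j k' => K.Valid M ∧ K.IsNext M j k'
  | D K => K.Valid M ∧ ¬ ∃ j k', K.IsNext M j k'

/-- The values of `a` for which the curve `y = f + a x ^ (k / N)` lies in `B_κ`, for the pair
`κ = (f, k / N)` represented by `(i, k)`. -/
def bRegion (M : Truncation E) (c : Constants d) (i : Fin d) (k : ℕ) (t : Param m) : Set ℂ :=
  {a | ‖a‖ ≤ c.β i k ∧ (M.HasCore i k → c.α i k ≤ ‖a‖) ∧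
    ∀ j, M.Fits i k j → c.γ i k ≤ ‖a - E.coeff j k t‖}

/-- The pieces of the carrousel decomposition of the ball for `Δ_t`. -/
def carrier (M : Truncation E) (c : Constants d) (ε : ℝ) (t : Param m) : Piece d → Set (ℂ × ℂ)
  | conical => {p | p ∈ ball c.R ε ∧ ∀ i, c.η * ‖p.1‖ ≤ ‖p.2 - E.coeff i E.N t * p.1‖}
  | B i k => {p | ‖p.1‖ ≤ ε ∧ ∃ w : ℂ, w ^ E.N = p.1 ∧
      ‖p.2 - E.partialSum i k t w‖ ≤ c.β i k * ‖w‖ ^ k ∧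
      (M.HasCore i k → c.α i k * ‖w‖ ^ k ≤ ‖p.2 - E.partialSum i k t w‖) ∧
      ∀ j, M.Fits i k j →
        c.γ i k * ‖w‖ ^ k ≤ ‖p.2 - (E.partialSum i k t w + E.coeff j k t * w ^ k)‖}
  | A K j k' => {p | ‖p.1‖ ≤ ε ∧ ∃ w : ℂ, w ^ E.N = p.1 ∧
      c.β j k' * ‖w‖ ^ k' ≤ ‖p.2 - K.center E t w‖ ∧
      ‖p.2 - K.center E t w‖ ≤ K.radius c * ‖w‖ ^ K.order E}
  | D K => {p | ‖p.1‖ ≤ ε ∧ ∃ w : ℂ, w ^ E.N = p.1 ∧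
      ‖p.2 - K.center E t w‖ ≤ K.radius c * ‖w‖ ^ K.order E}

/-- The leaves of the foliations of the pieces by complex curves:
* complex lines through the origin in the conical piece;
* `y = f + a x ^ (k / N)` in `B_κ`, and `y = g + a x ^ p` in a `D`-piece `|y - g| ≤ ρ |x ^ p|`;
* the immersed curves `y = g + b(r) e ^ (iθ) x ^ r`, with `x ^ r` continued along all paths, where
  `p ≤ r ≤ p'` and `b` is the affine function with `b(p) = ρ` and `b(p') = β_κ'`, in an `A`-piece
  `β_κ' |x ^ p'| ≤ |y - g| ≤ ρ |x ^ p|`. -/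
def leaves (M : Truncation E) (c : Constants d) (ε : ℝ) (t : Param m) :
    Piece d → Set (Set (ℂ × ℂ))
  | conical => {L | L = {p | p ∈ ball c.R ε ∧ p.1 = 0} ∨
      ∃ a : ℂ, (∀ i, c.η ≤ ‖a - E.coeff i E.N t‖) ∧ L = {p | p ∈ ball c.R ε ∧ p.2 = a * p.1}}
  | B i k => {L | ∃ a ∈ bRegion M c i k t, L = {p | ‖p.1‖ ≤ ε ∧ ∃ w : ℂ, w ^ E.N = p.1 ∧
      p.2 = E.partialSum i k t w + a * w ^ k}}
  | A K j k' => {L | ∃ r θ : ℝ, (K.order E / E.N : ℝ) ≤ r ∧ r ≤ (k' / E.N : ℝ) ∧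
      L = {p | p = 0 ∨ ‖p.1‖ ≤ ε ∧ ∃ z : ℂ, Complex.exp z = p.1 ∧
        p.2 = K.center E t (Complex.exp (z / E.N)) +
          ((c.β j k' + ((k' / E.N : ℝ) - r) / ((k' / E.N : ℝ) - (K.order E / E.N : ℝ)) *
            (K.radius c - c.β j k') : ℝ) : ℂ) * Complex.exp (θ * Complex.I) *
            Complex.exp (r * z)}}
  | D K => {L | ∃ a : ℂ, ‖a‖ ≤ K.radius c ∧ L = {p | ‖p.1‖ ≤ ε ∧ ∃ w : ℂ, w ^ E.N = p.1 ∧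
      p.2 = K.center E t w + a * w ^ K.order E}}

end Piece

/-! ### Trivializations -/

/-- The product of the ball `|x| ≤ ε`, `|y| ≤ R ε` with the ball of radius `δ` in the parameter
space. -/
def domain (m : ℕ) (R ε δ : ℝ) : Set (ℂ × ℂ × Param m) :=
  {p | (p.1, p.2.1) ∈ ball R ε ∧ p.2.2 ∈ Metric.ball (0 : Param m) δ}

/-- The map `φ_t` of `ℂ²`. -/
def slice {m : ℕ} (φ : ℂ × ℂ × Param m → ℂ × ℂ × Param m) (t : Param m) (p : ℂ × ℂ) : ℂ × ℂ :=
  ((φ (p.1, p.2, t)).1, (φ (p.1, p.2, t)).2.1)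

/-- `φ` trivializes the family of foliated carrousel decompositions. -/
structure IsTrivialization {m d : ℕ} {P : Param m → ℂ → ℂ[X]} {E : PuiseuxExpansion d P}
    (M : Truncation E) (c : Constants d) (ε δ : ℝ)
    (φ : ℂ × ℂ × Param m → ℂ × ℂ × Param m) : Prop where
  bijOn : Set.BijOn φ (domain m c.R ε δ) (domain m c.R ε δ)
  bilipschitz : ∃ K : ℝ, 0 < K ∧ ∀ p ∈ domain m c.R ε δ, ∀ q ∈ domain m c.R ε δ,
    dist (φ p) (φ q) ≤ K * dist p q ∧ dist p q ≤ K * dist (φ p) (φ q)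
  /-- each `φ_t` is semi-algebraic -/
  semialgebraic_slice : ∀ t ∈ Metric.ball (0 : Param m) δ,
    IsSemialgebraicMapOn (slice φ t) (ball c.R ε)
  /-- if the family of curves is semi-algebraic, then `φ` is semi-algebraic -/
  semialgebraic : (∀ k : ℕ, ∃ U ∈ 𝓝 (0 : Param m × ℂ),
      IsSemialgebraicMapOn (fun q : Param m × ℂ => (P q.1 q.2).coeff k) U) →
    IsSemialgebraicMapOn φ (domain m c.R ε δ)
  x_eq : ∀ p ∈ domain m c.R ε δ, (φ p).1 = p.1
  t_eq : ∀ p ∈ domain m c.R ε δ, (φ p).2.2 = p.2.2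
  image_cone : ∀ t ∈ Metric.ball (0 : Param m) δ, ∀ i,
    slice φ t '' cone E c ε t i = cone E c ε 0 i
  image_piece : ∀ t ∈ Metric.ball (0 : Param m) δ, ∀ Q : Piece d, Q.Valid M →
    slice φ t '' Q.carrier M c ε t = Q.carrier M c ε 0
  /-- `φ_t` maps the leaves of each piece to the leaves of the corresponding piece -/
  image_leaves : ∀ t ∈ Metric.ball (0 : Param m) δ, ∀ Q : Piece d, Q.Valid M →
    (fun L => slice φ t '' L) '' Q.leaves M c ε t = Q.leaves M c ε 0
  /-- on the boundary of a cone, `φ_t` maps complex lines to complex lines -/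
  boundary_lines : ∀ t ∈ Metric.ball (0 : Param m) δ, ∀ (i : Fin d) (a : ℂ),
    ‖a - E.coeff i E.N t‖ = c.η → ∃ a' : ℂ, ‖a' - E.coeff i E.N 0‖ = c.η ∧
      ∀ x : ℂ, ‖x‖ ≤ ε → slice φ t (x, a * x) = (x, a' * x)

end Carrousel

open Carrousel

namespace Carrousel

/-! ### Continuous and holomorphic choices of the roots of a family of polynomials -/

/-! After the substitution x = w ^ N the roots of P are holomorphic functions of (t, w). To find
them, pull the roots back by x = exp z to a half space, which is simply connected, so that they
become continuous global functions. The translation by 2πi permutes these, hence a power of it fixes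
them all. The resulting functions on the punctured disk extend analytically across w = 0 by Cauchy's
integral formula, applied to an analytic map into the Banach algebra of continuous functions on a
circle (`analyticAt_extension`, `nonempty_puiseuxExpansion`).

The decisive consequence of equisingularity is `exists_coeff_ne`: at the first exponent where two
series differ, the coefficients differ already at t = 0. Therefore the combinatorics of the
carrousel does not change with t, and all strict inequalities between the finitely many coefficients
involved hold near t = 0 with a common margin τ (`Fit`, `exists_fit`).

The trivialization is explicit. Let b and b' be the coefficients at t and at 0. Each cone and each
disk of radius γ, at the exponent l / N, contributes to the displacement of y the term (b' - b) w ^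
l inside the disk, damped to 0 in a collar of relative width τ (`bump`). If several series pass
through one disk, each gets an equal share. A point f + a x ^ (k / N) lies deep inside the larger
disks around the series with initial part f and far from the other larger disks, so these move f
exactly to f'; the disks at level k change a by `leafMap`; only smaller disks can add a further term
(`displacement_eq`). On B-leaves the smaller disks contribute nothing, so leaves go to leaves. In A-
and D-pieces the map is a translation by the difference of the centers, which preserves both kinds
of leaves there. Outside the cones it maps lines to lines.

For t near 0 the displacement is Lipschitz in y with constant 1/2, so the map is bijective on every
fiber. It does not depend on the root w of x, because the determinations permute the summands
(`Close.displacement_mul`). It is Lipschitz in x in spite of the fractional powers, because only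
powers w ^ l with l ≥ N matter (`exists_close_roots`). It is semi-algebraic because it is built from
polynomials, norms, maxima and minima, with w existentially quantified. For a semi-algebraic family
the Puiseux coefficients are semi-algebraic as well, being characterized by a first-order formula
(`PuiseuxExpansion.germSA_coeff`). -/

theorem isRoot_prod_iff {d : ℕ} (f : Fin d → ℂ) (y : ℂ) :
    (∏ i, (Polynomial.X - Polynomial.C (f i))).IsRoot y ↔ ∃ i, y = f i := by
  simp [Polynomial.IsRoot, Polynomial.eval_prod, Finset.prod_eq_zero_iff, sub_eq_zero]

/-- The local branches make the projection of the root space a closed local homeomorphism with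
finite fibers, and such a map is a covering. -/
theorem isCoveringMap_roots {X : Type*} [TopologicalSpace X] [T2Space X] {d : ℕ} {P : X → ℂ[X]}
    (h : ∀ p, ∃ ψ : Fin d → X → ℂ, (∀ i, ContinuousAt (ψ i) p) ∧
      Function.Injective (fun i => ψ i p) ∧
      ∀ᶠ q in 𝓝 p, P q = ∏ i, (Polynomial.X - Polynomial.C (ψ i q))) :
    IsCoveringMap (fun e : {e : X × ℂ // (P e.1).IsRoot e.2} => e.1.1) := by
  set f := fun e : {e : X × ℂ // (P e.1).IsRoot e.2} => e.1.1 with hf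
  have fcont : Continuous f := continuous_fst.comp continuous_subtype_val
  rw [isCoveringMap_iff_isCoveringMapOn_univ]
  have fopen : IsOpenMap f := by
    rw [isOpenMap_iff_nhds_le]
    rintro ⟨⟨p, y⟩, hy⟩ s hs
    obtain ⟨ψ, hψ, hinj, hP⟩ := h p
    obtain ⟨i, hi⟩ := (isRoot_prod_iff _ _).1 (hP.self_of_nhds ▸ hy)
    simp only at hi
    obtain ⟨t, ht, hts⟩ := (mem_nhds_induced Subtype.val _ _).1 (mem_map.1 hs)
    change s ∈ 𝓝 p
    have h1 : Tendsto (fun q => (q, ψ i q)) (𝓝 p) (𝓝 (p, y)) := by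
      rw [hi]; exact continuousAt_id.prodMk (hψ i)
    filter_upwards [h1 ht, hP] with q hq hq'
    exact hts (a := ⟨(q, ψ i q), by rw [hq']; exact (isRoot_prod_iff _ _).2 ⟨i, rfl⟩⟩) hq
  refine IsClosedMap.isCoveringMapOn_of_isLocalHomeomorphOn ?_ ?_ ?_
  · rw [isClosedMap_iff_comap_nhds_le]
    intro p s hs
    obtain ⟨ψ, hψ, hinj, hP⟩ := h p
    have h1 : ∀ i, ∀ᶠ q in 𝓝 p, ∀ hq : (P q).IsRoot (ψ i q), (⟨(q, ψ i q), hq⟩ :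
        {e : X × ℂ // (P e.1).IsRoot e.2}) ∈ s := by
      intro i
      have hroot : (P p).IsRoot (ψ i p) := by
        rw [hP.self_of_nhds]; exact (isRoot_prod_iff _ _).2 ⟨i, rfl⟩
      have h2 : s ∈ 𝓝 (⟨(p, ψ i p), hroot⟩ : {e : X × ℂ // (P e.1).IsRoot e.2}) :=
        mem_nhdsSet_iff_forall.1 hs _ rfl
      obtain ⟨t, ht, hts⟩ := (mem_nhds_induced Subtype.val _ _).1 h2
      have h1 : Tendsto (fun q => (q, ψ i q)) (𝓝 p) (𝓝 (p, ψ i p)) :=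
        continuousAt_id.prodMk (hψ i)
      filter_upwards [h1 ht] with q hq hq'
      exact hts hq
    refine mem_comap.2 ⟨_, (eventually_all.2 h1).and hP, ?_⟩
    rintro ⟨⟨q, y⟩, hy⟩ ⟨hq1, hq2⟩
    simp only [hf] at hq1 hq2
    obtain ⟨i, hi⟩ := (isRoot_prod_iff _ _).1 (hq2 ▸ hy)
    simp only at hi
    subst hi
    exact hq1 i hy
  · intro p _
    obtain ⟨ψ, hψ, hinj, hP⟩ := h p
    have hP := hP.self_of_nhds
    refine Set.Finite.of_finite_image (f := fun e => e.1.2)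
      ((Set.finite_range fun i => ψ i p).subset ?_) ?_
    · rintro _ ⟨⟨⟨q, y⟩, hy⟩, rfl, rfl⟩
      obtain ⟨i, hi⟩ := (isRoot_prod_iff _ _).1 (hP ▸ hy)
      exact ⟨i, hi.symm⟩
    · rintro ⟨⟨q, y⟩, hy⟩ hq ⟨⟨q', y'⟩, hy'⟩ hq' hyy
      exact Subtype.ext (Prod.ext (hq.trans hq'.symm) hyy)
  · rw [isLocalHomeomorphOn_iff_isOpenEmbedding_restrict]
    rintro ⟨⟨p, y⟩, hy⟩ -
    obtain ⟨ψ, hψ, hinj, hP⟩ := h p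
    obtain ⟨i, hi⟩ := (isRoot_prod_iff _ _).1 (hP.self_of_nhds ▸ hy)
    simp only at hi
    subst hi
    have h1 : ∀ j, ∀ᶠ e in 𝓝 ((p, ψ i p) : X × ℂ), e.2 = ψ j e.1 → j = i := by
      intro j
      by_cases hji : j = i
      · exact Eventually.of_forall fun _ _ => hji
      have h2 : Tendsto (fun e : X × ℂ => e.2 - ψ j e.1) (𝓝 (p, ψ i p)) (𝓝 (ψ i p - ψ j p)) :=
        continuousAt_snd.sub ((hψ j).comp_of_eq continuousAt_fst rfl)
      have h3 := h2.eventually_ne (sub_ne_zero.2 fun h4 => hji (hinj h4.symm))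
      filter_upwards [h3] with e he he'
      exact absurd (sub_eq_zero.2 he') he
    have h2 : ∀ᶠ e in 𝓝 ((p, ψ i p) : X × ℂ), (P e.1).IsRoot e.2 → e.2 = ψ i e.1 := by
      filter_upwards [eventually_all.2 h1, continuousAt_fst.eventually hP] with e he hPe hr
      obtain ⟨j, hj⟩ := (isRoot_prod_iff _ _).1 (hPe ▸ hr)
      rw [← he j hj]; exact hj
    obtain ⟨U, hU, hUo, hpU⟩ := eventually_nhds_iff.1 h2
    have hV : IsOpen (Subtype.val ⁻¹' U : Set {e : X × ℂ // (P e.1).IsRoot e.2}) :=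
      hUo.preimage continuous_subtype_val
    refine ⟨_, hV.mem_nhds hpU, ?_⟩
    refine .of_continuous_injective_isOpenMap (fcont.comp continuous_subtype_val) ?_
      (fopen.comp hV.isOpenMap_subtype_val)
    rintro ⟨⟨⟨q, y⟩, hy⟩, hq⟩ ⟨⟨⟨q', y'⟩, hy'⟩, hq'⟩ hqq
    have hqq' : q = q' := hqq
    subst hqq'
    have e1 : y = ψ i q := hU _ hq hy
    have e2 : y' = ψ i q := hU _ hq' hy'
    simp [e1, e2]

/-- The branches are the lifts of the identity through the roots over one base point. The last
clause, uniqueness of lifts, is what makes the monodromy a permutation of the branches later on. -/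
theorem exists_continuous_roots {X : Type*} [TopologicalSpace X] [T2Space X]
    [SimplyConnectedSpace X] [LocallyPathConnectedSpace X] {d : ℕ} {P : X → ℂ[X]}
    (h : ∀ p, ∃ ψ : Fin d → X → ℂ, (∀ i, ContinuousAt (ψ i) p) ∧
      Function.Injective (fun i => ψ i p) ∧
      ∀ᶠ q in 𝓝 p, P q = ∏ i, (Polynomial.X - Polynomial.C (ψ i q))) :
    ∃ g : Fin d → X → ℂ, (∀ i, Continuous (g i)) ∧ (∀ q, Function.Injective fun i => g i q) ∧
      (∀ q, P q = ∏ i, (Polynomial.X - Polynomial.C (g i q))) ∧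
      ∀ k : X → ℂ, Continuous k → (∀ q, (P q).IsRoot (k q)) → ∃ i, k = g i := by
  have cov := isCoveringMap_roots h
  obtain ⟨p⟩ : Nonempty X := inferInstance
  obtain ⟨ψ, hψ, hinj, hP⟩ := h p
  have hP := hP.self_of_nhds
  have hr : ∀ i, (P p).IsRoot (ψ i p) := fun i => by
    rw [hP]; exact (isRoot_prod_iff _ _).2 ⟨i, rfl⟩
  have key := fun i => cov.existsUnique_continuousMap_lifts (ContinuousMap.id X) p
    ⟨(p, ψ i p), hr i⟩ rfl
  choose F hF hFu using key
  have hF1 : ∀ i q, (F i q).1.1 = q := fun i q => congrFun (hF i).2 q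
  have hroot : ∀ i q, (P q).IsRoot (F i q).1.2 := fun i q => by
    have := (F i q).2; rwa [hF1] at this
  have hinj' : ∀ q, Function.Injective fun i => (F i q).1.2 := by
    intro q i j hij
    have h1 : (F i : X → _) = F j := cov.eq_of_comp_eq (F i).continuous (F j).continuous
      ((hF i).2.trans (hF j).2.symm) q
      (Subtype.ext (Prod.ext ((hF1 i q).trans (hF1 j q).symm) hij))
    have h2 := congrFun h1 p
    rw [(hF i).1, (hF j).1] at h2
    exact hinj (congrArg (fun e => e.1.2) h2)
  refine ⟨fun i q => (F i q).1.2, fun i =>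
    continuous_snd.comp (continuous_subtype_val.comp (F i).continuous), hinj', ?_, ?_⟩
  · intro q
    obtain ⟨ψ', -, hinj'', hP'⟩ := h q
    have hP' := hP'.self_of_nhds
    rw [hP']
    have h1 : ∀ i, ∃ j, (F i q).1.2 = ψ' j q := fun i =>
      (isRoot_prod_iff _ _).1 (hP' ▸ hroot i q)
    choose σ hσ using h1
    have hσi : Function.Injective σ := fun i j hij => hinj' q (by
      simp only [hσ, hij])
    have hσb : Function.Bijective σ := Finite.injective_iff_bijective.1 hσi
    exact (Function.Bijective.prod_comp hσb
      (fun j => Polynomial.X - Polynomial.C (ψ' j q))).symm.trans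
      (Finset.prod_congr rfl fun i _ => by rw [← hσ])
  · intro k hk hkr
    obtain ⟨i, hi⟩ := (isRoot_prod_iff _ _).1 (hP ▸ hkr p)
    refine ⟨i, ?_⟩
    have h1 := hFu i ⟨fun q => ⟨(q, k q), hkr q⟩, by fun_prop⟩
      ⟨Subtype.ext (Prod.ext rfl hi), rfl⟩
    funext q
    simp only [← h1]
    rfl

/-- The analytic implicit function theorem. -/
theorem exists_analytic_implicit {E₁ A : Type*} [NormedAddCommGroup E₁] [NormedSpace ℂ E₁]
    [CompleteSpace E₁] [NormedAddCommGroup A] [NormedSpace ℂ A] [CompleteSpace A]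
    {Φ : E₁ × A → A} {u : E₁ × A} (hΦ : AnalyticAt ℂ Φ u) (Ψ : A ≃L[ℂ] A)
    (hΨ : HasFDerivAt (fun y => Φ (u.1, y)) (Ψ : A →L[ℂ] A) u.2) :
    ∃ ψ : E₁ → A, AnalyticAt ℂ ψ u.1 ∧ ψ u.1 = u.2 ∧ ∀ᶠ v in 𝓝 u, Φ v = Φ u ↔ ψ v.1 = v.2 := by
  have h1 : ContDiffAt ℂ ⊤ Φ u := hΦ.contDiffAt
  have h2 : (fderiv ℂ Φ u ∘L .inr ℂ E₁ A).IsInvertible := by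
    refine ⟨Ψ, ?_⟩
    refine hΨ.unique ?_
    have h3 : HasFDerivAt (fun y : A => (u.1, y)) (ContinuousLinearMap.inr ℂ E₁ A) u.2 :=
      hasFDerivAt_prodMk_right u.1 u.2
    exact HasFDerivAt.comp u.2 (g := Φ) hΦ.differentiableAt.hasFDerivAt h3
  refine ⟨h1.implicitFunction (by simp) h2, (h1.contDiffAt_implicitFunction _ h2).analyticAt,
    h1.implicitFunction_apply_self _ h2, h1.eventually_apply_eq_iff_implicitFunction _ h2⟩

theorem eval_eq_sum_coeff_of_monic {d : ℕ} {p : ℂ[X]} (hp : p.natDegree = d) (y : ℂ) :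
    p.eval y = ∑ k ∈ Finset.range (d + 1), p.coeff k * y ^ k := by
  rw [Polynomial.eval_eq_sum_range, hp]

theorem monic_eq_prod {d : ℕ} {p : ℂ[X]} (hp : p.Monic) (hd : p.natDegree = d) {f : Fin d → ℂ}
    (hf : Function.Injective f) (hr : ∀ i, p.IsRoot (f i)) :
    p = ∏ i, (Polynomial.X - Polynomial.C (f i)) := by
  refine Polynomial.eq_of_monic_of_dvd_of_natDegree_le
    (Polynomial.monic_prod_of_monic _ _ fun i _ => Polynomial.monic_X_sub_C _) hp ?_ ?_
  · refine Finset.prod_dvd_of_coprime ?_ fun i _ => Polynomial.dvd_iff_isRoot.2 (hr i)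
    intro i _ j _ hij
    exact Polynomial.pairwise_coprime_X_sub_C hf hij
  · rw [hd, Polynomial.natDegree_prod_of_monic _ _ fun i _ => Polynomial.monic_X_sub_C _]
    simp

/-- Near a parameter where a monic polynomial is separable, its roots are analytic functions. -/
theorem exists_analytic_roots {E₁ : Type*} [NormedAddCommGroup E₁] [NormedSpace ℂ E₁]
    [CompleteSpace E₁] {d : ℕ} {P : E₁ → ℂ[X]} {p : E₁}
    (hmon : ∀ᶠ q in 𝓝 p, (P q).Monic ∧ (P q).natDegree = d)
    (han : ∀ k, AnalyticAt ℂ (fun q => (P q).coeff k) p) (hsep : (P p).Separable) :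
    ∃ ψ : Fin d → E₁ → ℂ, (∀ i, AnalyticAt ℂ (ψ i) p) ∧ Function.Injective (fun i => ψ i p) ∧
      ∀ᶠ q in 𝓝 p, P q = ∏ i, (Polynomial.X - Polynomial.C (ψ i q)) := by
  obtain ⟨hm, hd⟩ := hmon.self_of_nhds
  have hcard : (P p).roots.toFinset.card = d := by
    rw [Multiset.toFinset_card_of_nodup (Polynomial.nodup_roots hsep), ← hd]
    exact (IsAlgClosed.splits (P p)).natDegree_eq_card_roots.symm
  let e : Fin d ≃ (P p).roots.toFinset := (Finset.equivFinOfCardEq hcard).symm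
  have hroot : ∀ i, (P p).IsRoot (e i).1 := fun i =>
    Polynomial.isRoot_of_mem_roots (Multiset.mem_toFinset.1 (e i).2)
  let Φ : E₁ × ℂ → ℂ := fun v => ∑ k ∈ Finset.range (d + 1), (P v.1).coeff k * v.2 ^ k
  have key : ∀ i, ∃ ψ : E₁ → ℂ, AnalyticAt ℂ ψ p ∧ ψ p = e i ∧
      ∀ᶠ q in 𝓝 p, (P q).IsRoot (ψ q) := by
    intro i
    have hΦ : AnalyticAt ℂ Φ (p, (e i : ℂ)) := by
      refine Finset.analyticAt_fun_sum _ fun k _ => ?_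
      have h1 : AnalyticAt ℂ (fun v : E₁ × ℂ => (P v.1).coeff k) (p, (e i : ℂ)) :=
        (han k).comp_of_eq analyticAt_fst rfl
      exact h1.mul (analyticAt_snd.pow k)
    have hder : (P p).derivative.eval (e i : ℂ) ≠ 0 := by
      have := hsep.aeval_derivative_ne_zero (x := (e i : ℂ)) (by simpa using hroot i)
      simpa using this
    have hΦp : ∀ y, Φ (p, y) = (P p).eval y := fun y =>
      (eval_eq_sum_coeff_of_monic hd y).symm
    obtain ⟨ψ, h1, h2, h3⟩ := exists_analytic_implicit (u := (p, (e i : ℂ))) hΦ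
      (ContinuousLinearEquiv.unitsEquivAut ℂ (Units.mk0 _ hder)) (by
        simp only [hΦp]
        have h4 := ((P p).hasDerivAt (e i : ℂ)).hasFDerivAt
        exact h4.congr_fderiv (by ext; simp))
    refine ⟨ψ, h1, h2, ?_⟩
    have h4 : Tendsto (fun q => (q, ψ q)) (𝓝 p) (𝓝 (p, (e i : ℂ))) := by
      have h5 : ψ p = e i := h2
      rw [← h5]; exact continuousAt_id.prodMk h1.continuousAt
    filter_upwards [h4.eventually h3, hmon] with q hq hq'
    have h5 : Φ (q, ψ q) = 0 := by
      rw [hq.2 rfl, hΦp]; exact hroot i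
    rwa [Polynomial.IsRoot, eval_eq_sum_coeff_of_monic hq'.2]
  choose ψ hψ hψp hψr using key
  have hinj : Function.Injective (fun i => ψ i p) := by
    intro i j hij
    simp only [hψp] at hij
    exact e.injective (Subtype.ext hij)
  refine ⟨ψ, hψ, hinj, ?_⟩
  have h1 : ∀ i j, i ≠ j → ∀ᶠ q in 𝓝 p, ψ i q ≠ ψ j q := by
    intro i j hij
    have h2 := ((hψ i).continuousAt.sub (hψ j).continuousAt).eventually_ne
      (sub_ne_zero.2 fun h => hij (hinj h))
    filter_upwards [h2] with q hq
    exact sub_ne_zero.1 hq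
  have h2 : ∀ᶠ q in 𝓝 p, ∀ i j, i ≠ j → ψ i q ≠ ψ j q :=
    eventually_all.2 fun i => eventually_all.2 fun j => by
      by_cases hij : i = j
      · simp [hij]
      · filter_upwards [h1 i j hij] with q hq _ using hq
  filter_upwards [h2, hmon, eventually_all.2 hψr] with q hq hq' hqr
  exact monic_eq_prod hq'.1 hq'.2 (fun i j hij => by_contra fun h => hq i j h hij) hqr

end Carrousel

/-! ### Roots over the punctured disk, by way of the logarithm -/

namespace Carrousel

/-- The half space `‖t‖ < r`, `Re z < log r`, whose image under `(t, z) ↦ (t, exp z)` is the part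
`x ≠ 0` of a ball. -/
def logDomain (m : ℕ) (r : ℝ) : Set (Param m × ℂ) := {p | ‖p.1‖ < r ∧ p.2.re < Real.log r}

theorem isOpen_logDomain (m : ℕ) (r : ℝ) : IsOpen (logDomain m r) := by
  have h1 : Continuous fun p : Param m × ℂ => ‖p.1‖ := by fun_prop
  have h2 : Continuous fun p : Param m × ℂ => p.2.re := by fun_prop
  exact (isOpen_lt h1 continuous_const).inter (isOpen_lt h2 continuous_const)

theorem convex_logDomain (m : ℕ) (r : ℝ) : Convex ℝ (logDomain m r) := by
  have h1 : logDomain m r = Metric.ball (0 : Param m) r ×ˢ {z : ℂ | z.re < Real.log r} := by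
    ext p; simp [logDomain]
  rw [h1]
  exact (convex_ball _ _).prod (convex_halfSpace_re_lt _)

theorem exp_mem_of_mem_logDomain {m : ℕ} {r : ℝ} (hr : 0 < r) {p : Param m × ℂ}
    (hp : p ∈ logDomain m r) : ‖(p.1, Complex.exp p.2)‖ < r := by
  rw [Prod.norm_def, max_lt_iff]
  refine ⟨hp.1, ?_⟩
  rw [Complex.norm_exp]
  exact (Real.lt_log_iff_exp_lt hr).1 hp.2

/-- The half space is convex, so the roots are global continuous functions there. The translation z
↦ z + 2πi preserves the polynomials and hence permutes these functions. -/
theorem exists_log_roots {m d : ℕ} {P : Param m → ℂ → ℂ[X]} {r : ℝ} (hr : 0 < r)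
    (h : ∀ p : Param m × ℂ, ‖p‖ < r → p.2 ≠ 0 → ∃ ψ : Fin d → Param m × ℂ → ℂ,
      (∀ i, ContinuousAt (ψ i) p) ∧ Function.Injective (fun i => ψ i p) ∧
      ∀ᶠ q in 𝓝 p, P q.1 q.2 = ∏ i, (Polynomial.X - Polynomial.C (ψ i q))) :
    ∃ N : ℕ, 0 < N ∧ ∃ G : Fin d → Param m → ℂ → ℂ,
      (∀ i, ∀ p ∈ logDomain m r, ContinuousAt (fun p : Param m × ℂ => G i p.1 p.2) p) ∧
      (∀ p ∈ logDomain m r, P p.1 (Complex.exp p.2) =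
        ∏ i, (Polynomial.X - Polynomial.C (G i p.1 p.2))) ∧
      ∀ i t, Function.Periodic (G i t) (N * (2 * Real.pi * Complex.I)) := by
  classical
  set U := logDomain m r with hU
  have hUo : IsOpen U := isOpen_logDomain m r
  have : ContractibleSpace U := (convex_logDomain m r).contractibleSpace
    ⟨(0, ((Real.log r - 1 : ℝ) : ℂ)), by simp [logDomain, hr]⟩
  have : SimplyConnectedSpace U := SimplyConnectedSpace.ofContractible U
  have : LocallyPathConnectedSpace U := hUo.locallyPathConnectedSpace
  obtain ⟨g, hgc, hgi, hgP, hgu⟩ := exists_continuous_roots (X := U) (d := d)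
    (P := fun p => P p.1.1 (Complex.exp p.1.2)) (by
      intro p
      obtain ⟨ψ, h1, h2, h3⟩ := h (p.1.1, Complex.exp p.1.2) (exp_mem_of_mem_logDomain hr p.2)
        (Complex.exp_ne_zero _)
      have hc : Continuous fun q : U => (q.1.1, Complex.exp q.1.2) := by fun_prop
      exact ⟨fun i q => ψ i (q.1.1, Complex.exp q.1.2), fun i =>
        ContinuousAt.comp (f := fun q : U => (q.1.1, Complex.exp q.1.2)) (h1 i) hc.continuousAt,
        h2, hc.continuousAt.eventually h3⟩)
  let c : ℂ := 2 * Real.pi * Complex.I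
  have hcre : c.re = 0 := by simp [c]
  have hτ : ∀ p : Param m × ℂ, (p.1, p.2 + c) ∈ U ↔ p ∈ U := fun p => by
    simp only [hU, logDomain, Set.mem_ofPred_eq, Complex.add_re, hcre, add_zero]
  let τ : U → U := fun p => ⟨(p.1.1, p.1.2 + c), (hτ _).2 p.2⟩
  have hτc : Continuous τ := by fun_prop
  have hexp : ∀ z : ℂ, Complex.exp (z + c) = Complex.exp z := Complex.exp_periodic
  have h1 : ∀ i, ∃ j, (fun q => g i (τ q)) = g j := by
    intro i
    refine hgu _ ((hgc i).comp hτc) fun q => ?_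
    have h2 := hgP (τ q)
    simp only [τ, hexp] at h2
    rw [h2]
    exact (isRoot_prod_iff _ _).2 ⟨i, rfl⟩
  choose σ hσ using h1
  have hσi : Function.Injective σ := by
    intro i j hij
    obtain ⟨q⟩ : Nonempty U := inferInstance
    exact hgi (τ q) ((congrFun (hσ i) q).trans ((hij ▸ congrFun (hσ j) q).symm))
  let s : Equiv.Perm (Fin d) := Equiv.ofBijective σ (Finite.injective_iff_bijective.1 hσi)
  have hs : ∀ n i q, g i (τ^[n] q) = g ((s ^ n) i) q := by
    intro n
    induction n with
    | zero => intro i q; rfl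
    | succ n ih =>
      intro i q
      rw [Function.iterate_succ_apply, ih, pow_succ']
      exact congrFun (hσ ((s ^ n) i)) q
  -- The order of the symmetric group kills every permutation, so it serves as N; there is no need
  -- for the least period.
  refine ⟨Fintype.card (Equiv.Perm (Fin d)), Fintype.card_pos,
    fun i t z => if hp : (t, z) ∈ U then g i ⟨(t, z), hp⟩ else 0, ?_, ?_, ?_⟩
  · intro i p hp
    have h2 : ContinuousOn (fun p : Param m × ℂ => if hp : (p.1, p.2) ∈ U then
        g i ⟨(p.1, p.2), hp⟩ else 0) U := by
      rw [continuousOn_iff_continuous_domRestrict]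
      convert hgc i using 1
      funext q
      have h3 : (q.1.1, q.1.2) ∈ U := q.2
      simp only [Set.domRestrict_apply]
      rw [dif_pos h3]
    exact h2.continuousAt (hUo.mem_nhds hp)
  · intro p hp
    have h2 : (p.1, p.2) ∈ U := hp
    simp only [dif_pos h2]
    exact hgP ⟨p, hp⟩
  · intro i t z
    have h2 : ∀ n : ℕ, (t, z + n * c) ∈ U ↔ (t, z) ∈ U := fun n => by
      simp [hU, logDomain, hcre]
    have h3 : ∀ (n : ℕ) (hz : (t, z) ∈ U), (τ^[n] ⟨(t, z), hz⟩).1 = (t, z + n * c) := by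
      intro n hz
      induction n with
      | zero => simp
      | succ n ih =>
        rw [Function.iterate_succ_apply']
        simp only [τ, ih]
        push_cast
        ring_nf
    beta_reduce
    by_cases hz : (t, z) ∈ U
    · rw [dif_pos hz, dif_pos ((h2 _).2 hz)]
      have h4 := hs (Fintype.card (Equiv.Perm (Fin d))) i ⟨(t, z), hz⟩
      rw [pow_card_eq_one] at h4
      refine Eq.trans (congrArg _ (Subtype.ext ?_)) h4
      exact (h3 _ hz).symm
    · rw [dif_neg hz, dif_neg (mt (h2 _).1 hz)]

/-- The functions of z = N log w have period 2πiN in z, so the choice of the logarithm of w is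
immaterial and the cut of the principal branch causes no discontinuity. -/
theorem exists_punctured_roots {m d : ℕ} {P : Param m → ℂ → ℂ[X]} {r : ℝ} (hr : 0 < r)
    (hr1 : r ≤ 1)
    (h : ∀ p : Param m × ℂ, ‖p‖ < r → p.2 ≠ 0 → ∃ ψ : Fin d → Param m × ℂ → ℂ,
      (∀ i, ContinuousAt (ψ i) p) ∧ Function.Injective (fun i => ψ i p) ∧
      ∀ᶠ q in 𝓝 p, P q.1 q.2 = ∏ i, (Polynomial.X - Polynomial.C (ψ i q))) :
    ∃ N : ℕ, 0 < N ∧ ∃ f : Fin d → Param m → ℂ → ℂ, ∀ p : Param m × ℂ, ‖p‖ < r → p.2 ≠ 0 →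
      (∀ i, ContinuousAt (fun p : Param m × ℂ => f i p.1 p.2) p) ∧
      P p.1 (p.2 ^ N) = ∏ i, (Polynomial.X - Polynomial.C (f i p.1 p.2)) := by
  obtain ⟨N, hN, G, hGc, hGP, hGp⟩ := exists_log_roots hr h
  have hN0 : (N : ℂ) ≠ 0 := Nat.cast_ne_zero.2 hN.ne'
  have hlog : ∀ (i : Fin d) (t : Param m) (z w : ℂ), Complex.exp z = w →
      G i t (N * Complex.log w) = G i t (N * z) := by
    intro i t z w hzw
    have hw : w ≠ 0 := hzw ▸ Complex.exp_ne_zero z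
    obtain ⟨n, hn⟩ := Complex.exp_eq_exp_iff_exists_int.1 (hzw.trans (Complex.exp_log hw).symm)
    rw [hn, mul_add]
    have := (hGp i t).int_mul n (N * Complex.log w)
    rw [← this]
    congr 1
    ring
  have hmem : ∀ (t : Param m) (z w : ℂ), Complex.exp z = w → ‖(t, w)‖ < r →
      (t, (N : ℂ) * z) ∈ logDomain m r := by
    intro t z w hzw hw
    rw [Prod.norm_def, max_lt_iff] at hw
    refine ⟨hw.1, ?_⟩
    have h1 : ((N : ℂ) * z).re = N * z.re := by simp
    simp only [h1]
    rw [Real.lt_log_iff_exp_lt hr, mul_comm, Real.exp_mul, ← Complex.norm_exp, hzw,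
      Real.rpow_natCast]
    exact (pow_le_of_le_one (norm_nonneg _) (hw.2.le.trans hr1) hN.ne').trans_lt hw.2
  refine ⟨N, hN, fun i t w => G i t (N * Complex.log w), ?_⟩
  rintro ⟨t, w⟩ hp hw
  simp only at hw ⊢
  refine ⟨fun i => ?_, ?_⟩
  · have h1 := hGc i _ (hmem t (Complex.log w) w (Complex.exp_log hw) hp)
    -- A branch of the logarithm that is continuous near the given w, also when w lies on the cut.
    have h2 : ContinuousAt (fun p : Param m × ℂ =>
        (p.1, (N : ℂ) * (Complex.log (p.2 / w) + Complex.log w))) (t, w) := by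
      refine continuousAt_fst.prodMk (continuousAt_const.mul (ContinuousAt.add ?_
        continuousAt_const))
      refine ContinuousAt.clog (by fun_prop) ?_
      simp [hw]
    have h3 := ContinuousAt.comp_of_eq (f := fun p : Param m × ℂ =>
        (p.1, (N : ℂ) * (Complex.log (p.2 / w) + Complex.log w)))
        (g := fun p : Param m × ℂ => G i p.1 p.2) h1 h2 (by simp [hw])
    refine h3.congr ?_
    have h4 : ∀ᶠ p : Param m × ℂ in 𝓝 (t, w), p.2 ≠ 0 := continuousAt_snd.eventually_ne hw
    filter_upwards [h4] with p hp
    refine (hlog i p.1 _ p.2 ?_).symm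
    rw [Complex.exp_add, Complex.exp_log (div_ne_zero hp hw), Complex.exp_log hw,
      div_mul_cancel₀ _ hw]
  · have h1 := hGP _ (hmem t (Complex.log w) w (Complex.exp_log hw) hp)
    simp only at h1
    rw [← h1, Complex.exp_nat_mul, Complex.exp_log hw]

end Carrousel

namespace Carrousel

/-! ### Analytic extension of roots across `w = 0` -/

/-- An analytic function of `(t, ζ)` is, for `ζ` on a small circle, an analytic function of `t` with
values in the continuous functions on the circle. -/
theorem exists_analytic_curry {E₁ : Type*} [NormedAddCommGroup E₁] [NormedSpace ℂ E₁]
    {c : E₁ × ℂ → ℂ} (hc : AnalyticAt ℂ c 0) :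
    ∃ s₀ : ℝ, 0 < s₀ ∧ ∀ s : ℝ, s < s₀ → ∃ C : E₁ → C(Metric.sphere (0 : ℂ) s, ℂ),
      AnalyticAt ℂ C 0 ∧ ∀ᶠ t in 𝓝 (0 : E₁), ∀ ζ, C t ζ = c (t, ζ) := by
  obtain ⟨p, R, hp⟩ := hc
  obtain ⟨s₀, hs₀, hs₀R⟩ := ENNReal.lt_iff_exists_nnreal_btwn.1 hp.r_pos
  have hs₀' : 0 < (s₀ : ℝ) := by exact_mod_cast hs₀
  refine ⟨s₀, hs₀', fun s hs => ?_⟩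
  set K := Metric.sphere (0 : ℂ) s
  -- The power series of c acts pointwise on continuous functions on the circle; its terms have
  -- norms no larger than the original ones.
  let q : FormalMultilinearSeries ℂ C(K, E₁ × ℂ) C(K, ℂ) := fun n =>
    MultilinearMap.mkContinuous
      { toFun := fun h => ⟨fun ζ => p n (fun j => h j ζ),
          (p n).cont.comp (continuous_pi fun j => (h j).continuous)⟩
        map_update_add' := by
          intro _ h j x y
          ext ζ
          have : ∀ z : C(K, E₁ × ℂ), (fun i => Function.update h j z i ζ) =
              Function.update (fun i => h i ζ) j (z ζ) := fun z => by
            funext i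
            by_cases hij : i = j
            · subst hij; simp
            · simp [hij]
          simp [this]
        map_update_smul' := by
          intro _ h j x y
          ext ζ
          have : ∀ z : C(K, E₁ × ℂ), (fun i => Function.update h j z i ζ) =
              Function.update (fun i => h i ζ) j (z ζ) := fun z => by
            funext i
            by_cases hij : i = j
            · subst hij; simp
            · simp [hij]
          simp [this] }
      ‖p n‖ (fun h => (ContinuousMap.norm_le _ (by positivity)).2 fun ζ =>
        ((p n).le_opNorm _).trans (mul_le_mul_of_nonneg_left
          (Finset.prod_le_prod (fun _ _ => norm_nonneg _) fun j _ => (h j).norm_coe_le_norm ζ)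
          (norm_nonneg _)))
  have hq : ∀ n, ‖q n‖ ≤ ‖p n‖ := fun n =>
    MultilinearMap.mkContinuous_norm_le _ (norm_nonneg _) _
  have hrad : p.radius ≤ q.radius := FormalMultilinearSeries.radius_le_of_le (fun {n} => hq n)
  have hqR : (s₀ : ENNReal) < q.radius := hs₀R.trans_le (hp.r_le.trans hrad)
  have hqf := q.hasFPowerSeriesOnBall (hs₀.trans hqR)
  let L : E₁ →L[ℂ] C(K, E₁ × ℂ) := LinearMap.mkContinuous
    { toFun := fun t => ContinuousMap.const K (t, 0)
      map_add' := fun x y => by ext <;> simp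
      map_smul' := fun x y => by ext <;> simp } 1 (fun t => by
        refine (ContinuousMap.norm_le _ (by positivity)).2 fun ζ => ?_
        simp [Prod.norm_def])
  let X₀ : C(K, E₁ × ℂ) := ⟨fun ζ => (0, ζ), by fun_prop⟩
  have hX : ∀ t ζ, (X₀ + L t) ζ = (t, (ζ : ℂ)) := fun t ζ => by simp [X₀, L]
  have hnorm : ∀ t : E₁, ‖t‖ < s₀ → ‖X₀ + L t‖ < s₀ := by
    intro t ht
    -- If s is negative, the sphere is empty, and the bound must still be nonnegative.
    have h1 : max ‖t‖ (max s 0) < s₀ := max_lt ht (max_lt hs hs₀')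
    refine lt_of_le_of_lt ((ContinuousMap.norm_le _ (by positivity)).2 fun ζ => ?_) h1
    rw [hX, Prod.norm_def]
    have h2 : ‖(ζ : ℂ)‖ = s := by simp
    exact max_le_max le_rfl (h2.le.trans (le_max_left _ _))
  refine ⟨fun t => q.sum (X₀ + L t), ?_, ?_⟩
  · have h1 : AnalyticAt ℂ q.sum (X₀ + L 0) := by
      refine hqf.analyticAt_of_mem ?_
      rw [Metric.mem_eball, edist_zero_right]
      refine lt_trans ?_ hqR
      have := hnorm 0 (by simpa using hs₀')
      rw [← ofReal_norm, ENNReal.ofReal_lt_iff_lt_toReal (norm_nonneg _) (by simp)]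
      simpa using this
    exact h1.comp (f := fun t => X₀ + L t) (analyticAt_const.add (L.analyticAt 0))
  · have h1 : ∀ᶠ t in 𝓝 (0 : E₁), ‖t‖ < s₀ := by
      have := Metric.ball_mem_nhds (0 : E₁) hs₀'
      filter_upwards [this] with t ht
      simpa using ht
    filter_upwards [h1] with t ht ζ
    have h2 := hnorm t ht
    have h3 : HasSum (fun n => q n fun _ => X₀ + L t) (q.sum (X₀ + L t)) := by
      refine q.hasSum ?_
      rw [Metric.mem_eball, edist_zero_right]
      refine lt_trans ?_ hqR
      rw [← ofReal_norm, ENNReal.ofReal_lt_iff_lt_toReal (norm_nonneg _) (by simp)]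
      simpa using h2
    have h4 := (ContinuousMap.evalCLM ℂ ζ).hasSum h3
    have h5 : HasSum (fun n => p n fun _ => (t, (ζ : ℂ))) (c (t, ζ)) := by
      have h6 : (t, (ζ : ℂ)) ∈ Metric.eball (0 : E₁ × ℂ) R := by
        rw [Metric.mem_eball, edist_zero_right]
        refine lt_trans ?_ hs₀R
        rw [← ofReal_norm, ENNReal.ofReal_lt_iff_lt_toReal (norm_nonneg _) (by simp)]
        rw [← hX t ζ]
        exact ((X₀ + L t).norm_coe_le_norm ζ).trans_lt (by simpa using h2)
      simpa using hp.hasSum h6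
    refine h4.unique ?_
    convert h5 using 2 with n
    change p n (fun _ => (X₀ + L t) ζ) = _
    rw [hX]

/-- Cauchy's integral formula, as a functional of the values on the circle. -/
theorem exists_cauchy_functional {s : ℝ} (hs : 0 < s) :
    ∃ κ : ℂ → C(Metric.sphere (0 : ℂ) s, ℂ) →L[ℂ] ℂ, AnalyticAt ℂ κ 0 ∧
      ∀ (f : ℂ → ℂ), DifferentiableOn ℂ f (Metric.closedBall 0 s) →
        ∀ Y : C(Metric.sphere (0 : ℂ) s, ℂ), (∀ ζ, Y ζ = f ζ) →
        ∀ w ∈ Metric.ball (0 : ℂ) s, κ w Y = f w := by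
  set K := Metric.sphere (0 : ℂ) s
  let γ : ℝ → K := fun θ => ⟨circleMap 0 s θ, circleMap_mem_sphere 0 hs.le θ⟩
  have hγ : Continuous γ := by
    have := continuous_circleMap 0 s
    fun_prop
  have hint : ∀ Y : C(K, ℂ), Continuous fun θ => deriv (circleMap 0 s) θ * Y (γ θ) := by
    intro Y
    have h1 : Continuous (deriv (circleMap 0 s)) := by
      have : deriv (circleMap 0 s) = fun θ => circleMap 0 s θ * Complex.I := by
        funext θ; simp [deriv_circleMap]
      rw [this]
      exact (continuous_circleMap 0 s).mul continuous_const
    fun_prop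
  let Λ : C(K, ℂ) →L[ℂ] ℂ := LinearMap.mkContinuous
    { toFun := fun Y => (2 * Real.pi * Complex.I : ℂ)⁻¹ *
        ∫ θ in (0 : ℝ)..2 * Real.pi, deriv (circleMap 0 s) θ * Y (γ θ)
      map_add' := fun x y => by
        rw [← mul_add, ← intervalIntegral.integral_add ((hint x).intervalIntegrable _ _)
          ((hint y).intervalIntegrable _ _)]
        simp [mul_add]
      map_smul' := fun a y => by
        simp only [ContinuousMap.smul_apply, smul_eq_mul, RingHom.id_apply]
        rw [mul_left_comm, ← intervalIntegral.integral_const_mul a]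
        congr 2
        funext θ
        ring }
    (‖(2 * Real.pi * Complex.I : ℂ)⁻¹‖ * (s * |2 * Real.pi - 0|)) (fun Y => by
      simp only [LinearMap.coe_mk, AddHom.coe_mk, norm_mul]
      rw [mul_assoc ‖(2 * Real.pi * Complex.I : ℂ)⁻¹‖]
      refine mul_le_mul_of_nonneg_left ?_ (norm_nonneg _)
      rw [mul_right_comm]
      refine intervalIntegral.norm_integral_le_of_norm_le_const fun θ _ => ?_
      rw [norm_mul]
      refine mul_le_mul ?_ (Y.norm_coe_le_norm _) (norm_nonneg _) hs.le
      simp [deriv_circleMap, abs_of_pos hs])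
  let Z : C(K, ℂ) := ⟨fun ζ => (ζ : ℂ), by fun_prop⟩
  have hA : ∀ w ζ, algebraMap ℂ C(K, ℂ) w ζ = w := fun w ζ => by simp
  have hZ : ∀ w ∈ Metric.ball (0 : ℂ) s, IsUnit (Z - algebraMap ℂ C(K, ℂ) w) := by
    intro w hw
    rw [ContinuousMap.isUnit_iff_forall_ne_zero]
    intro ζ
    simp only [ContinuousMap.sub_apply, ContinuousMap.coe_mk, Z, hA, ne_eq, sub_eq_zero]
    rintro rfl
    have h2 : ‖(ζ : ℂ)‖ = s := by simp
    simp [h2] at hw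
  refine ⟨fun w => Λ ∘L (ContinuousLinearMap.mul ℂ C(K, ℂ)
    (Ring.inverse (Z - algebraMap ℂ C(K, ℂ) w))), ?_, ?_⟩
  -- The Cauchy kernel 1 / (ζ - w) is an inverse in the Banach algebra C(K, ℂ), and inversion is
  -- analytic at units.
  · have h1 : AnalyticAt ℂ (fun w : ℂ => Ring.inverse (Z - algebraMap ℂ C(K, ℂ) w)) 0 := by
      obtain ⟨u, hu⟩ := hZ 0 (by simpa using hs)
      refine AnalyticAt.comp_of_eq (g := Ring.inverse) (f := fun w => Z - algebraMap ℂ C(K, ℂ) w)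
        (analyticAt_inverse u) (analyticAt_const.sub ?_) hu.symm
      exact (Algebra.linearMap ℂ C(K, ℂ)).toContinuousLinearMap.analyticAt 0
    have h2 : AnalyticAt ℂ (fun w : ℂ => ContinuousLinearMap.mul ℂ C(K, ℂ)
        (Ring.inverse (Z - algebraMap ℂ C(K, ℂ) w))) 0 :=
      ((ContinuousLinearMap.mul ℂ C(K, ℂ)).analyticAt _).comp h1
    exact ((ContinuousLinearMap.compL ℂ C(K, ℂ) C(K, ℂ) ℂ Λ).analyticAt _).comp h2
  · intro f hf Y hY w hw
    have h1 := (hf.mono (Metric.closure_ball_subset_closedBall)).diffContOnCl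
      |>.two_pi_i_inv_smul_circleIntegral_sub_inv_smul hw
    rw [← h1]
    simp only [ContinuousLinearMap.comp_apply, smul_eq_mul]
    change (2 * Real.pi * Complex.I : ℂ)⁻¹ * _ = _
    congr 1
    rw [circleIntegral]
    congr 1
    funext θ
    rw [smul_eq_mul]
    congr 1
    have h2 := Ring.inverse_mul_cancel _ (hZ w hw)
    have h3 := congrArg (fun h : C(K, ℂ) => h (γ θ)) h2
    simp only [ContinuousMap.mul_apply, ContinuousMap.sub_apply, hA, ContinuousMap.one_apply] at h3
    change Ring.inverse (Z - algebraMap ℂ C(K, ℂ) w) (γ θ) * Y (γ θ) = _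
    rw [hY]
    congr 1
    exact eq_inv_of_mul_eq_one_left h3

end Carrousel

/-! ### Existence of Puiseux expansions -/

namespace Carrousel

theorem exists_eventuallyEq_of_root {X : Type*} [TopologicalSpace X] {d : ℕ} {ψ : Fin d → X → ℂ}
    {h : X → ℂ} {p : X} (hψ : ∀ i, ContinuousAt (ψ i) p)
    (hinj : Function.Injective (fun i => ψ i p)) (hh : ContinuousAt h p)
    (hr : ∀ᶠ q in 𝓝 p, ∃ i, h q = ψ i q) : ∃ i, h =ᶠ[𝓝 p] ψ i := by
  obtain ⟨i, hi⟩ := hr.self_of_nhds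
  have h1 : ∀ j, ∀ᶠ q in 𝓝 p, h q = ψ j q → j = i := by
    intro j
    by_cases hji : j = i
    · exact Eventually.of_forall fun _ _ => hji
    have h3 := (hh.sub (hψ j)).eventually_ne
      (sub_ne_zero.2 fun h4 => hji (hinj (h4.symm.trans hi)))
    filter_upwards [h3] with q hq hq'
    exact absurd (sub_eq_zero.2 hq') hq
  refine ⟨i, ?_⟩
  filter_upwards [hr, eventually_all.2 h1] with q ⟨j, hj⟩ hq
  rwa [← hq j hj]

theorem IsEquisingularFamily.exists_radius {m d : ℕ} {P : Param m → ℂ → ℂ[X]}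
    (hP : IsEquisingularFamily d P) : ∃ r : ℝ, 0 < r ∧ r ≤ 1 ∧ ∀ q : Param m × ℂ, ‖q‖ < r →
      (∀ᶠ q' in 𝓝 q, (P q'.1 q'.2).Monic ∧ (P q'.1 q'.2).natDegree = d) ∧
      (∀ k, AnalyticAt ℂ (fun q : Param m × ℂ => (P q.1 q.2).coeff k) q) ∧
      (q.2 ≠ 0 → (P q.1 q.2).Separable) := by
  have h1 := hP.monic.eventually_nhds
  have h2 : ∀ᶠ q in 𝓝 (0 : Param m × ℂ), ∀ k ∈ Finset.range (d + 1),
      AnalyticAt ℂ (fun q : Param m × ℂ => (P q.1 q.2).coeff k) q :=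
    (eventually_all_finset _).2 fun k _ => (hP.analytic k).eventually_analyticAt
  obtain ⟨r, hr, h⟩ := Metric.eventually_nhds_iff.1 (h1.and (h2.and hP.branch_locus))
  refine ⟨min r 1, by positivity, min_le_right _ _, fun q hq => ?_⟩
  obtain ⟨h3, h4, h5⟩ := h (y := q) (by simpa using hq.trans_le (min_le_left _ _))
  refine ⟨h3, fun k => ?_, h5⟩
  -- Coefficients of degree above d vanish, so only finitely many analyticity conditions restrict
  -- the radius.
  by_cases hk : k < d + 1
  · exact h4 k (Finset.mem_range.2 hk)
  · refine (analyticAt_const (v := (0 : ℂ))).congr ?_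
    filter_upwards [h3] with q' hq'
    exact (Polynomial.coeff_eq_zero_of_natDegree_lt (by omega)).symm

theorem norm_root_le {d : ℕ} {p : ℂ[X]} (hp : p.Monic) (hd : p.natDegree = d) {y : ℂ}
    (hy : p.IsRoot y) : ‖y‖ ≤ 1 + ∑ k ∈ Finset.range d, ‖p.coeff k‖ := by
  have h0 : 0 ≤ ∑ k ∈ Finset.range d, ‖p.coeff k‖ := Finset.sum_nonneg fun _ _ => norm_nonneg _
  by_contra! hlt
  have hy1 : 1 < ‖y‖ := by linarith
  have h1 : y ^ d = -∑ k ∈ Finset.range d, p.coeff k * y ^ k := by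
    have h2 := hy
    rw [Polynomial.IsRoot, eval_eq_sum_coeff_of_monic hd, Finset.sum_range_succ, ← hd,
      hp.coeff_natDegree, hd, one_mul] at h2
    linear_combination h2
  rcases Nat.eq_zero_or_pos d with rfl | hd0
  · simp at h1
  obtain ⟨e, rfl⟩ : ∃ e, d = e + 1 := ⟨d - 1, by omega⟩
  have h3 : ‖y‖ ^ (e + 1) ≤ (∑ k ∈ Finset.range (e + 1), ‖p.coeff k‖) * ‖y‖ ^ e := by
    rw [← norm_pow, h1, norm_neg, Finset.sum_mul]
    refine (norm_sum_le _ _).trans (Finset.sum_le_sum fun k hk => ?_)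
    rw [norm_mul, norm_pow]
    exact mul_le_mul_of_nonneg_left (pow_le_pow_right₀ hy1.le
      (Nat.lt_succ_iff.1 (Finset.mem_range.1 hk))) (norm_nonneg _)
  rw [pow_succ'] at h3
  have := le_of_mul_le_mul_right h3 (by positivity)
  linarith

/-- A continuous choice of a root of `∑ C k t * Y ^ k` in a commutative Banach algebra depends
analytically on `t`. -/
theorem analyticAt_of_root {E₁ A : Type*} [NormedAddCommGroup E₁] [NormedSpace ℂ E₁]
    [CompleteSpace E₁] [NormedCommRing A] [NormedAlgebra ℂ A] [CompleteSpace A]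
    {d : ℕ} {C : ℕ → E₁ → A} {Y : E₁ → A} {p : E₁}
    (hC : ∀ k ∈ Finset.range (d + 1), AnalyticAt ℂ (C k) p) (hY : ContinuousAt Y p)
    (hr : ∀ᶠ t in 𝓝 p, ∑ k ∈ Finset.range (d + 1), C k t * Y t ^ k = 0)
    (hu : IsUnit (∑ k ∈ Finset.range (d + 1), C k p * (k * Y p ^ (k - 1)))) :
    AnalyticAt ℂ Y p := by
  let Φ : E₁ × A → A := fun v => ∑ k ∈ Finset.range (d + 1), C k v.1 * v.2 ^ k
  have hΦ : AnalyticAt ℂ Φ (p, Y p) := by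
    refine Finset.analyticAt_fun_sum _ fun k hk => ?_
    have h1 : AnalyticAt ℂ (fun v : E₁ × A => C k v.1) (p, Y p) :=
      (hC k hk).comp_of_eq analyticAt_fst rfl
    exact h1.mul (analyticAt_snd.pow k)
  set D := ∑ k ∈ Finset.range (d + 1), C k p * (k * Y p ^ (k - 1)) with hD
  obtain ⟨u, hu⟩ := hu
  let Ψ : A ≃L[ℂ] A := ContinuousLinearEquiv.equivOfInverse
    (ContinuousLinearMap.mul ℂ A u) (ContinuousLinearMap.mul ℂ A ↑u⁻¹)
    (fun x => by simp) (fun x => by simp)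
  have hΨ : HasFDerivAt (fun y => Φ (p, y)) (Ψ : A →L[ℂ] A) (Y p) := by
    have h1 : ∀ k ∈ Finset.range (d + 1), HasFDerivAt (fun y : A => C k p * y ^ k)
        (ContinuousLinearMap.mul ℂ A (C k p * (k * Y p ^ (k - 1)))) (Y p) := by
      intro k _
      have h2 := (hasFDerivAt_pow (𝕜 := ℂ) k (x := Y p)).const_mul (C k p)
      refine h2.congr_fderiv ?_
      ext x
      simp [mul_assoc]
    have h3 := HasFDerivAt.fun_sum h1
    refine h3.congr_fderiv ?_
    ext x
    have : (Ψ : A →L[ℂ] A) x = D * x := by rw [← hu]; rfl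
    rw [this, hD, Finset.sum_mul]
    simp
  obtain ⟨ψ, h1, h2, h3⟩ := exists_analytic_implicit (u := (p, Y p)) hΦ Ψ hΨ
  refine h1.congr ?_
  have h4 : Tendsto (fun t => (t, Y t)) (𝓝 p) (𝓝 (p, Y p)) := continuousAt_id.prodMk hY
  filter_upwards [h4.eventually h3, hr] with t ht htr
  have h5 : Φ (p, Y p) = 0 := hr.self_of_nhds
  exact ht.1 (by rw [h5]; exact htr)

theorem sum_coeff_derivative {d : ℕ} {p : ℂ[X]} (hd : p.natDegree = d) (y : ℂ) :
    ∑ k ∈ Finset.range (d + 1), p.coeff k * (k * y ^ (k - 1)) = p.derivative.eval y := by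
  have h1 : HasDerivAt (fun y => ∑ k ∈ Finset.range (d + 1), p.coeff k * y ^ k)
      (∑ k ∈ Finset.range (d + 1), p.coeff k * (k * y ^ (k - 1))) y :=
    HasDerivAt.fun_sum fun k _ => (hasDerivAt_pow k y).const_mul _
  refine h1.unique ?_
  simp_rw [← eval_eq_sum_coeff_of_monic hd]
  exact p.hasDerivAt y

/-- On a small circle in the w-plane the polynomials are separable. So the restriction of f to the
circle is a simple root of a polynomial over C(K, ℂ), and the implicit function theorem makes it
analytic in t. Cauchy's formula then recovers a function analytic in (t, w) jointly. -/
theorem analyticAt_extension {m d : ℕ} {Q : Param m → ℂ → ℂ[X]} {r : ℝ} (hr : 0 < r)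
    (hQ : ∀ q : Param m × ℂ, ‖q‖ < r → (Q q.1 q.2).Monic ∧ (Q q.1 q.2).natDegree = d ∧
      (q.2 ≠ 0 → (Q q.1 q.2).Separable))
    (hQa : ∀ q : Param m × ℂ, ‖q‖ < r → ∀ k,
      AnalyticAt ℂ (fun q : Param m × ℂ => (Q q.1 q.2).coeff k) q)
    {f : Param m → ℂ → ℂ}
    (hf : ∀ q : Param m × ℂ, ‖q‖ < r → q.2 ≠ 0 →
      ContinuousAt (fun q : Param m × ℂ => f q.1 q.2) q)
    (hfr : ∀ q : Param m × ℂ, ‖q‖ < r → q.2 ≠ 0 → (Q q.1 q.2).IsRoot (f q.1 q.2)) :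
    ∃ F : Param m → ℂ → ℂ, AnalyticAt ℂ (fun q : Param m × ℂ => F q.1 q.2) 0 ∧
      ∀ᶠ q in 𝓝 (0 : Param m × ℂ), q.2 ≠ 0 → F q.1 q.2 = f q.1 q.2 := by
  have hfa : ∀ q : Param m × ℂ, ‖q‖ < r → q.2 ≠ 0 →
      AnalyticAt ℂ (fun q : Param m × ℂ => f q.1 q.2) q := by
    intro q hq hq2
    have hev : ∀ᶠ q' in 𝓝 q, ‖q'‖ < r := continuous_norm.continuousAt.eventually_lt_const hq
    have hev2 : ∀ᶠ q' : Param m × ℂ in 𝓝 q, q'.2 ≠ 0 := continuousAt_snd.eventually_ne hq2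
    obtain ⟨ψ, h1, h2, h3⟩ := exists_analytic_roots (P := fun q : Param m × ℂ => Q q.1 q.2) (p := q)
      (d := d) (hev.mono fun q' h => ⟨(hQ q' h).1, (hQ q' h).2.1⟩) (hQa q hq) ((hQ q hq).2.2 hq2)
    obtain ⟨i, hi⟩ := exists_eventuallyEq_of_root (fun i => (h1 i).continuousAt) h2 (hf q hq hq2) (by
      filter_upwards [hev, hev2, h3] with q' h4 h5 h6
      exact (isRoot_prod_iff _ _).1 (h6 ▸ hfr q' h4 h5))
    exact (h1 i).congr hi.symm
  have key := fun k => exists_analytic_curry (hQa 0 (by simpa using hr) k)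
  choose s₀ hs₀ C' hC' using key
  obtain ⟨s, hs, hsr, hss⟩ : ∃ s : ℝ, 0 < s ∧ s < r ∧ ∀ k ∈ Finset.range (d + 1), s < s₀ k := by
    have h1 : ∀ᶠ s in 𝓝[>] (0 : ℝ), ∀ k ∈ Finset.range (d + 1), s < s₀ k :=
      (eventually_all_finset _).2 fun k _ => nhdsWithin_le_nhds (eventually_lt_nhds (hs₀ k))
    obtain ⟨s, h2, h3, h4⟩ := (eventually_mem_nhdsWithin.and
      (((eventually_lt_nhds hr).filter_mono nhdsWithin_le_nhds).and h1)).exists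
    exact ⟨s, h2, h3, h4⟩
  set K := Metric.sphere (0 : ℂ) s
  have hKn : ∀ ζ : K, ‖(ζ : ℂ)‖ = s := fun ζ => by simp
  have hK0 : ∀ ζ : K, (ζ : ℂ) ≠ 0 := fun ζ h => by
    have := hKn ζ; rw [h, norm_zero] at this; exact hs.ne this
  have hKr : ∀ (t : Param m) (ζ : K), ‖t‖ < r → ‖(t, (ζ : ℂ))‖ < r := fun t ζ ht => by
    rw [Prod.norm_def, hKn]; exact max_lt ht hsr
  have hCk : ∀ k ∈ Finset.range (d + 1), ∃ C : Param m → C(K, ℂ), AnalyticAt ℂ C 0 ∧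
      ∀ᶠ t in 𝓝 (0 : Param m), ∀ ζ : K, C t ζ = (Q t ζ).coeff k := fun k hk =>
    ⟨_, hC' k s (hss k hk)⟩
  choose! C hCa hCe using hCk
  have hCe := (eventually_all_finset _).2 hCe
  have hball : ∀ᶠ t in 𝓝 (0 : Param m), ‖t‖ < r :=
    continuous_norm.continuousAt.eventually_lt_const (by simpa using hr)
  -- the restriction of `f` to the circle
  let B := Metric.ball (0 : Param m) r
  let g : C(B × K, ℂ) := ⟨fun p => f p.1 p.2, by
    rw [continuous_iff_continuousAt]
    rintro ⟨⟨t, ht⟩, ζ⟩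
    have ht' : ‖t‖ < r := by simpa [B] using ht
    have h1 := hf (t, (ζ : ℂ)) (hKr t ζ ht') (hK0 ζ)
    exact ContinuousAt.comp_of_eq (f := fun p : B × K => ((p.1 : Param m), (p.2 : ℂ))) h1
      (by fun_prop) rfl⟩
  classical
  let Y : Param m → C(K, ℂ) := fun t => if h : t ∈ B then g.curry ⟨t, h⟩ else 0
  have hYv : ∀ t, ‖t‖ < r → ∀ ζ : K, Y t ζ = f t ζ := fun t ht ζ => by
    have : t ∈ B := by simpa [B] using ht
    simp only [Y, dif_pos this]
    rfl
  have hYc : ContinuousAt Y 0 := by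
    have h1 : ContinuousOn Y B := by
      rw [continuousOn_iff_continuous_domRestrict]
      convert g.curry.continuous using 1
      funext t
      simp [Y, Set.domRestrict_apply]
    exact h1.continuousAt (Metric.ball_mem_nhds _ hr)
  have hYa : AnalyticAt ℂ Y 0 := by
    refine analyticAt_of_root (d := d) (C := C) hCa hYc ?_ ?_
    · filter_upwards [hball, hCe] with t ht htC
      ext ζ
      simp only [ContinuousMap.coe_sum, Finset.sum_apply, ContinuousMap.mul_apply,
        ContinuousMap.pow_apply, ContinuousMap.zero_apply]
      have h1 := hfr _ (hKr t ζ ht) (hK0 ζ)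
      rw [Polynomial.IsRoot, eval_eq_sum_coeff_of_monic (hQ _ (hKr t ζ ht)).2.1] at h1
      rw [← h1]
      refine Finset.sum_congr rfl fun k hk => ?_
      rw [htC k hk, hYv t ht]
    · rw [ContinuousMap.isUnit_iff_forall_ne_zero]
      intro ζ
      have ht : ‖(0 : Param m)‖ < r := by simpa using hr
      obtain ⟨h1, h2, h3⟩ := hQ _ (hKr 0 ζ ht)
      have h4 := (h3 (hK0 ζ)).aeval_derivative_ne_zero (x := f 0 ζ)
        (by simpa using hfr _ (hKr 0 ζ ht) (hK0 ζ))
      rw [Polynomial.coe_aeval_eq_eval, ← sum_coeff_derivative h2] at h4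
      convert h4 using 1
      simp only [ContinuousMap.coe_sum, Finset.sum_apply, ContinuousMap.mul_apply,
        ContinuousMap.pow_apply]
      refine Finset.sum_congr rfl fun k hk => ?_
      rw [hCe.self_of_nhds k hk, hYv 0 ht]
      simp
  obtain ⟨κ, hκ, hκc⟩ := exists_cauchy_functional hs
  refine ⟨fun t w => κ w (Y t), ?_, ?_⟩
  · have h1 : AnalyticAt ℂ (fun q : Param m × ℂ => κ q.2) 0 :=
      AnalyticAt.comp_of_eq (f := Prod.snd) hκ analyticAt_snd rfl
    have h2 : AnalyticAt ℂ (fun q : Param m × ℂ => Y q.1) 0 :=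
      AnalyticAt.comp_of_eq (f := Prod.fst) hYa analyticAt_fst rfl
    exact ((ContinuousLinearMap.id ℂ (C(K, ℂ) →L[ℂ] ℂ)).analyticAt_bilinear (κ 0, Y 0)).comp_of_eq
      (h1.prod h2) rfl
  · have h1 : ∀ᶠ q in 𝓝 (0 : Param m × ℂ), ‖q‖ < s :=
      continuous_norm.continuousAt.eventually_lt_const (by simpa using hs)
    filter_upwards [h1] with q hq hq2
    have hqt : ‖q.1‖ < r := (norm_fst_le q).trans_lt (hq.trans hsr)
    have hqw : ‖q.2‖ < s := (norm_snd_le q).trans_lt hq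
    have hpr : ∀ w : ℂ, ‖w‖ < r → ‖(q.1, w)‖ < r := fun w hw => by
      rw [Prod.norm_def]; exact max_lt hqt hw
    have hd : DifferentiableOn ℂ (f q.1) (Metric.ball 0 r \ {0}) := by
      intro w hw
      have h2 := hfa (q.1, w) (hpr w (by simpa using hw.1)) (by simpa using hw.2)
      have h3 : AnalyticAt ℂ (fun w => f q.1 w) w :=
        AnalyticAt.comp_of_eq (f := fun w : ℂ => (q.1, w)) h2 (by fun_prop) rfl
      exact h3.differentiableAt.differentiableWithinAt
    -- For fixed t the root is bounded in terms of the coefficients, so the singularity at w = 0 is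
    -- removable and Cauchy's formula applies to the extended function.
    have hbd : IsBoundedUnder (· ≤ ·) (𝓝[≠] (0 : ℂ)) fun z => ‖f q.1 z - f q.1 0‖ := by
      have h4 : ContinuousAt (fun w : ℂ => 1 + ∑ k ∈ Finset.range d, ‖(Q q.1 w).coeff k‖) 0 := by
        refine continuousAt_const.add (tendsto_finsetSum _ fun k _ => ?_)
        have h5 := (hQa (q.1, 0) (hpr 0 (by simpa using hr)) k).continuousAt.norm
        exact ContinuousAt.comp_of_eq (f := fun w : ℂ => (q.1, w)) h5 (by fun_prop) rfl
      obtain ⟨b, hb⟩ := h4.tendsto.isBoundedUnder_le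
      refine ⟨b + ‖f q.1 0‖, ?_⟩
      rw [eventually_map] at hb ⊢
      filter_upwards [nhdsWithin_le_nhds hb, eventually_mem_nhdsWithin,
        nhdsWithin_le_nhds (Metric.ball_mem_nhds (0 : ℂ) hr)] with w h6 h7 h8
      have h9 := hpr w (by simpa using h8)
      refine (norm_sub_le _ _).trans (add_le_add_left ((norm_root_le (hQ _ h9).1 (hQ _ h9).2.1
        (hfr _ h9 (by simpa using h7))).trans h6) _)
    have h2 := Complex.differentiableOn_update_limUnder_of_isLittleO
      (Metric.ball_mem_nhds (0 : ℂ) hr) hd hbd.isLittleO_sub_self_inv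
    have h3 := hκc _ (h2.mono (Metric.closedBall_subset_ball hsr)) (Y q.1) (fun ζ => by
      rw [hYv _ hqt, Function.update_of_ne (hK0 ζ)]) q.2 (by simpa using hqw)
    rw [h3, Function.update_of_ne hq2]

theorem nonempty_puiseuxExpansion {m d : ℕ} {P : Param m → ℂ → ℂ[X]}
    (hP : IsEquisingularFamily d P) : Nonempty (PuiseuxExpansion d P) := by
  obtain ⟨r, hr, hr1, hrP⟩ := hP.exists_radius
  obtain ⟨N, hN, f, hf⟩ := exists_punctured_roots (P := P) (d := d) hr hr1 (by
    intro p hp hp2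
    obtain ⟨h1, h2, h3⟩ := hrP p hp
    obtain ⟨ψ, h4, h5, h6⟩ := exists_analytic_roots (P := fun q : Param m × ℂ => P q.1 q.2) h1 h2
      (h3 hp2)
    exact ⟨ψ, fun i => (h4 i).continuousAt, h5, h6⟩)
  have hpow : ∀ q : Param m × ℂ, ‖q‖ < r → ‖(q.1, q.2 ^ N)‖ < r := by
    intro q hq
    have h1 := (norm_snd_le q).trans_lt hq
    rw [Prod.norm_def, norm_pow]
    exact max_lt ((norm_fst_le q).trans_lt hq)
      ((pow_le_of_le_one (norm_nonneg _) (h1.le.trans hr1) hN.ne').trans_lt h1)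
  have hQm : ∀ q : Param m × ℂ, ‖q‖ < r → (P q.1 (q.2 ^ N)).Monic ∧
      (P q.1 (q.2 ^ N)).natDegree = d ∧ (q.2 ≠ 0 → (P q.1 (q.2 ^ N)).Separable) := fun q hq =>
    ⟨(hrP _ (hpow q hq)).1.self_of_nhds.1, (hrP _ (hpow q hq)).1.self_of_nhds.2, fun h =>
      (hrP _ (hpow q hq)).2.2 (pow_ne_zero N h)⟩
  have hQa : ∀ q : Param m × ℂ, ‖q‖ < r → ∀ k,
      AnalyticAt ℂ (fun q : Param m × ℂ => (P q.1 (q.2 ^ N)).coeff k) q := fun q hq k =>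
    AnalyticAt.comp_of_eq (f := fun q : Param m × ℂ => (q.1, q.2 ^ N))
      ((hrP _ (hpow q hq)).2.1 k) (analyticAt_fst.prod (analyticAt_snd.pow N)) rfl
  have key : ∀ i, ∃ F : Param m → ℂ → ℂ, AnalyticAt ℂ (fun q : Param m × ℂ => F q.1 q.2) 0 ∧
      ∀ᶠ q in 𝓝 (0 : Param m × ℂ), q.2 ≠ 0 → F q.1 q.2 = f i q.1 q.2 := fun i =>
    analyticAt_extension (Q := fun t w => P t (w ^ N)) hr hQm hQa
      (fun q hq hq2 => (hf q hq hq2).1 i)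
      (fun q hq hq2 => by rw [(hf q hq hq2).2]; exact (isRoot_prod_iff _ _).2 ⟨i, rfl⟩)
  choose F hFa hFf using key
  have hev : ∀ᶠ q in 𝓝 (0 : Param m × ℂ), ‖q‖ < r :=
    continuous_norm.continuousAt.eventually_lt_const (by simpa using hr)
  have hne : ∀ᶠ q in 𝓝 (0 : Param m × ℂ), q.2 ≠ 0 →
      P q.1 (q.2 ^ N) = ∏ i, (Polynomial.X - Polynomial.C (F i q.1 q.2)) := by
    filter_upwards [hev, eventually_all.2 hFf] with q hq hq' hq2
    rw [(hf q hq hq2).2]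
    exact Finset.prod_congr rfl fun i _ => by rw [hq' i hq2]
  refine ⟨⟨N, hN, F, hFa, ?_⟩⟩
  filter_upwards [hne.eventually_nhds, hev.eventually_nhds,
    eventually_all.2 fun i => (hFa i).eventually_analyticAt] with q hq hqr hqa
  by_cases hq2 : q.2 ≠ 0
  · exact hq.self_of_nhds hq2
  -- At w = 0, where separability may fail, the factorization follows by continuity from w ≠ 0.
  refine Polynomial.funext fun y => ?_
  have hc : Tendsto (fun w : ℂ => (q.1, w)) (𝓝[≠] q.2) (𝓝 q) :=
    (Continuous.tendsto' (by fun_prop) _ _ rfl).mono_left nhdsWithin_le_nhds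
  have h1 : Tendsto (fun w : ℂ => (P q.1 (w ^ N)).eval y) (𝓝[≠] q.2)
      (𝓝 ((P q.1 (q.2 ^ N)).eval y)) := by
    have h2 : Tendsto (fun w : ℂ => ∑ k ∈ Finset.range (d + 1), (P q.1 (w ^ N)).coeff k * y ^ k)
        (𝓝[≠] q.2) (𝓝 (∑ k ∈ Finset.range (d + 1), (P q.1 (q.2 ^ N)).coeff k * y ^ k)) :=
      tendsto_finsetSum _ fun k _ =>
        ((hQa q hqr.self_of_nhds k).continuousAt.tendsto.comp hc).mul_const _
    rw [eval_eq_sum_coeff_of_monic (hQm q hqr.self_of_nhds).2.1]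
    refine h2.congr' ?_
    filter_upwards [hc.eventually hqr] with w hw
    rw [eval_eq_sum_coeff_of_monic (hQm _ hw).2.1]
  have h3 : Tendsto (fun w : ℂ => (∏ i, (Polynomial.X - Polynomial.C (F i q.1 w))).eval y)
      (𝓝[≠] q.2) (𝓝 ((∏ i, (Polynomial.X - Polynomial.C (F i q.1 q.2))).eval y)) := by
    simp only [Polynomial.eval_prod, Polynomial.eval_sub, Polynomial.eval_X, Polynomial.eval_C]
    exact tendsto_finsetProd _ fun i _ => tendsto_const_nhds.sub
      ((hqa i).continuousAt.tendsto.comp hc)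
  refine tendsto_nhds_unique h1 (h3.congr' ?_)
  filter_upwards [hc.eventually hq, eventually_mem_nhdsWithin] with w hw hw2
  rw [hw]
  simpa [not_not.1 hq2] using hw2

end Carrousel

namespace Carrousel

/-! ### Coefficients of power series with parameters -/

section Taylor

variable {E₁ : Type*} [NormedAddCommGroup E₁] [NormedSpace ℂ E₁] {f : E₁ → ℂ → ℂ}

theorem analyticAt_iteratedDeriv_snd [CompleteSpace E₁]
    (hf : AnalyticAt ℂ (fun q : E₁ × ℂ => f q.1 q.2) 0) (l : ℕ) :
    AnalyticAt ℂ (fun q : E₁ × ℂ => iteratedDeriv l (f q.1) q.2) 0 := by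
  induction l with
  | zero => simpa using hf
  | succ l ih =>
    have h1 : AnalyticAt ℂ (fun q => fderiv ℂ (fun q : E₁ × ℂ => iteratedDeriv l (f q.1) q.2) q
        ((0 : E₁), (1 : ℂ))) 0 :=
      ((ContinuousLinearMap.apply ℂ ℂ ((0 : E₁), (1 : ℂ))).analyticAt _).comp ih.fderiv
    refine h1.congr ?_
    filter_upwards [ih.eventually_analyticAt] with q hq
    rw [iteratedDeriv_succ]
    have h2 : HasDerivAt (fun w : ℂ => (q.1, w)) ((0 : E₁), (1 : ℂ)) q.2 :=
      (hasDerivAt_const _ _).prodMk (hasDerivAt_id _)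
    exact (HasFDerivAt.comp_hasDerivAt (f := fun w : ℂ => (q.1, w)) q.2
      hq.differentiableAt.hasFDerivAt h2).deriv.symm

theorem analyticAt_taylorCoeff [CompleteSpace E₁]
    (hf : AnalyticAt ℂ (fun q : E₁ × ℂ => f q.1 q.2) 0) (l : ℕ) :
    AnalyticAt ℂ (fun t => iteratedDeriv l (f t) 0 / (l.factorial : ℂ)) 0 := by
  refine AnalyticAt.div ?_ analyticAt_const (Nat.cast_ne_zero.2 l.factorial_ne_zero)
  exact AnalyticAt.comp_of_eq (f := fun t : E₁ => (t, (0 : ℂ))) (analyticAt_iteratedDeriv_snd hf l)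
    (analyticAt_id.prod analyticAt_const) rfl

theorem exists_taylor_bound (hf : AnalyticAt ℂ (fun q : E₁ × ℂ => f q.1 q.2) 0) :
    (∀ᶠ q in 𝓝 (0 : E₁ × ℂ), HasSum (fun l : ℕ =>
      iteratedDeriv l (f q.1) 0 / (l.factorial : ℂ) * q.2 ^ l) (f q.1 q.2)) ∧
    ∀ L : ℕ, ∃ C : ℝ, 0 ≤ C ∧ ∀ᶠ q in 𝓝 (0 : E₁ × ℂ), ‖f q.1 q.2 - ∑ l ∈ Finset.range L,
      iteratedDeriv l (f q.1) 0 / (l.factorial : ℂ) * q.2 ^ l‖ ≤ C * ‖q.2‖ ^ L := by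
  have hb : ∀ᶠ q in 𝓝 (0 : E₁ × ℂ), ‖f q.1 q.2‖ < ‖f 0 0‖ + 1 :=
    hf.continuousAt.norm.eventually_lt_const (by simp)
  obtain ⟨ρ, hρ, h⟩ := Metric.eventually_nhds_iff.1 (hb.and hf.eventually_analyticAt)
  set M := ‖f 0 0‖ + 1
  have hM : 0 < M := by positivity
  have hpr : ∀ (t : E₁) (w : ℂ), ‖t‖ < ρ → ‖w‖ < ρ → ‖f t w‖ < M ∧
      AnalyticAt ℂ (fun q : E₁ × ℂ => f q.1 q.2) (t, w) := fun t w ht hw => by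
    refine h (y := (t, w)) ?_
    rw [dist_zero_right, Prod.norm_def]
    exact max_lt ht hw
  have hd : ∀ t : E₁, ‖t‖ < ρ → DifferentiableOn ℂ (f t) (Metric.ball 0 ρ) := by
    intro t ht w hw
    have h1 := (hpr t w ht (by simpa using hw)).2
    have h2 : AnalyticAt ℂ (fun w => f t w) w :=
      AnalyticAt.comp_of_eq (f := fun w : ℂ => (t, w)) h1 (by fun_prop) rfl
    exact h2.differentiableAt.differentiableWithinAt
  have hsum : ∀ (t : E₁) (w : ℂ), ‖t‖ < ρ → ‖w‖ < ρ → HasSum (fun l : ℕ =>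
      iteratedDeriv l (f t) 0 / (l.factorial : ℂ) * w ^ l) (f t w) := by
    intro t w ht hw
    have h1 := Complex.hasSum_taylorSeries_on_ball (hd t ht) (z := w) (by simpa using hw)
    have h2 : (fun l : ℕ => iteratedDeriv l (f t) 0 / (l.factorial : ℂ) * w ^ l) =
        fun l : ℕ => (l.factorial : ℂ)⁻¹ • (w - 0) ^ l • iteratedDeriv l (f t) 0 := by
      funext l
      rw [sub_zero, smul_eq_mul, smul_eq_mul]
      ring
    rw [h2]
    exact h1
  have hmem : ∀ᶠ q in 𝓝 (0 : E₁ × ℂ), ‖q‖ < ρ / 4 :=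
    continuous_norm.continuousAt.eventually_lt_const (by simpa using hρ)
  refine ⟨?_, fun L => ⟨2 * M * (2 / ρ) ^ L, by positivity, ?_⟩⟩
  · filter_upwards [hmem] with q hq
    have h1 := (norm_fst_le q).trans_lt hq
    have h2 := (norm_snd_le q).trans_lt hq
    exact hsum q.1 q.2 (by linarith) (by linarith)
  · filter_upwards [hmem] with q hq
    have h1 := (norm_fst_le q).trans_lt hq
    have h2 := (norm_snd_le q).trans_lt hq
    -- Cauchy's estimate on the circle of radius ρ / 2, uniform in t. As |w| < ρ / 4, the tail is
    -- dominated by a geometric series of ratio at most 1 / 2.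
    have hcoef : ∀ l : ℕ, ‖iteratedDeriv l (f q.1) 0 / (l.factorial : ℂ)‖ ≤ M * (2 / ρ) ^ l := by
      intro l
      have h3 := Complex.norm_iteratedDeriv_le_of_forall_mem_sphere_norm_le (c := 0) (R := ρ / 2)
        (C := M) (f := f q.1) l (by positivity)
        (((hd q.1 (by linarith)).mono (Metric.closedBall_subset_ball (by linarith))).mono
          Metric.closure_ball_subset_closedBall).diffContOnCl
        (fun z hz => (hpr q.1 z (by linarith) (by
          have : ‖z‖ = ρ / 2 := by simpa using hz
          linarith)).1.le)
      rw [norm_div, Complex.norm_natCast, div_le_iff₀ (by positivity)]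
      refine h3.trans (le_of_eq ?_)
      rw [div_pow, div_pow]
      field_simp
    have h3 := (hasSum_nat_add_iff' L).2 (hsum q.1 q.2 (by linarith) (by linarith))
    set u := 2 / ρ * ‖q.2‖ with hu
    have hu0 : 0 ≤ u := by positivity
    have hu1 : u ≤ 1 / 2 := by
      rw [hu, div_mul_eq_mul_div, div_le_iff₀ hρ]; linarith
    have h4 : HasSum (fun n : ℕ => M * u ^ L * u ^ n) (M * u ^ L * (1 - u)⁻¹) :=
      (hasSum_geometric_of_lt_one hu0 (by linarith)).mul_left _
    rw [← h3.tsum_eq]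
    refine (tsum_of_norm_bounded h4 fun n => ?_).trans ?_
    · rw [norm_mul, norm_pow]
      refine (mul_le_mul_of_nonneg_right (hcoef _) (by positivity)).trans (le_of_eq ?_)
      rw [hu, mul_pow, mul_pow, pow_add, pow_add]; ring
    · have h5 : (1 - u)⁻¹ ≤ 2 := by
        rw [inv_le_comm₀ (by linarith) (by norm_num)]; linarith
      calc M * u ^ L * (1 - u)⁻¹ ≤ M * u ^ L * 2 := by gcongr
        _ = _ := by rw [hu, mul_pow]; ring

end Taylor

/-- The limit kills the constant term; then divide by w and repeat. The filter is arbitrary because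
one application controls a root only along part of the punctured neighborhoods. -/
theorem coeff_eq_zero_of_isLittleO {F : Filter ℂ} [F.NeBot] (hF : F ≤ 𝓝[≠] 0) {L : ℕ} {c : ℕ → ℂ}
    (h : (fun w => ∑ l ∈ Finset.range (L + 1), c l * w ^ l) =o[F] fun w => w ^ L) :
    ∀ l ≤ L, c l = 0 := by
  have hF0 : F ≤ 𝓝 0 := hF.trans nhdsWithin_le_nhds
  induction L generalizing c with
  | zero =>
    intro l hl
    obtain rfl : l = 0 := by omega
    simp only [zero_add, Finset.range_one, Finset.sum_singleton, pow_zero, mul_one] at h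
    exact tendsto_nhds_unique tendsto_const_nhds (Asymptotics.isLittleO_one_iff ℂ |>.1 h)
  | succ L ih =>
    have h0 : c 0 = 0 := by
      have h1 : Tendsto (fun w => ∑ l ∈ Finset.range (L + 1 + 1), c l * w ^ l) F (𝓝 (c 0)) := by
        have : Continuous fun w : ℂ => ∑ l ∈ Finset.range (L + 1 + 1), c l * w ^ l := by fun_prop
        refine (Continuous.tendsto' this 0 _ ?_).mono_left hF0
        rw [Finset.sum_range_succ']
        simp
      have h2 : Tendsto (fun w : ℂ => w ^ (L + 1)) F (𝓝 0) := by
        have : Continuous fun w : ℂ => w ^ (L + 1) := by fun_prop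
        exact (Continuous.tendsto' this 0 _ (by simp)).mono_left hF0
      exact tendsto_nhds_unique h1 (h.trans_tendsto h2)
    have h1 : (fun w => ∑ l ∈ Finset.range (L + 1), c (l + 1) * w ^ l) =o[F] fun w => w ^ L := by
      have hne : ∀ᶠ w in F, w ≠ 0 := hF eventually_mem_nhdsWithin
      have h2 := h.mul_isBigO (Asymptotics.isBigO_refl (fun w : ℂ => w⁻¹) F)
      refine h2.congr' ?_ ?_
      · filter_upwards [hne] with w hw
        rw [Finset.sum_range_succ', h0, zero_mul, add_zero, Finset.sum_mul]
        refine Finset.sum_congr rfl fun l _ => ?_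
        field_simp
        ring
      · filter_upwards [hne] with w hw
        field_simp
        ring
    intro l hl
    rcases l with _ | l
    · exact h0
    · exact ih h1 l (by omega)

/-! ### First differences of Puiseux series -/

namespace PuiseuxExpansion

variable {m d : ℕ} {P : Param m → ℂ → ℂ[X]} (E : PuiseuxExpansion d P)

theorem analyticAt_coeff (i : Fin d) (l : ℕ) : AnalyticAt ℂ (E.coeff i l) 0 :=
  analyticAt_taylorCoeff (E.analytic i) l

theorem root_isLittleO (i : Fin d) (L : ℕ) : ∀ᶠ t in 𝓝 (0 : Param m),
    (fun w => E.root i t w - E.partialSum i (L + 1) t w) =o[𝓝[≠] 0] fun w => w ^ L := by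
  obtain ⟨C, -, hC⟩ := (exists_taylor_bound (E.analytic i)).2 (L + 1)
  have h1 := (nhds_prod_eq (x := (0 : Param m)) (y := (0 : ℂ)) ▸ hC).curry
  filter_upwards [h1] with t ht
  have h2 : (fun w => E.root i t w - E.partialSum i (L + 1) t w) =O[𝓝 0] fun w => w ^ (L + 1) :=
    Asymptotics.IsBigO.of_bound C (by filter_upwards [ht] with w hw; rw [norm_pow]; exact hw)
  exact (h2.trans_isLittleO (Asymptotics.isLittleO_pow_pow (Nat.lt_succ_self L))).mono
    nhdsWithin_le_nhds

variable {E} in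
theorem Agree.refl (i : Fin d) (k : ℕ) : E.Agree i i k := fun _ _ => Eventually.of_forall fun _ => rfl

variable {E} in
theorem Agree.symm {i j : Fin d} {k : ℕ} (h : E.Agree i j k) : E.Agree j i k :=
  fun l hl => (h l hl).mono fun _ ht => ht.symm

variable {E} in
theorem Agree.trans {i j j' : Fin d} {k : ℕ} (h : E.Agree i j k) (h' : E.Agree j j' k) :
    E.Agree i j' k :=
  fun l hl => by filter_upwards [h l hl, h' l hl] with t h1 h2; rw [h2, h1]

variable {E} in
theorem Agree.mono {i j : Fin d} {k k' : ℕ} (h : E.Agree i j k) (hk : k' ≤ k) : E.Agree i j k' :=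
  fun l hl => h l (hl.trans_le hk)

variable {E} in
theorem Agree.succ {i j : Fin d} {k : ℕ} (h : E.Agree i j k)
    (hk : ∀ᶠ t in 𝓝 (0 : Param m), E.coeff j k t = E.coeff i k t) : E.Agree i j (k + 1) := by
  intro l hl
  rcases Nat.lt_succ_iff_lt_or_eq.1 hl with hl | rfl
  · exact h l hl
  · exact hk

theorem eventually_root_ne (hP : IsEquisingularFamily d P) : ∀ᶠ q in 𝓝 (0 : Param m × ℂ),
    q.2 ≠ 0 → Function.Injective fun i => E.root i q.1 q.2 := by
  have h1 : Tendsto (fun q : Param m × ℂ => (q.1, q.2 ^ E.N)) (𝓝 0) (𝓝 0) := by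
    refine Continuous.tendsto' (by fun_prop) _ _ ?_
    simp [E.N_pos.ne', Prod.ext_iff]
  filter_upwards [E.factor, h1.eventually hP.branch_locus] with q hq hq' hq2
  have h2 : (P q.1 (q.2 ^ E.N)).Separable := hq' (pow_ne_zero _ hq2)
  rw [hq, Polynomial.separable_prod_X_sub_C_iff] at h2
  exact h2

/-- Two different series differ for the first time by terms whose coefficients are different also at
`t = 0`. -/
theorem exists_coeff_ne (hP : IsEquisingularFamily d P) {i j : Fin d} (hij : i ≠ j) :
    ∃ k, E.Agree i j k ∧ E.coeff i k 0 ≠ E.coeff j k 0 := by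
  classical
  set D : Param m → ℂ → ℂ := fun t w => E.root i t w - E.root j t w with hD
  have hDne : ∀ᶠ q in 𝓝 (0 : Param m × ℂ), q.2 ≠ 0 → D q.1 q.2 ≠ 0 :=
    (E.eventually_root_ne hP).mono fun q hq hq2 => sub_ne_zero.2 ((hq hq2).ne hij)
  obtain ⟨hsi, hbi⟩ := exists_taylor_bound (E.analytic i)
  obtain ⟨hsj, hbj⟩ := exists_taylor_bound (E.analytic j)
  -- Otherwise the two series coincide at t = 0, and the polynomial has a double root there for
  -- small w ≠ 0.
  have hex : ∃ k, ¬ ∀ᶠ t in 𝓝 (0 : Param m), E.coeff j k t = E.coeff i k t := by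
    by_contra! hall
    have hc : Tendsto (fun w : ℂ => ((0 : Param m), w)) (𝓝 0) (𝓝 0) :=
      Continuous.tendsto' (by fun_prop) _ _ rfl
    have h1 : ∀ᶠ w in 𝓝[≠] (0 : ℂ), False := by
      filter_upwards [nhdsWithin_le_nhds (hc.eventually hsi),
        nhdsWithin_le_nhds (hc.eventually hsj), nhdsWithin_le_nhds (hc.eventually hDne),
        eventually_mem_nhdsWithin] with w h1 h2 h3 h4
      refine h3 h4 (sub_eq_zero.2 (h1.unique ?_))
      convert h2 using 2 with l
      have := (hall l).self_of_nhds
      simp only [coeff] at this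
      simp only [this]
    exact h1.exists.choose_spec
  set k := Nat.find hex with hk
  have hag : E.Agree i j k := fun l hl => not_not.1 (Nat.find_min hex hl)
  refine ⟨k, hag, fun h0 => ?_⟩
  set a : Param m → ℂ := fun t => E.coeff i k t - E.coeff j k t with ha
  have haa : AnalyticAt ℂ a 0 := (E.analyticAt_coeff i k).sub (E.analyticAt_coeff j k)
  have ha0 : a 0 = 0 := sub_eq_zero.2 h0
  have hane : ¬ ∀ᶠ t in 𝓝 (0 : Param m), a t = 0 := fun h =>
    Nat.find_spec hex (h.mono fun t ht => (sub_eq_zero.1 ht).symm)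
  have hDa : AnalyticAt ℂ (fun q : Param m × ℂ => D q.1 q.2) 0 := (E.analytic i).sub (E.analytic j)
  obtain ⟨Ci, hCi0, hCi⟩ := hbi (k + 1)
  obtain ⟨Cj, hCj0, hCj⟩ := hbj (k + 1)
  have hagt : ∀ᶠ t in 𝓝 (0 : Param m), ∀ l ∈ Finset.range k, E.coeff j l t = E.coeff i l t :=
    (eventually_all_finset _).2 fun l hl => hag l (Finset.mem_range.1 hl)
  have hfst : Tendsto (Prod.fst : Param m × ℂ → Param m) (𝓝 0) (𝓝 0) := continuous_fst.tendsto _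
  have hest : ∀ᶠ q in 𝓝 (0 : Param m × ℂ),
      ‖D q.1 q.2 - a q.1 * q.2 ^ k‖ ≤ (Ci + Cj) * ‖q.2‖ ^ (k + 1) := by
    filter_upwards [hCi, hCj, hfst.eventually hagt] with q h1 h2 h3
    have h4 : D q.1 q.2 - a q.1 * q.2 ^ k =
        (E.root i q.1 q.2 - ∑ l ∈ Finset.range (k + 1), E.coeff i l q.1 * q.2 ^ l) -
        (E.root j q.1 q.2 - ∑ l ∈ Finset.range (k + 1), E.coeff j l q.1 * q.2 ^ l) := by
      rw [Finset.sum_range_succ, Finset.sum_range_succ,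
        ← Finset.sum_congr rfl fun l hl => congrArg (· * q.2 ^ l) (h3 l hl)]
      simp only [hD, ha]; ring
    rw [h4, add_mul]
    exact (norm_sub_le _ _).trans (add_le_add h1 h2)
  obtain ⟨ρ, hρ, h⟩ := Metric.eventually_nhds_iff.1
    ((hDne.and (hest.and hDa.eventually_analyticAt)).and (hfst.eventually haa.eventually_analyticAt))
  have hpr : ∀ (t : Param m) (w : ℂ), ‖t‖ < ρ → ‖w‖ < ρ → (w ≠ 0 → D t w ≠ 0) ∧
      ‖D t w - a t * w ^ k‖ ≤ (Ci + Cj) * ‖w‖ ^ (k + 1) ∧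
      AnalyticAt ℂ (fun q : Param m × ℂ => D q.1 q.2) (t, w) ∧ AnalyticAt ℂ a t := fun t w ht hw => by
    obtain ⟨⟨h1, h2, h3⟩, h4⟩ := h (y := (t, w)) (by
      rw [dist_zero_right, Prod.norm_def]; exact max_lt ht hw)
    exact ⟨h1, h2, h3, h4⟩
  -- Restrict to the complex line through a parameter t₁ with a t₁ ≠ 0. There the zeros of a are
  -- isolated, so a has no zero on some small circle about 0.
  have hfreq : ∃ᶠ t in 𝓝 (0 : Param m), ¬ a t = 0 :=
    not_eventually.1 hane
  obtain ⟨t₁, ht₁0, ht₁⟩ := (hfreq.and_eventually (Metric.ball_mem_nhds 0 hρ)).exists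
  have ht₁ : ‖t₁‖ < ρ := by simpa using ht₁
  have hst : ∀ s : ℂ, ‖s‖ ≤ 1 → ‖s • t₁‖ < ρ := fun s hs => by
    rw [norm_smul]
    exact (mul_le_of_le_one_left (norm_nonneg _) hs).trans_lt ht₁
  have hha : AnalyticOnNhd ℂ (fun s : ℂ => a (s • t₁)) (Metric.closedBall 0 1) := by
    intro s hs
    exact AnalyticAt.comp_of_eq (f := fun s : ℂ => s • t₁)
      (hpr _ 0 (hst s (by simpa using hs)) (by simpa using hρ)).2.2.2 (by fun_prop) rfl
  obtain ⟨r, hr0, hr1, hr⟩ : ∃ r : ℝ, 0 < r ∧ r ≤ 1 ∧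
      ∀ s ∈ Metric.sphere (0 : ℂ) r, a (s • t₁) ≠ 0 := by
    rcases (hha 0 (by simp)).eventually_eq_zero_or_eventually_ne_zero with h1 | h1
    · have h2 := hha.eqOn_zero_of_preconnected_of_eventuallyEq_zero
        (convex_closedBall (0 : ℂ) 1).isPreconnected (by simp) h1 (x := 1) (by simp)
      simp only [one_smul, Pi.zero_apply] at h2
      exact absurd h2 ht₁0
    · rw [eventually_nhdsWithin_iff, Metric.eventually_nhds_iff] at h1
      obtain ⟨e, he, h2⟩ := h1
      refine ⟨min (e / 2) 1, by positivity, min_le_right _ _, fun s hs => ?_⟩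
      have h3 : ‖s‖ = min (e / 2) 1 := by simpa using hs
      refine h2 ?_ ?_
      · rw [dist_zero_right, h3]; exact (min_le_left _ _).trans_lt (by linarith)
      · rintro rfl
        rw [norm_zero] at h3
        exact absurd h3 (by positivity)
  obtain ⟨s₀, hs₀, hmin⟩ := (isCompact_sphere (0 : ℂ) r).exists_isMinOn
    (NormedSpace.sphere_nonempty.2 hr0.le) (f := fun s => ‖a (s • t₁)‖) (by
      intro s hs
      have : ‖s‖ = r := by simpa using hs
      exact (hha s (by simp [this, hr1])).continuousAt.norm.continuousWithinAt)
  set μ := ‖a (s₀ • t₁)‖ with hμ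
  have hμ0 : 0 < μ := norm_pos_iff.2 (hr s₀ hs₀)
  obtain ⟨w, hw0, hwρ, hwC⟩ : ∃ w : ℂ, w ≠ 0 ∧ ‖w‖ < ρ ∧ (Ci + Cj) * ‖w‖ < μ / 2 := by
    have h1 : Tendsto (fun w : ℂ => (Ci + Cj) * ‖w‖) (𝓝 0) (𝓝 0) :=
      Continuous.tendsto' (by fun_prop) _ _ (by simp)
    have h2 : ∀ᶠ w in 𝓝[≠] (0 : ℂ), w ≠ 0 ∧ ‖w‖ < ρ ∧ (Ci + Cj) * ‖w‖ < μ / 2 := by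
      filter_upwards [eventually_mem_nhdsWithin, nhdsWithin_le_nhds (Metric.ball_mem_nhds 0 hρ),
        nhdsWithin_le_nhds (h1.eventually_lt_const (half_pos hμ0))] with w h3 h4 h5
      exact ⟨h3, by simpa using h4, h5⟩
    exact h2.exists
  have hwk : 0 < ‖w‖ ^ k := by positivity
  -- For fixed w ≠ 0 the difference D has no zeros, so the maximum principle applies to 1 / D in s.
  -- The lower bound μ / 2 |w| ^ k thus passes from the circle to s = 0, where a 0 = 0 leaves only D
  -- = O(|w| ^ (k + 1)); the choice of w makes this a contradiction.
  have hbd : ∀ s ∈ frontier (Metric.ball (0 : ℂ) r), ‖(D (s • t₁) w)⁻¹‖ ≤ (μ / 2 * ‖w‖ ^ k)⁻¹ := by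
    intro s hs
    rw [frontier_ball _ hr0.ne'] at hs
    have hsr : ‖s‖ = r := by simpa using hs
    obtain ⟨-, h2, -⟩ := hpr (s • t₁) w (hst s (hsr.le.trans hr1)) hwρ
    have h3 : μ ≤ ‖a (s • t₁)‖ := hmin hs
    rw [norm_inv]
    refine inv_anti₀ (by positivity) ?_
    have h4 : ‖a (s • t₁) * w ^ k‖ ≤ ‖D (s • t₁) w‖ + ‖D (s • t₁) w - a (s • t₁) * w ^ k‖ := by
      rw [norm_sub_rev (D _ _)]
      exact norm_le_norm_add_norm_sub' _ _
    rw [norm_mul, norm_pow] at h4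
    rw [pow_succ] at h2
    nlinarith
  have hdiff : DiffContOnCl ℂ (fun s : ℂ => (D (s • t₁) w)⁻¹) (Metric.ball 0 r) := by
    refine DifferentiableOn.diffContOnCl ?_
    intro s hs
    have hs' : ‖s‖ ≤ 1 := by
      have := Metric.closure_ball_subset_closedBall hs
      exact (by simpa using this : ‖s‖ ≤ r).trans hr1
    obtain ⟨h1, -, h3, -⟩ := hpr (s • t₁) w (hst s hs') hwρ
    have h4 : AnalyticAt ℂ (fun s : ℂ => D (s • t₁) w) s :=
      AnalyticAt.comp_of_eq (f := fun s : ℂ => (s • t₁, w)) h3 (by fun_prop) rfl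
    exact (h4.differentiableAt.inv (h1 hw0)).differentiableWithinAt
  have h1 := Complex.norm_le_of_forall_mem_frontier_norm_le Metric.isBounded_ball hdiff hbd
    (subset_closure (Metric.mem_ball_self hr0))
  simp only [zero_smul, norm_inv] at h1
  obtain ⟨h2, h3, -⟩ := hpr 0 w (by simpa using hρ) hwρ
  rw [inv_le_inv₀ (norm_pos_iff.2 (h2 hw0)) (by positivity)] at h1
  rw [ha0, zero_mul, sub_zero, pow_succ] at h3
  nlinarith

end PuiseuxExpansion

end Carrousel

/-! ### Conjugate determinations and the initial terms of the series -/

namespace Carrousel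

namespace PuiseuxExpansion

variable {m d : ℕ} {P : Param m → ℂ → ℂ[X]} {E : PuiseuxExpansion d P}

/-- This is the form in which `exists_coeff_ne` is used: after agreement below k, equality at the
single parameter t = 0 forces equality for all small t. -/
theorem Agree.succ_of_coeff_eq (hP : IsEquisingularFamily d P) {i j : Fin d} {k : ℕ}
    (h : E.Agree i j k) (h0 : E.coeff i k 0 = E.coeff j k 0) : E.Agree i j (k + 1) := by
  by_cases hij : i = j
  · subst hij; exact .refl _ _
  obtain ⟨k', h1, h2⟩ := E.exists_coeff_ne hP hij
  rcases lt_trichotomy k' k with h3 | rfl | h3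
  · exact absurd (h k' h3).self_of_nhds.symm h2
  · exact absurd h0 h2
  · exact h1.mono h3

theorem coeff_conj {i j : Fin d} {ζ : ℂ} (hζ : ζ ^ E.N = 1)
    (h : ∀ᶠ q in 𝓝 (0 : Param m × ℂ), E.root j q.1 q.2 = E.root i q.1 (ζ * q.2)) (l : ℕ) :
    ∀ᶠ t in 𝓝 (0 : Param m), E.coeff j l t = ζ ^ l * E.coeff i l t := by
  have hζ0 : ζ ≠ 0 := by
    rintro rfl
    rw [zero_pow E.N_pos.ne'] at hζ
    exact zero_ne_one hζ
  have h1 := (nhds_prod_eq (x := (0 : Param m)) (y := (0 : ℂ)) ▸ h).curry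
  have hmul : Tendsto (fun w : ℂ => ζ * w) (𝓝[≠] 0) (𝓝[≠] 0) := by
    refine tendsto_nhdsWithin_iff.2 ⟨?_, ?_⟩
    · exact (Continuous.tendsto' (by fun_prop) _ _ (by simp)).mono_left nhdsWithin_le_nhds
    · filter_upwards [eventually_mem_nhdsWithin] with w hw
      exact mul_ne_zero hζ0 hw
  filter_upwards [h1, E.root_isLittleO i l, E.root_isLittleO j l] with t ht hi hj
  have hO : ((fun w : ℂ => w ^ l) ∘ fun w => ζ * w) =O[𝓝[≠] 0] fun w : ℂ => w ^ l :=
    Asymptotics.IsBigO.of_bound (‖ζ‖ ^ l) (Eventually.of_forall fun w => by simp [mul_pow])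
  have hi2 := (hi.comp_tendsto hmul).trans_isBigO hO
  have h2 : (fun w => ∑ l' ∈ Finset.range (l + 1),
      (ζ ^ l' * E.coeff i l' t - E.coeff j l' t) * w ^ l') =o[𝓝[≠] 0] fun w : ℂ => w ^ l := by
    refine (hj.sub hi2).congr' ?_ EventuallyEq.rfl
    filter_upwards [nhdsWithin_le_nhds ht] with w hw
    simp only [Function.comp_apply, hw, partialSum, sub_mul, Finset.sum_sub_distrib, mul_pow]
    rw [sub_sub_sub_cancel_left]
    congr 1
    exact Finset.sum_congr rfl fun l _ => by ring
  have h3 := coeff_eq_zero_of_isLittleO le_rfl h2 l le_rfl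
  exact (sub_eq_zero.1 h3).symm

/-- The determinations of a Puiseux series form a permutation of the roots. -/
theorem exists_conj (hP : IsEquisingularFamily d P) {ζ : ℂ} (hζ : ζ ^ E.N = 1) :
    ∃ σ : Equiv.Perm (Fin d), ∀ i,
      ∀ᶠ q in 𝓝 (0 : Param m × ℂ), E.root (σ i) q.1 q.2 = E.root i q.1 (ζ * q.2) := by
  have hζ0 : ζ ≠ 0 := by
    rintro rfl
    rw [zero_pow E.N_pos.ne'] at hζ
    exact zero_ne_one hζ
  have hrot : Tendsto (fun q : Param m × ℂ => (q.1, ζ * q.2)) (𝓝 0) (𝓝 0) :=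
    Continuous.tendsto' (by fun_prop) _ _ (by simp [Prod.ext_iff])
  have han : ∀ i, AnalyticAt ℂ (fun q : Param m × ℂ => E.root i q.1 (ζ * q.2)) 0 := fun i =>
    AnalyticAt.comp_of_eq (f := fun q : Param m × ℂ => (q.1, ζ * q.2)) (E.analytic i)
      (analyticAt_fst.prod (analyticAt_const.mul analyticAt_snd)) (by simp [Prod.ext_iff])
  obtain ⟨ρ, hρ, h⟩ := Metric.eventually_nhds_iff_ball.1 ((E.factor.and (hrot.eventually E.factor)).and
    (((E.eventually_root_ne hP).and (hrot.eventually (E.eventually_root_ne hP))).and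
      ((eventually_all.2 fun i => (E.analytic i).eventually_analyticAt).and
        (eventually_all.2 fun i => (han i).eventually_analyticAt))))
  -- A base point with w ≠ 0. There the roots are distinct, so the rotated root equals some root
  -- nearby, and the identity theorem spreads the equality over the ball.
  set p : Param m × ℂ := (0, ((ρ / 2 : ℝ) : ℂ)) with hp
  have hpB : p ∈ Metric.ball (0 : Param m × ℂ) ρ := by
    rw [mem_ball_zero_iff, Prod.norm_def, hp]
    simp [abs_of_pos hρ, hρ]
  have hp2 : p.2 ≠ 0 := by simp [hp, hρ.ne']
  have key : ∀ i, ∃ j, ∀ q ∈ Metric.ball (0 : Param m × ℂ) ρ,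
      E.root j q.1 q.2 = E.root i q.1 (ζ * q.2) := by
    intro i
    obtain ⟨j, hj⟩ := exists_eventuallyEq_of_root (p := p)
      (ψ := fun j q => E.root j q.1 q.2) (h := fun q : Param m × ℂ => E.root i q.1 (ζ * q.2))
      (fun j => ((h p hpB).2.2.1 j).continuousAt) ((h p hpB).2.1.1 hp2)
      ((h p hpB).2.2.2 i).continuousAt (by
        filter_upwards [Metric.isOpen_ball.mem_nhds hpB] with q hq
        obtain ⟨⟨h1, h2⟩, -⟩ := h q hq
        rw [mul_pow, hζ, one_mul] at h2
        refine (isRoot_prod_iff _ _).1 (h1 ▸ ?_)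
        rw [h2]
        exact (isRoot_prod_iff _ _).2 ⟨i, rfl⟩)
    refine ⟨j, fun q hq => ?_⟩
    have h1 := AnalyticOnNhd.eqOn_of_preconnected_of_eventuallyEq
      (f := fun q : Param m × ℂ => E.root i q.1 (ζ * q.2)) (g := fun q => E.root j q.1 q.2)
      (fun q hq => (h q hq).2.2.2 i) (fun q hq => (h q hq).2.2.1 j)
      (convex_ball _ _).isPreconnected hpB hj hq
    exact h1.symm
  choose σ hσ using key
  have hσi : Function.Injective σ := by
    intro i j hij
    have h1 := (hσ i p hpB).symm.trans ((congrArg (fun k => E.root k p.1 p.2) hij).trans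
      (hσ j p hpB))
    exact (h p hpB).2.1.2 (mul_ne_zero hζ0 hp2) h1
  refine ⟨Equiv.ofBijective σ (Finite.injective_iff_bijective.1 hσi), fun i => ?_⟩
  filter_upwards [Metric.ball_mem_nhds (0 : Param m × ℂ) hρ] with q hq
  exact hσ i q hq

/-- Transversality gives |y| ≤ K |w| ^ N on the curve at t = 0, which excludes terms of lower order.
-/
theorem coeff_zero_eq_zero_of_lt (hP : IsEquisingularFamily d P) (i : Fin d) {l : ℕ} (hl : l < E.N) :
    E.coeff i l 0 = 0 := by
  obtain ⟨K, hK⟩ := hP.transverse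
  have h1 := (E.root_isLittleO i l).self_of_nhds
  have hpow : Tendsto (fun w : ℂ => w ^ E.N) (𝓝 0) (𝓝 0) :=
    Continuous.tendsto' (by fun_prop) _ _ (by simp [E.N_pos.ne'])
  have hc : Tendsto (fun w : ℂ => ((0 : Param m), w)) (𝓝 0) (𝓝 0) :=
    Continuous.tendsto' (by fun_prop) _ _ rfl
  have h2 : (fun w => E.root i 0 w) =O[𝓝 0] fun w => w ^ E.N := by
    refine Asymptotics.IsBigO.of_bound K ?_
    filter_upwards [hpow.eventually hK, hc.eventually E.factor] with w h3 h4
    refine h3 _ ?_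
    rw [h4]
    exact (isRoot_prod_iff _ _).2 ⟨i, rfl⟩
  have h3 := (h2.trans_isLittleO (Asymptotics.isLittleO_pow_pow hl)).mono
    (nhdsWithin_le_nhds (s := {0}ᶜ))
  have h4 := (h3.sub h1)
  simp only [sub_sub_cancel] at h4
  exact coeff_eq_zero_of_isLittleO le_rfl h4 l le_rfl

theorem agree_N (hP : IsEquisingularFamily d P) (i j : Fin d) : E.Agree i j E.N := by
  have h1 : ∀ k ≤ E.N, E.Agree i j k := by
    intro k
    induction k with
    | zero => intro _ l hl; omega
    | succ k ih =>
      intro hk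
      refine (ih (by omega)).succ_of_coeff_eq hP ?_
      rw [coeff_zero_eq_zero_of_lt hP i hk, coeff_zero_eq_zero_of_lt hP j hk]
  exact h1 _ le_rfl

/-- All series have the same coefficients below N, by induction from their vanishing at t = 0. For l
= 0 the common value is 0 because 0 is a root of P t 0. For 0 < l < N, rotation by a primitive root
of unity multiplies the coefficient by ζ ^ l ≠ 1 but cannot change it. -/
theorem coeff_eventually_zero_of_lt (hP : IsEquisingularFamily d P) (i : Fin d) {l : ℕ}
    (hl : l < E.N) : ∀ᶠ t in 𝓝 (0 : Param m), E.coeff i l t = 0 := by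
  rcases Nat.eq_zero_or_pos l with rfl | hl0
  · have hc : Tendsto (fun t : Param m => (t, (0 : ℂ))) (𝓝 0) (𝓝 0) :=
      Continuous.tendsto' (by fun_prop) _ _ rfl
    filter_upwards [hP.zero_mem, hc.eventually E.factor,
      eventually_all.2 fun j => agree_N hP j i 0 hl] with t h1 h2 h3
    rw [zero_pow E.N_pos.ne'] at h2
    rw [h2] at h1
    obtain ⟨j, hj⟩ := (isRoot_prod_iff _ _).1 h1
    rw [h3 j, hj]
    simp [coeff]
  · set ζ := Complex.exp (2 * Real.pi * Complex.I / E.N) with hζ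
    have hprim : IsPrimitiveRoot ζ E.N := Complex.isPrimitiveRoot_exp _ E.N_pos.ne'
    obtain ⟨σ, hσ⟩ := exists_conj (E := E) hP hprim.pow_eq_one
    filter_upwards [coeff_conj hprim.pow_eq_one (hσ i) l, agree_N hP i (σ i) l hl] with t h1 h2
    rw [h2] at h1
    have h3 : (1 - ζ ^ l) * E.coeff i l t = 0 := by linear_combination h1
    exact (mul_eq_zero.1 h3).resolve_left
      (sub_ne_zero.2 (hprim.pow_ne_one_of_pos_of_lt hl0.ne' hl).symm)

end PuiseuxExpansion

namespace Truncation

variable {m d : ℕ} {P : Param m → ℂ → ℂ[X]} {E : PuiseuxExpansion d P} {M : Truncation E}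

/-- If the exponent `k / N` is missing in a series that agrees with the `j`-th series up to there,
then no coefficient of the pair represented by `(j, k)` vanishes at `t = 0`. -/
theorem hasCore_of_missing (hP : IsEquisingularFamily d P) {i j : Fin d} {k : ℕ}
    (hij : E.Agree i j k) (hi : ∀ᶠ t in 𝓝 (0 : Param m), E.coeff i k t = 0) : M.HasCore j k := by
  intro j' hj' h0
  have h1 : E.Agree i j' k := hij.trans hj'.2
  have h2 := h1.succ_of_coeff_eq hP (by rw [h0, hi.self_of_nhds])
  refine hj'.1.2.2 ?_
  filter_upwards [h2 k (Nat.lt_succ_self k), hi] with t h3 h4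
  rw [h3, h4]

end Truncation

end Carrousel

namespace Carrousel

/-! ### Calculus of semi-algebraic sets -/

namespace SemialgebraicSet

variable {n : ℕ} {s s' : Set (Fin n → ℝ)}

theorem inter (h : SemialgebraicSet s) (h' : SemialgebraicSet s') : SemialgebraicSet (s ∩ s') := by
  rw [← compl_compl (s ∩ s'), Set.compl_inter]
  exact (h.compl.union h'.compl).compl

theorem eq_zero (p : MvPolynomial (Fin n) ℝ) :
    SemialgebraicSet {v : Fin n → ℝ | MvPolynomial.eval v p = 0} := by
  have h := (SemialgebraicSet.pos p).compl.inter (SemialgebraicSet.pos (-p)).compl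
  convert h using 1
  ext v
  simp only [map_neg, Set.mem_ofPred_eq, Set.mem_inter_iff, Set.mem_compl_iff, not_lt,
    Left.neg_nonpos_iff]
  exact le_antisymm_iff

/-- By induction on the construction of the set. For a projection the substitution is extended by
one free variable, which is projected away afterwards. -/
theorem preimage_poly {k : ℕ} {s : Set (Fin k → ℝ)} (hs : SemialgebraicSet s) :
    ∀ {n : ℕ} (g : Fin k → MvPolynomial (Fin n) ℝ),
      SemialgebraicSet {v : Fin n → ℝ | (fun i => MvPolynomial.eval v (g i)) ∈ s} := by
  induction hs with
  | pos p =>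
    intro n g
    convert SemialgebraicSet.pos (MvPolynomial.bind₁ g p) using 1
    ext v
    simp only [Set.mem_ofPred_eq]
    have h : MvPolynomial.eval v (MvPolynomial.bind₁ g p) =
        MvPolynomial.eval (fun i => MvPolynomial.eval v (g i)) p :=
      MvPolynomial.eval₂Hom_bind₁ _ _ _ _
    rw [h]
  | compl _ ih => intro n g; exact (ih g).compl
  | union _ _ ih ih' => intro n g; exact (ih g).union (ih' g)
  | @proj k s hs ih =>
    intro n g
    have h := (ih (Fin.snoc (α := fun _ => MvPolynomial (Fin (n + 1)) ℝ)
      (fun i => MvPolynomial.rename Fin.castSucc (g i))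
      (MvPolynomial.X (Fin.last n)))).proj
    convert h using 1
    ext v
    have key : ∀ u : Fin (n + 1) → ℝ, (fun i => MvPolynomial.eval u
        ((Fin.snoc (α := fun _ => MvPolynomial (Fin (n + 1)) ℝ)
        (fun i => MvPolynomial.rename Fin.castSucc (g i)) (MvPolynomial.X (Fin.last n)) :
        Fin (k + 1) → MvPolynomial (Fin (n + 1)) ℝ) i)) =
        Fin.snoc (α := fun _ => ℝ) (fun i => MvPolynomial.eval (fun i => u i.castSucc) (g i))
          (u (Fin.last n)) := by
      intro u
      ext i
      refine Fin.lastCases ?_ (fun i => ?_) i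
      · simp
      · simp [MvPolynomial.eval_rename, Function.comp_def]
    simp only [Set.mem_ofPred_eq, Set.mem_image, key]
    constructor
    · rintro ⟨u, hu, huv⟩
      refine ⟨Fin.snoc (α := fun _ => ℝ) v (u (Fin.last k)), ?_, by simp⟩
      simp only [Fin.snoc_castSucc, Fin.snoc_last]
      rw [← huv]
      convert hu using 1
      exact Fin.snoc_init_self u
    · rintro ⟨u, hu, rfl⟩
      exact ⟨_, hu, by simp⟩

theorem proj_castAdd {n : ℕ} : ∀ {k : ℕ} {s : Set (Fin (n + k) → ℝ)}, SemialgebraicSet s →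
    SemialgebraicSet ((fun v (i : Fin n) => v (i.castAdd k)) '' s)
  | 0, s, hs => by
    have h : (fun v (i : Fin n) => v (i.castAdd 0)) '' s = s := Set.image_id s
    rw [h]
    exact hs
  | k + 1, s, hs => by
    have h := proj_castAdd (k := k) (SemialgebraicSet.proj (n := n + k) hs)
    rw [← Set.image_comp] at h
    exact h

end SemialgebraicSet

/-- The polynomial of a linear form. -/
theorem exists_poly_of_linear {n : ℕ} (f : (Fin n → ℝ) →ₗ[ℝ] ℝ) :
    ∃ p : MvPolynomial (Fin n) ℝ, ∀ v, MvPolynomial.eval v p = f v := by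
  refine ⟨∑ i, MvPolynomial.C (f (Pi.single i 1)) * MvPolynomial.X i, fun v => ?_⟩
  simp only [map_sum, map_mul, MvPolynomial.eval_C, MvPolynomial.eval_X]
  conv_rhs => rw [← LinearMap.sum_single_apply (fun _ => ℝ) v, map_sum]
  refine Finset.sum_congr rfl fun i _ => ?_
  have : (Pi.single i (v i) : Fin n → ℝ) = v i • Pi.single i 1 := by
    ext j; by_cases h : j = i
    · subst h; simp
    · simp [h]
  rw [this, map_smul, smul_eq_mul, mul_comm]

section SA

variable {E F G : Type*} [AddCommGroup E] [Module ℝ E] [AddCommGroup F] [Module ℝ F]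
  [AddCommGroup G] [Module ℝ G]

/-- A set whose pullbacks to all coordinate spaces are semi-algebraic. -/
def SA (S : Set E) : Prop :=
  ∀ (n : ℕ) (f : (Fin n → ℝ) →ₗ[ℝ] E), SemialgebraicSet (f ⁻¹' S)

theorem SA.isSemialgebraic [FiniteDimensional ℝ E] {S : Set E} (h : SA S) : IsSemialgebraic S := by
  refine ⟨_, (Module.finBasis ℝ E).equivFun, ?_⟩
  rw [LinearEquiv.image_eq_preimage_symm]
  exact h _ (Module.finBasis ℝ E).equivFun.symm.toLinearMap

theorem IsSemialgebraic.sa {S : Set E} (h : IsSemialgebraic S) : SA S := by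
  obtain ⟨k, e, he⟩ := h
  intro n f
  choose g hg using fun i => exists_poly_of_linear
    ((LinearMap.proj i : (Fin k → ℝ) →ₗ[ℝ] ℝ) ∘ₗ (e : E →ₗ[ℝ] (Fin k → ℝ)) ∘ₗ f)
  convert he.preimage_poly g using 1
  ext v
  simp only [Set.mem_preimage, Set.mem_ofPred_eq, hg]
  exact (Function.Injective.mem_set_image e.injective).symm

theorem SA.congr {S S' : Set E} (h : SA S) (hS : ∀ x, x ∈ S' ↔ x ∈ S) : SA S' :=
  Set.ext hS ▸ h

theorem SA.preimage {S : Set F} (h : SA S) (g : E →ₗ[ℝ] F) : SA (g ⁻¹' S) :=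
  fun n f => h n (g ∘ₗ f)

theorem SA.compl {S : Set E} (h : SA S) : SA Sᶜ := fun n f => (h n f).compl

theorem SA.union {S S' : Set E} (h : SA S) (h' : SA S') : SA (S ∪ S') :=
  fun n f => (h n f).union (h' n f)

theorem SA.inter {S S' : Set E} (h : SA S) (h' : SA S') : SA (S ∩ S') :=
  fun n f => (h n f).inter (h' n f)

theorem SA.univ : SA (Set.univ : Set E) := by
  intro n f
  convert SemialgebraicSet.pos (1 : MvPolynomial (Fin n) ℝ) using 1
  ext; simp

theorem SA.iInter {ι : Type*} [Finite ι] {S : ι → Set E} (h : ∀ i, SA (S i)) : SA (⋂ i, S i) := by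
  classical
  cases nonempty_fintype ι
  have h1 : ∀ s : Finset ι, SA (⋂ i ∈ s, S i) := by
    intro s
    induction s using Finset.induction_on with
    | empty => simpa using SA.univ
    | insert i s _ ih => rw [Finset.set_biInter_insert]; exact (h i).inter ih
  simpa using h1 Finset.univ

theorem SA.forall_finite {ι : Type*} [Finite ι] {p : ι → E → Prop} (h : ∀ i, SA {x | p i x}) :
    SA {x | ∀ i, p i x} := by
  rw [Set.ofPred_forall]; exact SA.iInter h

/-- Quantifier elimination is built into the definition as closure under projections. This lemma and
its complement make every first-order formula available. -/
theorem SA.exists_mem [FiniteDimensional ℝ F] {S : Set (E × F)} (h : SA S) :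
    SA {x | ∃ y, (x, y) ∈ S} := by
  intro n f
  set k := Module.finrank ℝ F
  set e := (Module.finBasis ℝ F).equivFun
  have h1 := h (n + k) ((f ∘ₗ LinearMap.funLeft ℝ ℝ (Fin.castAdd k)).prod
    ((e.symm : (Fin k → ℝ) →ₗ[ℝ] F) ∘ₗ LinearMap.funLeft ℝ ℝ (Fin.natAdd n)))
  convert h1.proj_castAdd using 1
  ext v
  simp only [Set.mem_preimage, Set.mem_ofPred_eq, Set.mem_image]
  constructor
  · rintro ⟨y, hy⟩
    refine ⟨Fin.append v (e y), ?_, ?_⟩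
    · have h1 : (LinearMap.funLeft ℝ ℝ (Fin.castAdd k)) (Fin.append v (e y)) = v := by
        ext i; simp [LinearMap.funLeft_apply]
      have h2 : (LinearMap.funLeft ℝ ℝ (Fin.natAdd n)) (Fin.append v (e y)) = e y := by
        ext i; simp [LinearMap.funLeft_apply]
      change (f _, e.symm _) ∈ S
      rw [h1, h2, LinearEquiv.symm_apply_apply]
      exact hy
    · ext i; simp
  · rintro ⟨u, hu, rfl⟩
    exact ⟨_, hu⟩

theorem SA.forall_mem [FiniteDimensional ℝ F] {S : Set (E × F)} (h : SA S) :
    SA {x | ∀ y, (x, y) ∈ S} := by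
  convert (SA.exists_mem h.compl).compl using 1
  ext; simp

theorem SA.pos_real : SA {a : ℝ | 0 < a} := by
  intro n f
  obtain ⟨p, hp⟩ := exists_poly_of_linear f
  convert SemialgebraicSet.pos p using 1
  ext v; simp [hp]

theorem SA.zero_real : SA {a : ℝ | a = 0} := by
  intro n f
  obtain ⟨p, hp⟩ := exists_poly_of_linear f
  convert SemialgebraicSet.eq_zero p using 1
  ext v; simp [hp]

theorem SA.zero [FiniteDimensional ℝ E] : SA {a : E | a = 0} := by
  have h : SA {a : E | ∀ i, (Module.finBasis ℝ E).equivFun a i = 0} := by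
    refine SA.forall_finite fun i => ?_
    exact SA.zero_real.preimage
      ((LinearMap.proj i) ∘ₗ ((Module.finBasis ℝ E).equivFun : E →ₗ[ℝ] (Fin _ → ℝ)))
  convert h using 1
  ext a
  simp only [Set.mem_ofPred_eq]
  rw [← LinearEquiv.map_eq_zero_iff (Module.finBasis ℝ E).equivFun, funext_iff]
  rfl

/-- The graph of `f` is semi-algebraic. -/
def SAFun (f : E → F) : Prop := SA {p : E × F | p.2 = f p.1}

theorem SAFun.of_graph {f : E → F} {S : Set (E × F)} (h : SA S)
    (hS : ∀ x y, y = f x ↔ (x, y) ∈ S) : SAFun f :=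
  h.congr fun p => hS p.1 p.2

theorem SAFun.linear [FiniteDimensional ℝ F] (g : E →ₗ[ℝ] F) : SAFun g := by
  have h := (SA.zero (E := F)).preimage (LinearMap.snd ℝ E F - g ∘ₗ LinearMap.fst ℝ E F)
  exact SAFun.of_graph h fun x y => by simp [sub_eq_zero]

theorem SA.preimage_fun [FiniteDimensional ℝ F] {S : Set F} {f : E → F} (hS : SA S)
    (hf : SAFun f) : SA (f ⁻¹' S) := by
  have h := SA.exists_mem (hf.inter (hS.preimage (LinearMap.snd ℝ E F)))
  convert h using 1
  ext x
  simp

theorem SAFun.comp [FiniteDimensional ℝ F] {g : F → G} {f : E → F} (hg : SAFun g)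
    (hf : SAFun f) : SAFun fun x => g (f x) := by
  have h := SA.exists_mem (E := E × G) (F := F)
    ((hf.preimage ((LinearMap.fst ℝ E G ∘ₗ LinearMap.fst ℝ (E × G) F).prod
      (LinearMap.snd ℝ (E × G) F))).inter
      (hg.preimage ((LinearMap.snd ℝ (E × G) F).prod
        (LinearMap.snd ℝ E G ∘ₗ LinearMap.fst ℝ (E × G) F))))
  exact SAFun.of_graph h fun x y => by simp

theorem SAFun.prodMk {f : E → F} {g : E → G} (hf : SAFun f) (hg : SAFun g) :
    SAFun fun x => (f x, g x) := by
  have h := (hf.preimage ((LinearMap.fst ℝ E (F × G)).prod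
      (LinearMap.fst ℝ F G ∘ₗ LinearMap.snd ℝ E (F × G)))).inter
    (hg.preimage ((LinearMap.fst ℝ E (F × G)).prod
      (LinearMap.snd ℝ F G ∘ₗ LinearMap.snd ℝ E (F × G))))
  exact SAFun.of_graph h fun x y => by simp [Prod.ext_iff]

theorem SAFun.fst [FiniteDimensional ℝ E] : SAFun (Prod.fst : E × F → E) :=
  SAFun.linear (LinearMap.fst ℝ E F)

theorem SAFun.snd [FiniteDimensional ℝ F] : SAFun (Prod.snd : E × F → F) :=
  SAFun.linear (LinearMap.snd ℝ E F)

theorem SAFun.const [FiniteDimensional ℝ F] (a : F) : SAFun fun _ : E => a := by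
  have h : SA {b : F | b = a} := by
    intro n f
    choose g hg using fun i => exists_poly_of_linear
      ((LinearMap.proj i : (Fin _ → ℝ) →ₗ[ℝ] ℝ) ∘ₗ
        (Module.finBasis ℝ F).equivFun.toLinearMap ∘ₗ f)
    have h1 : SA (E := Fin n → ℝ) {v | ∀ i, f v = f v ∧
        MvPolynomial.eval v (g i - MvPolynomial.C ((Module.finBasis ℝ F).equivFun a i)) = 0} := by
      refine SA.forall_finite fun i => ?_
      simp only [true_and]
      intro k f'
      choose g' hg' using fun i => exists_poly_of_linear
        ((LinearMap.proj i : (Fin _ → ℝ) →ₗ[ℝ] ℝ) ∘ₗ f')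
      convert (SemialgebraicSet.eq_zero (g i -
        MvPolynomial.C ((Module.finBasis ℝ F).equivFun a i))).preimage_poly g' using 1
      ext v
      simp only [hg']
      rfl
    convert h1 n LinearMap.id using 1
    ext v
    simp only [Set.mem_preimage, Set.mem_ofPred_eq, true_and, map_sub, MvPolynomial.eval_C,
      sub_eq_zero, hg, LinearMap.id_apply]
    rw [← (Module.finBasis ℝ F).equivFun.injective.eq_iff, funext_iff]
    rfl
  exact h.preimage (LinearMap.snd ℝ E F)

theorem SAFun.mul_real {f g : E → ℝ} (hf : SAFun f) (hg : SAFun g) : SAFun fun x => f x * g x := by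
  have h : SAFun fun p : ℝ × ℝ => p.1 * p.2 := by
    intro n f
    obtain ⟨p, hp⟩ := exists_poly_of_linear (LinearMap.fst ℝ ℝ ℝ ∘ₗ LinearMap.fst ℝ (ℝ × ℝ) ℝ ∘ₗ f)
    obtain ⟨q, hq⟩ := exists_poly_of_linear (LinearMap.snd ℝ ℝ ℝ ∘ₗ LinearMap.fst ℝ (ℝ × ℝ) ℝ ∘ₗ f)
    obtain ⟨r, hr⟩ := exists_poly_of_linear (LinearMap.snd ℝ (ℝ × ℝ) ℝ ∘ₗ f)
    convert SemialgebraicSet.eq_zero (r - p * q) using 1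
    ext v
    simp [hp, hq, hr, sub_eq_zero]
  exact SAFun.comp h (hf.prodMk hg)

theorem SAFun.add [FiniteDimensional ℝ F] {f g : E → F} (hf : SAFun f) (hg : SAFun g) :
    SAFun fun x => f x + g x :=
  SAFun.comp (SAFun.linear (LinearMap.fst ℝ F F + LinearMap.snd ℝ F F)) (hf.prodMk hg)

theorem SAFun.sub [FiniteDimensional ℝ F] {f g : E → F} (hf : SAFun f) (hg : SAFun g) :
    SAFun fun x => f x - g x :=
  SAFun.comp (SAFun.linear (LinearMap.fst ℝ F F - LinearMap.snd ℝ F F)) (hf.prodMk hg)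

theorem SAFun.sum [FiniteDimensional ℝ F] {ι : Type*} (s : Finset ι) {f : ι → E → F}
    (hf : ∀ i ∈ s, SAFun (f i)) : SAFun fun x => ∑ i ∈ s, f i x := by
  classical
  induction s using Finset.induction_on with
  | empty => simpa using SAFun.const (0 : F)
  | insert i s hi ih =>
    simp only [Finset.sum_insert hi]
    exact (hf i (by simp)).add (ih fun j hj => hf j (by simp [hj]))

theorem SAFun.re {f : E → ℂ} (hf : SAFun f) : SAFun fun x => (f x).re :=
  SAFun.comp (SAFun.linear Complex.reLm) hf

theorem SAFun.im {f : E → ℂ} (hf : SAFun f) : SAFun fun x => (f x).im :=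
  SAFun.comp (SAFun.linear Complex.imLm) hf

theorem SAFun.complex_mk {f g : E → ℝ} (hf : SAFun f) (hg : SAFun g) :
    SAFun fun x => (⟨f x, g x⟩ : ℂ) :=
  SAFun.comp (SAFun.linear (Complex.equivRealProdLm.symm : ℝ × ℝ →ₗ[ℝ] ℂ)) (hf.prodMk hg)

theorem SAFun.ofReal {f : E → ℝ} (hf : SAFun f) : SAFun fun x => (f x : ℂ) :=
  hf.complex_mk (SAFun.const 0)

theorem SAFun.mul {f g : E → ℂ} (hf : SAFun f) (hg : SAFun g) : SAFun fun x => f x * g x := by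
  have h := ((hf.re.mul_real hg.re).sub (hf.im.mul_real hg.im)).complex_mk
    ((hf.re.mul_real hg.im).add (hf.im.mul_real hg.re))
  convert h using 2
  exact Complex.ext (by simp) (by simp)

theorem SAFun.pow {f : E → ℂ} (hf : SAFun f) (n : ℕ) : SAFun fun x => f x ^ n := by
  induction n with
  | zero => simpa using SAFun.const (1 : ℂ)
  | succ n ih => simp only [pow_succ]; exact ih.mul hf

theorem SAFun.setOf_eq [FiniteDimensional ℝ F] {f g : E → F} (hf : SAFun f) (hg : SAFun g) :
    SA {x | f x = g x} := by
  convert SA.zero.preimage_fun (hf.sub hg) using 1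
  ext x; simp [sub_eq_zero]

theorem SAFun.setOf_lt {f g : E → ℝ} (hf : SAFun f) (hg : SAFun g) : SA {x | f x < g x} := by
  convert SA.pos_real.preimage_fun (hg.sub hf) using 1
  ext x; simp

theorem SAFun.setOf_le {f g : E → ℝ} (hf : SAFun f) (hg : SAFun g) : SA {x | f x ≤ g x} := by
  convert (hg.setOf_lt hf).compl using 1
  ext x; simp

theorem SA.and {p q : E → Prop} (hp : SA {x | p x}) (hq : SA {x | q x}) : SA {x | p x ∧ q x} :=
  hp.inter hq

theorem SA.or {p q : E → Prop} (hp : SA {x | p x}) (hq : SA {x | q x}) : SA {x | p x ∨ q x} :=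
  hp.union hq

theorem SA.imp {p q : E → Prop} (hp : SA {x | p x}) (hq : SA {x | q x}) : SA {x | p x → q x} := by
  convert hp.compl.union hq using 1
  ext x; simp [imp_iff_not_or]

theorem SAFun.norm {f : E → ℂ} (hf : SAFun f) : SAFun fun x => ‖f x‖ := by
  have h : SAFun fun z : ℂ => ‖z‖ := by
    have hz : SAFun fun p : ℂ × ℝ => p.1 := SAFun.fst
    have hr : SAFun fun p : ℂ × ℝ => p.2 := SAFun.snd
    refine SAFun.of_graph (((SAFun.const 0).setOf_le hr).and ((hr.mul_real hr).setOf_eq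
      ((hz.re.mul_real hz.re).add (hz.im.mul_real hz.im)))) fun z r => ?_
    have h1 : z.re * z.re + z.im * z.im = ‖z‖ * ‖z‖ := by
      rw [← pow_two ‖z‖, Complex.sq_norm, Complex.normSq_apply]
    simp only [Set.mem_ofPred_eq, h1]
    constructor
    · rintro rfl; simp
    · rintro ⟨h0, h⟩; exact (mul_self_inj h0 (norm_nonneg z)).1 h
  exact SAFun.comp h hf

theorem SAFun.inv_real {f : E → ℝ} (hf : SAFun f) : SAFun fun x => (f x)⁻¹ := by
  have h : SAFun fun z : ℝ => z⁻¹ := by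
    have hz : SAFun fun p : ℝ × ℝ => p.1 := SAFun.fst
    have hr : SAFun fun p : ℝ × ℝ => p.2 := SAFun.snd
    -- The second alternative encodes the convention 0⁻¹ = 0.
    refine SAFun.of_graph (((hz.mul_real hr).setOf_eq (SAFun.const 1)).or
      ((hz.setOf_eq (SAFun.const 0)).and (hr.setOf_eq (SAFun.const 0)))) fun z r => ?_
    simp only [Set.mem_ofPred_eq]
    constructor
    · rintro rfl
      by_cases h : z = 0
      · simp [h]
      · simp [h]
    · rintro (h | ⟨rfl, rfl⟩)
      · exact eq_inv_of_mul_eq_one_right h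
      · simp
  exact SAFun.comp h hf

theorem SAFun.max {f g : E → ℝ} (hf : SAFun f) (hg : SAFun g) : SAFun fun x => max (f x) (g x) := by
  have h : SAFun fun p : ℝ × ℝ => Max.max p.1 p.2 := by
    have h1 : SAFun fun p : (ℝ × ℝ) × ℝ => p.1.1 := SAFun.comp SAFun.fst SAFun.fst
    have h2 : SAFun fun p : (ℝ × ℝ) × ℝ => p.1.2 := SAFun.comp SAFun.snd SAFun.fst
    have hr : SAFun fun p : (ℝ × ℝ) × ℝ => p.2 := SAFun.snd
    refine SAFun.of_graph (((h1.setOf_le h2).and (hr.setOf_eq h2)).or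
      ((h2.setOf_le h1).and (hr.setOf_eq h1))) fun ⟨a, b⟩ r => ?_
    simp only [Set.mem_ofPred_eq]
    rcases le_total a b with h | h
    · rw [max_eq_right h]; grind
    · rw [max_eq_left h]; grind
  exact SAFun.comp h (hf.prodMk hg)

theorem SAFun.neg_real {f : E → ℝ} (hf : SAFun f) : SAFun fun x => -f x := by
  simpa using (SAFun.const (0 : ℝ)).sub hf

theorem SAFun.min {f g : E → ℝ} (hf : SAFun f) (hg : SAFun g) : SAFun fun x => min (f x) (g x) := by
  convert (hf.neg_real.max hg.neg_real).neg_real using 2 with x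
  rw [max_neg_neg, neg_neg]

end SA

end Carrousel

/-! ### Semi-algebraicity of the Puiseux coefficients -/

namespace Carrousel

section

variable {E F : Type*} [AddCommGroup E] [Module ℝ E] [AddCommGroup F] [Module ℝ F]

theorem SA.exists_pred [FiniteDimensional ℝ F] {p : E → F → Prop} (h : SA {q : E × F | p q.1 q.2}) :
    SA {x | ∃ y, p x y} :=
  h.exists_mem

theorem SA.forall_pred [FiniteDimensional ℝ F] {p : E → F → Prop} (h : SA {q : E × F | p q.1 q.2}) :
    SA {x | ∀ y, p x y} :=
  h.forall_mem

theorem SAFun.indicator [FiniteDimensional ℝ E] [FiniteDimensional ℝ F] {f : E → F} {S : Set E}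
    [DecidablePred (· ∈ S)] (hS : SA S)
    (h : SA {p : E × F | p.1 ∈ S ∧ p.2 = f p.1}) : SAFun fun x => if x ∈ S then f x else 0 := by
  refine SAFun.of_graph (h.or ((hS.compl.preimage_fun SAFun.fst).and
    (SAFun.snd.setOf_eq (SAFun.const 0)))) fun x y => ?_
  by_cases hx : x ∈ S <;> simp [hx]

theorem SAFun.eval_equiv [FiniteDimensional ℝ E] {m : ℕ} {f : E → Param m} (hf : SAFun f)
    (i : Fin m) : SAFun fun x => f x i :=
  SAFun.comp (SAFun.linear (((LinearMap.proj i : (Fin m → ℂ) →ₗ[ℂ] ℂ) ∘ₗ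
    (WithLp.linearEquiv 2 ℂ (Fin m → ℂ)).toLinearMap).restrictScalars ℝ)) hf

theorem SAFun.setOf_norm_lt [FiniteDimensional ℝ E] {m : ℕ} {f : E → Param m} (hf : SAFun f)
    (r : ℝ) : SA {x | ‖f x‖ < r} := by
  by_cases hr : 0 < r
  · have h : SAFun fun x => ∑ i, ‖f x i‖ * ‖f x i‖ :=
      SAFun.sum _ fun i _ => (hf.eval_equiv i).norm.mul_real (hf.eval_equiv i).norm
    refine (h.setOf_lt (SAFun.const (r * r))).congr fun x => ?_
    simp only [Set.mem_ofPred_eq]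
    rw [← abs_of_pos hr, ← abs_norm (f x), ← sq_lt_sq, EuclideanSpace.norm_sq_eq]
    simp only [pow_two, abs_of_pos hr]
  · refine SA.univ.compl.congr fun x => ?_
    simp only [Set.mem_ofPred_eq, Set.compl_univ, Set.mem_empty_iff_false, iff_false, not_lt]
    exact (not_lt.1 hr).trans (norm_nonneg _)

end

/-- The function agrees near the origin with a semi-algebraic function. -/
def GermSA {m : ℕ} (f : Param m → ℂ) : Prop :=
  ∃ g : Param m → ℂ, SAFun g ∧ f =ᶠ[𝓝 0] g

/-- If the frequently many roots among finitely many are close to a function, then one is. -/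
theorem exists_frequently_of_eventually_exists {ι α : Type*} [Finite ι] {F : Filter α} [F.NeBot]
    {f : ι → α → ℝ} (h : ∀ e > 0, ∀ᶠ w in F, ∃ j, f j w ≤ e) :
    ∃ j, ∀ e > 0, ∃ᶠ w in F, f j w ≤ e := by
  by_contra! hcon
  choose e he hF using hcon
  have h1 : ∃ e0 > 0, ∀ j, e0 ≤ e j := by
    have h2 : ∀ᶠ x in 𝓝[>] (0 : ℝ), ∀ j, x ≤ e j := eventually_all.2 fun j =>
      nhdsWithin_le_nhds (eventually_le_nhds (he j))
    obtain ⟨x, hx, hx0⟩ := (h2.and self_mem_nhdsWithin).exists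
    exact ⟨x, hx0, hx⟩
  obtain ⟨e0, he0, hle⟩ := h1
  obtain ⟨w, ⟨j, hj⟩, hw⟩ := ((h e0 he0).and
    (eventually_all.2 hF)).exists
  exact (hw j).not_ge (hj.trans (hle j))

namespace PuiseuxExpansion

variable {m d : ℕ} {P : Param m → ℂ → ℂ[X]} {E : PuiseuxExpansion d P}

/-- The points where the roots are computed by a semi-algebraic equation. -/
theorem exists_saFun_eval (hP : IsEquisingularFamily d P)
    (hsa : ∀ k : ℕ, ∃ U ∈ 𝓝 (0 : Param m × ℂ),
      IsSemialgebraicMapOn (fun q : Param m × ℂ => (P q.1 q.2).coeff k) U) :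
    ∃ f : (Param m × ℂ) × ℂ → ℂ, SAFun f ∧
      ∀ᶠ q in 𝓝 (0 : Param m × ℂ), ∀ y, (P q.1 q.2).IsRoot y ↔ f (q, y) = 0 := by
  classical
  choose U hU hg using hsa
  obtain ⟨r, hr, hrU⟩ := Metric.eventually_nhds_iff_ball.1
    (hP.monic.and (eventually_all.2 fun k : Fin d => eventually_mem_set.2 (hU k)))
  set S : Set (Param m × ℂ) := {q | ‖q.1‖ < r ∧ ‖q.2‖ < r} with hSdef
  have hSr : ∀ q, q ∈ S ↔ q ∈ Metric.ball (0 : Param m × ℂ) r := by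
    intro q
    rw [mem_ball_zero_iff, Prod.norm_def, max_lt_iff]; rfl
  have hS : SA S := (SAFun.fst.setOf_norm_lt r).and
    ((SAFun.snd (E := Param m) (F := ℂ)).norm.setOf_lt (SAFun.const r))
  have hc : ∀ k : Fin d, SAFun fun q : Param m × ℂ => if q ∈ S then (P q.1 q.2).coeff k else 0 := by
    intro k
    refine SAFun.indicator hS ?_
    refine ((hS.preimage_fun (SAFun.fst (E := Param m × ℂ) (F := ℂ))).and (hg k).sa).congr ?_
    intro p
    simp only [Set.mem_ofPred_eq]
    refine and_congr_right fun hp => ?_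
    simp only [(hrU _ ((hSr _).1 hp)).2 k, true_and]
  refine ⟨fun p => p.2 ^ d + ∑ k : Fin d, (if p.1 ∈ S then (P p.1.1 p.1.2).coeff k else 0) *
    p.2 ^ (k : ℕ), (SAFun.snd.pow d).add (SAFun.sum _ fun k _ =>
      (SAFun.comp (hc k) SAFun.fst).mul (SAFun.snd.pow k)), ?_⟩
  filter_upwards [Metric.ball_mem_nhds _ hr] with q hq y
  obtain ⟨hm, hd⟩ := (hrU q hq).1
  simp only [(hSr q).2 hq, if_true]
  rw [Polynomial.IsRoot.def, Polynomial.eval_eq_sum_range, hd, Finset.sum_range_succ]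
  have h1 : (P q.1 q.2).coeff d = 1 := by rw [← hd]; exact hm
  rw [h1, one_mul, add_comm, Finset.sum_range]

/-- A recursive description of a coefficient that mentions only the roots of P and the lower
coefficients. Being close to the value at t = 0 selects the right series among those with the same
lower terms; this works because first differences are visible at t = 0. -/
theorem eq_coeff_of_frequently_root (hP : IsEquisingularFamily d P) (i : Fin d) (L : ℕ) :
    ∃ η > 0, ∀ᶠ t in 𝓝 (0 : Param m), ∀ a : ℂ,
      (a = E.coeff i L t ↔ ‖a - E.coeff i L 0‖ < η ∧ ∀ e > 0, ∀ᶠ w in 𝓝[≠] (0 : ℂ),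
        ∃ y, (P t (w ^ E.N)).IsRoot y ∧ ‖y - E.partialSum i L t w - a * w ^ L‖ ≤ e * ‖w ^ L‖) := by
  have hη : ∃ η > 0, ∀ j, E.coeff j L 0 ≠ E.coeff i L 0 →
      2 * η ≤ ‖E.coeff j L 0 - E.coeff i L 0‖ := by
    have h2 : ∀ᶠ x in 𝓝[>] (0 : ℝ), ∀ j, E.coeff j L 0 ≠ E.coeff i L 0 →
        2 * x ≤ ‖E.coeff j L 0 - E.coeff i L 0‖ := by
      refine eventually_all.2 fun j => ?_
      by_cases h : E.coeff j L 0 = E.coeff i L 0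
      · simp [h]
      · have h3 : Tendsto (fun x : ℝ => 2 * x) (𝓝 0) (𝓝 0) :=
          Continuous.tendsto' (by fun_prop) _ _ (by simp)
        filter_upwards [nhdsWithin_le_nhds (h3.eventually_le_const
          (norm_pos_iff.2 (sub_ne_zero.2 h)))] with x hx _ using hx
    obtain ⟨x, hx, hx0⟩ := (h2.and self_mem_nhdsWithin).exists
    exact ⟨x, hx0, hx⟩
  obtain ⟨η, hη0, hη⟩ := hη
  have hclose : ∀ᶠ t in 𝓝 (0 : Param m), ∀ j, ‖E.coeff j L t - E.coeff j L 0‖ < η := by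
    refine eventually_all.2 fun j => ?_
    have h1 := (E.analyticAt_coeff j L).continuousAt
    filter_upwards [Metric.continuousAt_iff'.1 h1 η hη0] with t ht
    rwa [← dist_eq_norm]
  have hdiff : ∀ᶠ t in 𝓝 (0 : Param m), ∀ j, i ≠ j → ∃ k, (∀ l < k, E.coeff j l t = E.coeff i l t) ∧
      E.coeff i k 0 ≠ E.coeff j k 0 ∧ E.coeff i k t ≠ E.coeff j k t := by
    refine eventually_all.2 fun j => ?_
    by_cases hij : i = j
    · simp [hij]
    obtain ⟨k, h1, h2⟩ := E.exists_coeff_ne hP hij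
    have h3 := (E.analyticAt_coeff i k).continuousAt.ne_iff_eventually_ne
      (E.analyticAt_coeff j k).continuousAt |>.1 h2
    have h4 : ∀ᶠ t in 𝓝 (0 : Param m), ∀ l : Fin k, E.coeff j l t = E.coeff i l t :=
      eventually_all.2 fun l => h1 l l.2
    filter_upwards [h3, h4] with t h5 h6 _
    exact ⟨k, fun l hl => h6 ⟨l, hl⟩, h2, h5⟩
  have hfac := (nhds_prod_eq (x := (0 : Param m)) (y := (0 : ℂ)) ▸ E.factor).curry
  refine ⟨η, hη0, ?_⟩
  filter_upwards [hclose, hdiff, hfac, eventually_all.2 fun j => E.root_isLittleO j L]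
    with t h1 h2 h3 h4 a
  constructor
  · rintro rfl
    refine ⟨h1 i, fun e he => ?_⟩
    filter_upwards [(h4 i).def he, nhdsWithin_le_nhds h3] with w hw hw2
    refine ⟨E.root i t w, hw2 ▸ (isRoot_prod_iff _ _).2 ⟨i, rfl⟩, ?_⟩
    rwa [partialSum, Finset.sum_range_succ, ← sub_sub] at hw
  · rintro ⟨ha, hroot⟩
    obtain ⟨j, hj⟩ := exists_frequently_of_eventually_exists (F := 𝓝[≠] (0 : ℂ))
      (f := fun (j : Fin d) w => ‖E.root j t w - E.partialSum i L t w - a * w ^ L‖ / ‖w ^ L‖)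
      (fun e he => by
        filter_upwards [hroot e he, nhdsWithin_le_nhds h3, self_mem_nhdsWithin] with w hw hw2 hw0
        obtain ⟨y, hy, hy2⟩ := hw
        rw [hw2] at hy
        obtain ⟨j, rfl⟩ := (isRoot_prod_iff _ _).1 hy
        exact ⟨j, (div_le_iff₀ (norm_pos_iff.2 (pow_ne_zero _ hw0))).2 hy2⟩)
    set g : ℂ → ℝ := fun w => ‖E.root j t w - E.partialSum i L t w - a * w ^ L‖ / ‖w ^ L‖
    -- Which root approximates may vary with w, so the j-th one is known to do so only frequently.
    -- Intersecting with the sets where g is small gives a nontrivial filter along which the error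
    -- is o(w ^ L).
    have hne : (𝓝[≠] (0 : ℂ) ⊓ comap g (𝓝 0)).NeBot := by
      rw [inf_neBot_iff_frequently_left]
      intro p hp
      rw [frequently_comap]
      intro hev
      obtain ⟨e, he, hb⟩ := Metric.eventually_nhds_iff_ball.1 hev
      refine (hj (e / 2) (half_pos he)) ?_
      filter_upwards [hp] with w hw hge
      refine hb (g w) ?_ ⟨w, rfl, hw⟩
      have : 0 ≤ g w := by positivity
      rw [Metric.mem_ball, dist_zero_right, Real.norm_of_nonneg this]
      linarith
    have ho : (fun w => ∑ l ∈ Finset.range (L + 1),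
        ((if l < L then E.coeff i l t else a) - E.coeff j l t) * w ^ l)
        =o[𝓝[≠] (0 : ℂ) ⊓ comap g (𝓝 0)] fun w => w ^ L := by
      have o1 : (fun w => E.root j t w - E.partialSum i L t w - a * w ^ L)
          =o[𝓝[≠] (0 : ℂ) ⊓ comap g (𝓝 0)] fun w => w ^ L := by
        refine Asymptotics.IsLittleO.of_bound fun e he => ?_
        have h5 : ∀ᶠ w in comap g (𝓝 0), g w < e :=
          tendsto_comap.eventually (gt_mem_nhds he)
        filter_upwards [inf_le_right (a := 𝓝[≠] (0 : ℂ)) h5,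
          inf_le_left (b := comap g (𝓝 0)) (self_mem_nhdsWithin (a := (0 : ℂ)))] with w hw hw0
        exact (div_le_iff₀ (norm_pos_iff.2 (pow_ne_zero _ hw0))).1 hw.le
      refine (((h4 j).mono inf_le_left).sub o1).congr_left fun w => ?_
      simp only [partialSum, sub_mul, Finset.sum_sub_distrib]
      have h6 : ∑ x ∈ Finset.range (L + 1), (if x < L then E.coeff i x t else a) * w ^ x =
          ∑ x ∈ Finset.range L, E.coeff i x t * w ^ x + a * w ^ L := by
        rw [Finset.sum_range_succ, if_neg (lt_irrefl L)]
        congr 1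
        exact Finset.sum_congr rfl fun x hx => by rw [if_pos (Finset.mem_range.1 hx)]
      rw [h6]
      ring
    have hz := coeff_eq_zero_of_isLittleO inf_le_left ho
    have hlow : ∀ l < L, E.coeff i l t = E.coeff j l t := fun l hl => by
      have := hz l hl.le
      rwa [if_pos hl, sub_eq_zero] at this
    have htop : a = E.coeff j L t := by
      have := hz L le_rfl
      rwa [if_neg (lt_irrefl _), sub_eq_zero] at this
    by_cases hij : i = j
    · rw [htop, hij]
    obtain ⟨k, hk1, hk2, hk3⟩ := h2 j hij
    rcases lt_trichotomy k L with hk | rfl | hk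
    · exact absurd (hlow k hk) hk3
    -- A first difference at L would place a within η of two values that are at least 2 η apart.
    · exfalso
      have h5 := hη j hk2.symm
      have h6 := h1 j
      rw [← htop] at h6
      have h7 : ‖E.coeff j k 0 - E.coeff i k 0‖ ≤
          ‖a - E.coeff i k 0‖ + ‖a - E.coeff j k 0‖ := by
        rw [show E.coeff j k 0 - E.coeff i k 0 =
          (a - E.coeff i k 0) - (a - E.coeff j k 0) by ring]
        exact norm_sub_le _ _
      linarith
    · rw [htop, hk1 L hk]

/-- Strong induction on L: the characterization by approximating roots becomes a first-order formula
once the lower coefficients are replaced by semi-algebraic functions with the same germs. -/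
theorem germSA_coeff (hP : IsEquisingularFamily d P)
    (hsa : ∀ k : ℕ, ∃ U ∈ 𝓝 (0 : Param m × ℂ),
      IsSemialgebraicMapOn (fun q : Param m × ℂ => (P q.1 q.2).coeff k) U)
    (i : Fin d) (L : ℕ) : GermSA (E.coeff i L) := by
  classical
  induction L using Nat.strong_induction_on with
  | _ L ih =>
  obtain ⟨f, hf, hfP⟩ := exists_saFun_eval hP hsa
  choose! g hg hgeq using ih
  obtain ⟨η, hη, hchar⟩ := eq_coeff_of_frequently_root (E := E) hP i L
  have hpow : Tendsto (fun w : ℂ => w ^ E.N) (𝓝 0) (𝓝 0) :=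
    Continuous.tendsto' (by fun_prop) _ _ (by simp [E.N_pos.ne'])
  have hfP' := (nhds_prod_eq (x := (0 : Param m)) (y := (0 : ℂ)) ▸ hfP).curry
  have hgeq' : ∀ᶠ t in 𝓝 (0 : Param m), ∀ l : Fin L, E.coeff i l t = g l t :=
    eventually_all.2 fun l => hgeq l l.2
  obtain ⟨r, hr, hball⟩ := Metric.eventually_nhds_iff_ball.1 ((hchar.and hfP').and hgeq')
  have hkey : SA {p : Param m × ℂ | ‖p.1‖ < r ∧ ‖p.2 - E.coeff i L 0‖ < η ∧ ∀ e : ℝ, 0 < e →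
      ∃ ρ : ℝ, 0 < ρ ∧ ∀ w : ℂ, (‖w‖ < ρ ∧ ¬ w = 0) → ∃ y, f ((p.1, w ^ E.N), y) = 0 ∧
        ‖y - ∑ l : Fin L, g l p.1 * w ^ (l : ℕ) - p.2 * w ^ L‖ ≤ e * ‖w ^ L‖} := by
    refine (SAFun.fst.setOf_norm_lt r).and (((SAFun.snd.sub (SAFun.const _)).norm.setOf_lt
      (SAFun.const η)).and (SA.forall_pred (E := Param m × ℂ) (F := ℝ) ?_))
    refine SA.imp ((SAFun.const 0).setOf_lt SAFun.snd)
      (SA.exists_pred (E := (Param m × ℂ) × ℝ) (F := ℝ) (SA.and ((SAFun.const 0).setOf_lt SAFun.snd)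
        (SA.forall_pred (E := ((Param m × ℂ) × ℝ) × ℝ) (F := ℂ) (SA.imp (SA.and
          (SAFun.snd.norm.setOf_lt (SAFun.comp SAFun.snd SAFun.fst))
          (SAFun.snd.setOf_eq (SAFun.const 0)).compl)
          (SA.exists_pred (E := (((Param m × ℂ) × ℝ) × ℝ) × ℂ) (F := ℂ) ?_)))))
    have vt : SAFun fun p : ((((Param m × ℂ) × ℝ) × ℝ) × ℂ) × ℂ => p.1.1.1.1.1 :=
      SAFun.linear (LinearMap.fst ℝ (Param m) ℂ ∘ₗ LinearMap.fst ℝ _ ℝ ∘ₗ LinearMap.fst ℝ _ ℝ ∘ₗ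
        LinearMap.fst ℝ _ ℂ ∘ₗ LinearMap.fst ℝ _ ℂ)
    have va : SAFun fun p : ((((Param m × ℂ) × ℝ) × ℝ) × ℂ) × ℂ => p.1.1.1.1.2 :=
      SAFun.linear (LinearMap.snd ℝ (Param m) ℂ ∘ₗ LinearMap.fst ℝ _ ℝ ∘ₗ LinearMap.fst ℝ _ ℝ ∘ₗ
        LinearMap.fst ℝ _ ℂ ∘ₗ LinearMap.fst ℝ _ ℂ)
    have ve : SAFun fun p : ((((Param m × ℂ) × ℝ) × ℝ) × ℂ) × ℂ => p.1.1.1.2 :=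
      SAFun.linear (LinearMap.snd ℝ (Param m × ℂ) ℝ ∘ₗ LinearMap.fst ℝ _ ℝ ∘ₗ
        LinearMap.fst ℝ _ ℂ ∘ₗ LinearMap.fst ℝ _ ℂ)
    have vw : SAFun fun p : ((((Param m × ℂ) × ℝ) × ℝ) × ℂ) × ℂ => p.1.2 :=
      SAFun.linear (LinearMap.snd ℝ (((Param m × ℂ) × ℝ) × ℝ) ℂ ∘ₗ LinearMap.fst ℝ _ ℂ)
    have vy : SAFun fun p : ((((Param m × ℂ) × ℝ) × ℝ) × ℂ) × ℂ => p.2 := SAFun.snd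
    refine SA.and ((SAFun.comp hf ((vt.prodMk (vw.pow E.N)).prodMk vy)).setOf_eq (SAFun.const 0))
      (SAFun.setOf_le (SAFun.norm ((vy.sub (SAFun.sum _ fun (l : Fin L) _ =>
        (SAFun.comp (hg l l.2) vt).mul (vw.pow l))).sub (va.mul (vw.pow L))))
        (ve.mul_real (vw.pow L).norm))
  have hS : SA {t : Param m | ‖t‖ < r} := (SAFun.linear LinearMap.id).setOf_norm_lt r
  refine ⟨fun t => if t ∈ {t : Param m | ‖t‖ < r} then E.coeff i L t else 0,
    SAFun.indicator hS (hkey.congr fun p => ?_), ?_⟩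
  · simp only [Set.mem_ofPred_eq]
    refine and_congr_right fun hp => ?_
    obtain ⟨⟨h1, h2⟩, h3⟩ := hball p.1 (mem_ball_zero_iff.2 hp)
    rw [h1 p.2]
    refine and_congr_right fun _ => forall₂_congr fun e he => ?_
    have hsum : ∀ w, ∑ l : Fin L, g l p.1 * w ^ (l : ℕ) = E.partialSum i L p.1 w := by
      intro w
      rw [partialSum, Finset.sum_range]
      exact Finset.sum_congr rfl fun l _ => by rw [h3 l]
    have hroot : ∀ᶠ w in 𝓝[≠] (0 : ℂ), ∀ y, (P p.1 (w ^ E.N)).IsRoot y ↔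
        f ((p.1, w ^ E.N), y) = 0 := nhdsWithin_le_nhds (hpow.eventually h2)
    simp only [hsum]
    have h4 : (∀ᶠ w in 𝓝[≠] (0 : ℂ), ∃ y, (P p.1 (w ^ E.N)).IsRoot y ∧
        ‖y - E.partialSum i L p.1 w - p.2 * w ^ L‖ ≤ e * ‖w ^ L‖) ↔
        ∀ᶠ w in 𝓝[≠] (0 : ℂ), ∃ y, f ((p.1, w ^ E.N), y) = 0 ∧
        ‖y - E.partialSum i L p.1 w - p.2 * w ^ L‖ ≤ e * ‖w ^ L‖ := by
      refine eventually_congr ?_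
      filter_upwards [hroot] with w hw
      simp only [hw]
    rw [h4, eventually_nhdsWithin_iff, Metric.eventually_nhds_iff]
    refine exists_congr fun ρ => and_congr_right fun _ => ?_
    simp only [dist_zero_right, Set.mem_compl_iff, Set.mem_singleton_iff, and_imp]
  · filter_upwards [Metric.ball_mem_nhds (0 : Param m) hr] with t ht
    rw [if_pos]
    exact mem_ball_zero_iff.1 ht

end PuiseuxExpansion

end Carrousel

/-! ### Admissible constants and uniform margins -/

namespace Carrousel

variable {m d : ℕ} {P : Param m → ℂ → ℂ[X]} {E : PuiseuxExpansion d P}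

theorem Truncation.IsNode.lt {M : Truncation E} {i : Fin d} {k L : ℕ} (h : M.IsNode i k)
    (hL : ∀ i, M.last i < L) : k < L := h.2.1.trans_lt (hL i)

theorem exists_admissible (hP : IsEquisingularFamily d P) (M : Truncation E) :
    ∃ c : Constants d, c.Admissible M := by
  classical
  obtain ⟨L, hL, hLN⟩ : ∃ L, (∀ i, M.last i < L) ∧ E.N < L := by
    refine ⟨(Finset.univ.sup M.last) + E.N + 1, fun i => ?_, by omega⟩
    have := Finset.le_sup (f := M.last) (Finset.mem_univ i)
    omega
  have hcont : ∀ i l, ContinuousAt (E.coeff i l) 0 := fun i l =>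
    (E.analyticAt_coeff i l).continuousAt
  have h2 : Tendsto (fun x : ℝ => 2 * x) (𝓝 0) (𝓝 0) :=
    Continuous.tendsto' (by fun_prop) _ _ (by simp)
  have he : ∀ᶠ e in 𝓝[>] (0 : ℝ), ∀ (i j : Fin d) (k : Fin L),
      (E.coeff i k 0 ≠ E.coeff j k 0 → 2 * e < ‖E.coeff i k 0 - E.coeff j k 0‖) ∧
      (E.coeff j k 0 ≠ 0 → 2 * e < ‖E.coeff j k 0‖) := by
    refine eventually_all.2 fun i => eventually_all.2 fun j => eventually_all.2 fun k => ?_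
    refine nhdsWithin_le_nhds (Eventually.and ?_ ?_)
    · by_cases h : E.coeff i k 0 = E.coeff j k 0
      · simp [h]
      · filter_upwards [h2.eventually_lt_const (norm_pos_iff.2 (sub_ne_zero.2 h))] with x hx _
          using hx
    · by_cases h : E.coeff j k 0 = 0
      · simp [h]
      · filter_upwards [h2.eventually_lt_const (norm_pos_iff.2 h)] with x hx _ using hx
  obtain ⟨e, he, he0⟩ := (he.and self_mem_nhdsWithin).exists
  obtain ⟨B, hB⟩ : ∃ B : ℝ, ∀ (j : Fin d) (k : Fin L), ‖E.coeff j k 0‖ + e < B := by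
    have : ∀ᶠ B : ℝ in atTop, ∀ (j : Fin d) (k : Fin L), ‖E.coeff j k 0‖ + e < B :=
      eventually_all.2 fun j => eventually_all.2 fun k => eventually_gt_atTop _
    exact this.exists
  have hsep : ∀ᶠ t in 𝓝 (0 : Param m), ∀ (i j : Fin d) (k : Fin L),
      E.coeff i k 0 ≠ E.coeff j k 0 → 2 * e < ‖E.coeff i k t - E.coeff j k t‖ := by
    refine eventually_all.2 fun i => eventually_all.2 fun j => eventually_all.2 fun k => ?_
    by_cases h : E.coeff i k 0 = E.coeff j k 0
    · simp [h]
    · filter_upwards [((hcont i k).sub (hcont j k)).norm.eventually_const_lt ((he i j k).1 h)]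
        with t ht _ using ht
  have hne : ∀ᶠ t in 𝓝 (0 : Param m), ∀ (j : Fin d) (k : Fin L),
      E.coeff j k 0 ≠ 0 → 2 * e < ‖E.coeff j k t‖ := by
    refine eventually_all.2 fun j => eventually_all.2 fun k => ?_
    by_cases h : E.coeff j k 0 = 0
    · simp [h]
    · filter_upwards [(hcont j k).norm.eventually_const_lt ((he j j k).2 h)] with t ht _ using ht
  have hle : ∀ᶠ t in 𝓝 (0 : Param m), ∀ (j : Fin d) (k : Fin L), ‖E.coeff j k t‖ + e < B := by
    refine eventually_all.2 fun j => eventually_all.2 fun k => ?_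
    exact ((hcont j k).norm.add continuousAt_const).eventually_lt_const (hB j k)
  have hsame : ∀ᶠ t in 𝓝 (0 : Param m), ∀ (i j : Fin d) (k : Fin L), E.Agree i j (k + 1) →
      E.coeff j k t = E.coeff i k t := by
    refine eventually_all.2 fun i => eventually_all.2 fun j => eventually_all.2 fun k => ?_
    by_cases h : E.Agree i j (k + 1)
    · filter_upwards [h k (Nat.lt_succ_self _)] with t ht _ using ht
    · simp [h]
  -- One small number for η, α and γ and one large number for R and β suffice; being constant, they
  -- do not depend on the determination.
  refine ⟨⟨e, B, fun _ _ => e, fun _ _ => B, fun _ _ => e⟩, he0, ?_, ?_, fun _ _ _ => he0,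
    fun _ _ _ => he0, fun _ _ _ _ _ _ => ⟨rfl, rfl, rfl⟩, ?_, ?_, ?_⟩
  · filter_upwards [hsep, hsame] with t h1 h2 i j hij
    refine h1 i j ⟨E.N, hLN⟩ fun h0 => ?_
    exact hij (h2 i j ⟨E.N, hLN⟩
      ((PuiseuxExpansion.agree_N hP i j).succ_of_coeff_eq hP h0)).symm
  · filter_upwards [hle] with t h i using h i ⟨E.N, hLN⟩
  · filter_upwards [hne] with t h i k j hik hcore hj
    have := h j ⟨k, hik.lt hL⟩ (hcore j hj)
    simp only at this ⊢
    linarith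
  · filter_upwards [hle] with t h i k j hik _ using h j ⟨k, hik.lt hL⟩
  · filter_upwards [hsep, hsame] with t h1 h2 i k j j' hik hj hj' hne
    refine h1 j j' ⟨k, hik.lt hL⟩ fun h0 => ?_
    exact hne (h2 j j' ⟨k, hik.lt hL⟩ ((hj.2.symm.trans hj'.2).succ_of_coeff_eq hP h0)).symm

/-- The coefficients `b i l` behave like those of the series at a parameter value near `0`, with a
margin `τ` in all strict inequalities. -/
structure Fit (M : Truncation E) (c : Constants d) (τ C : ℝ) (L : ℕ) (b : Fin d → ℕ → ℂ) :
    Prop where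
  low : ∀ i l, l < E.N → b i l = 0
  agree : ∀ i j l, l < L → E.Agree i j (l + 1) → b j l = b i l
  differ : ∀ i j l, l < L → E.Agree i j l → ¬ E.Agree i j (l + 1) → τ ≤ ‖b i l - b j l‖
  zero : ∀ i l, l < L → (∀ᶠ t in 𝓝 (0 : Param m), E.coeff i l t = 0) → b i l = 0
  bound : ∀ i l, l < L → ‖b i l‖ ≤ C
  conj : ∀ (i j : Fin d) (ζ : ℂ), ζ ^ E.N = 1 →
    (∀ᶠ q in 𝓝 (0 : Param m × ℂ), E.root j q.1 q.2 = E.root i q.1 (ζ * q.2)) →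
    ∀ l < L, b j l = ζ ^ l * b i l
  cones : ∀ i j, ¬ E.Agree i j (E.N + 1) → 2 * c.η + 2 * τ ≤ ‖b i E.N - b j E.N‖
  cones_le : ∀ i, ‖b i E.N‖ + c.η + 2 * τ ≤ c.R
  core : ∀ i k j, M.IsNode i k → M.HasCore i k → M.Fits i k j → c.α i k + c.γ i k + 2 * τ ≤ ‖b j k‖
  beta : ∀ i k j, M.IsNode i k → M.Fits i k j → ‖b j k‖ + c.γ i k + 2 * τ ≤ c.β i k
  disks : ∀ i k j j', M.IsNode i k → M.Fits i k j → M.Fits i k j' → ¬ E.Agree j j' (k + 1) →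
    2 * c.γ i k + 2 * τ ≤ ‖b j k - b j' k‖

/-- Bounds for the constants. -/
structure Bounds (M : Truncation E) (c : Constants d) (τ C : ℝ) (L : ℕ) : Prop where
  last_lt : ∀ i, M.last i < L
  N_lt : E.N < L
  τ_pos : 0 < τ
  η_ge : 2 * τ ≤ c.η
  α_ge : ∀ i k, M.IsNode i k → 2 * τ ≤ c.α i k
  γ_ge : ∀ i k, M.IsNode i k → 2 * τ ≤ c.γ i k
  η_le : c.η ≤ C
  α_le : ∀ i k, M.IsNode i k → c.α i k ≤ C
  β_le : ∀ i k, M.IsNode i k → c.β i k ≤ C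
  γ_le : ∀ i k, M.IsNode i k → c.γ i k ≤ C

/-- The order of the quantifiers is the point: τ is fixed before the neighborhood of parameters, so
finitely many such conditions can share one τ. -/
theorem eventually_slack {α : Type*} [TopologicalSpace α] {a : α} {f : α → ℝ}
    (hf : ContinuousAt f a) (h : 0 < f a) :
    ∀ᶠ τ in 𝓝[>] (0 : ℝ), ∀ᶠ t in 𝓝 a, 2 * τ ≤ f t := by
  have h2 : Tendsto (fun x : ℝ => 2 * x) (𝓝 0) (𝓝 0) :=
    Continuous.tendsto' (by fun_prop) _ _ (by simp)
  filter_upwards [nhdsWithin_le_nhds (h2.eventually_lt_const h)] with τ hτ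
  filter_upwards [hf.eventually_const_lt hτ] with t ht using ht.le

theorem eventually_slack_const {x : ℝ} (h : 0 < x) : ∀ᶠ τ in 𝓝[>] (0 : ℝ), 2 * τ ≤ x := by
  have h2 : Tendsto (fun x : ℝ => 2 * x) (𝓝 0) (𝓝 0) :=
    Continuous.tendsto' (by fun_prop) _ _ (by simp)
  exact nhdsWithin_le_nhds ((h2.eventually_lt_const h).mono fun _ => le_of_lt)

theorem eventually_eventually_of_imp {p : Prop} {q : ℝ → Param m → Prop}
    (h : p → ∀ᶠ τ in 𝓝[>] (0 : ℝ), ∀ᶠ t in 𝓝 (0 : Param m), q τ t) :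
    ∀ᶠ τ in 𝓝[>] (0 : ℝ), ∀ᶠ t in 𝓝 (0 : Param m), p → q τ t := by
  by_cases hp : p
  · simpa [hp] using h hp
  · simp [hp]

theorem eventually_eventually_all {ι : Type*} [Finite ι] {q : ι → ℝ → Param m → Prop}
    (h : ∀ i, ∀ᶠ τ in 𝓝[>] (0 : ℝ), ∀ᶠ t in 𝓝 (0 : Param m), q i τ t) :
    ∀ᶠ τ in 𝓝[>] (0 : ℝ), ∀ᶠ t in 𝓝 (0 : Param m), ∀ i, q i τ t := by
  filter_upwards [eventually_all.2 h] with τ hτ using eventually_all.2 hτ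

/-- Only finitely many coefficients enter. The strict inequalities of `Constants.Admissible` at t =
0 leave room for a margin, which continuity preserves for small t. Distinctness of coefficients is
restated as failure of `Agree`, which does not refer to t. -/
theorem exists_fit (hP : IsEquisingularFamily d P) {M : Truncation E} {c : Constants d}
    (hc : c.Admissible M) : ∃ (τ C : ℝ) (L : ℕ), Bounds M c τ C L ∧
      ∀ᶠ t in 𝓝 (0 : Param m), Fit M c τ C L fun i l => E.coeff i l t := by
  classical
  obtain ⟨L, hL, hLN⟩ : ∃ L, (∀ i, M.last i < L) ∧ E.N < L := by
    refine ⟨(Finset.univ.sup M.last) + E.N + 1, fun i => ?_, by omega⟩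
    have := Finset.le_sup (f := M.last) (Finset.mem_univ i)
    omega
  have hcont : ∀ i l, ContinuousAt (E.coeff i l) 0 := fun i l =>
    (E.analyticAt_coeff i l).continuousAt
  have hdiff : ∀ᶠ τ in 𝓝[>] (0 : ℝ), ∀ᶠ t in 𝓝 (0 : Param m), ∀ (i j : Fin d) (l : Fin L),
      E.Agree i j l ∧ ¬ E.Agree i j (l + 1) → 2 * τ ≤ ‖E.coeff i l t - E.coeff j l t‖ := by
    refine eventually_eventually_all fun i => eventually_eventually_all fun j =>
      eventually_eventually_all fun l => eventually_eventually_of_imp fun h => ?_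
    refine eventually_slack ((hcont i l).sub (hcont j l)).norm (norm_pos_iff.2 (sub_ne_zero.2 ?_))
    exact fun h0 => h.2 (h.1.succ_of_coeff_eq hP h0)
  have hcones : ∀ᶠ τ in 𝓝[>] (0 : ℝ), ∀ᶠ t in 𝓝 (0 : Param m), ∀ (i j : Fin d),
      ¬ E.Agree i j (E.N + 1) → 2 * τ ≤ ‖E.coeff i E.N t - E.coeff j E.N t‖ - 2 * c.η := by
    refine eventually_eventually_all fun i => eventually_eventually_all fun j =>
      eventually_eventually_of_imp fun h => ?_
    refine eventually_slack (((hcont i _).sub (hcont j _)).norm.sub continuousAt_const)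
      (sub_pos.2 (hc.cones_disjoint.self_of_nhds i j fun h0 => h ?_))
    exact (PuiseuxExpansion.agree_N hP i j).succ_of_coeff_eq hP h0
  have hconesR : ∀ᶠ τ in 𝓝[>] (0 : ℝ), ∀ᶠ t in 𝓝 (0 : Param m), ∀ (i : Fin d),
      2 * τ ≤ c.R - (‖E.coeff i E.N t‖ + c.η) := by
    refine eventually_eventually_all fun i => ?_
    exact eventually_slack (continuousAt_const.sub ((hcont i _).norm.add continuousAt_const))
      (sub_pos.2 (hc.cones_lt.self_of_nhds i))
  have hcore : ∀ᶠ τ in 𝓝[>] (0 : ℝ), ∀ᶠ t in 𝓝 (0 : Param m), ∀ (i : Fin d) (k : Fin L) (j : Fin d),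
      M.IsNode i k ∧ M.HasCore i k ∧ M.Fits i k j →
        2 * τ ≤ ‖E.coeff j k t‖ - c.γ i k - c.α i k := by
    refine eventually_eventually_all fun i => eventually_eventually_all fun k =>
      eventually_eventually_all fun j => eventually_eventually_of_imp fun h => ?_
    exact eventually_slack (((hcont j _).norm.sub continuousAt_const).sub continuousAt_const)
      (sub_pos.2 (hc.α_lt.self_of_nhds i k j h.1 h.2.1 h.2.2))
  have hbeta : ∀ᶠ τ in 𝓝[>] (0 : ℝ), ∀ᶠ t in 𝓝 (0 : Param m), ∀ (i : Fin d) (k : Fin L) (j : Fin d),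
      M.IsNode i k ∧ M.Fits i k j → 2 * τ ≤ c.β i k - (‖E.coeff j k t‖ + c.γ i k) := by
    refine eventually_eventually_all fun i => eventually_eventually_all fun k =>
      eventually_eventually_all fun j => eventually_eventually_of_imp fun h => ?_
    exact eventually_slack (continuousAt_const.sub ((hcont j _).norm.add continuousAt_const))
      (sub_pos.2 (hc.lt_β.self_of_nhds i k j h.1 h.2))
  have hdisks : ∀ᶠ τ in 𝓝[>] (0 : ℝ), ∀ᶠ t in 𝓝 (0 : Param m), ∀ (i : Fin d) (k : Fin L)
      (j j' : Fin d), M.IsNode i k ∧ M.Fits i k j ∧ M.Fits i k j' ∧ ¬ E.Agree j j' (k + 1) →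
        2 * τ ≤ ‖E.coeff j k t - E.coeff j' k t‖ - 2 * c.γ i k := by
    refine eventually_eventually_all fun i => eventually_eventually_all fun k =>
      eventually_eventually_all fun j => eventually_eventually_all fun j' =>
      eventually_eventually_of_imp fun h => ?_
    refine eventually_slack (((hcont j _).sub (hcont j' _)).norm.sub continuousAt_const)
      (sub_pos.2 (hc.disks_disjoint.self_of_nhds i k j j' h.1 h.2.1 h.2.2.1 fun h0 => h.2.2.2 ?_))
    exact (h.2.1.2.symm.trans h.2.2.1.2).succ_of_coeff_eq hP h0
  have hconst : ∀ᶠ τ in 𝓝[>] (0 : ℝ), 2 * τ ≤ c.η ∧ ∀ (i : Fin d) (k : Fin L), M.IsNode i k →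
      2 * τ ≤ c.α i k ∧ 2 * τ ≤ c.γ i k := by
    refine (eventually_slack_const hc.η_pos).and (eventually_all.2 fun i => eventually_all.2 fun k => ?_)
    by_cases h : M.IsNode i k
    · simpa [h] using (eventually_slack_const (hc.α_pos i k h)).and
        (eventually_slack_const (hc.γ_pos i k h))
    · simp [h]
  obtain ⟨τ, ⟨h1, h2, h3, h4, h5, h6, h7⟩, hτ⟩ := ((hdiff.and (hcones.and (hconesR.and (hcore.and
    (hbeta.and (hdisks.and hconst)))))).and self_mem_nhdsWithin).exists
  have hτ : 0 < τ := hτ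
  obtain ⟨C, hC⟩ : ∃ C : ℝ, c.η ≤ C ∧ ∀ (j : Fin d) (k : Fin L),
      ‖E.coeff j k 0‖ < C ∧ c.α j k ≤ C ∧ c.β j k ≤ C ∧ c.γ j k ≤ C := by
    have : ∀ᶠ C : ℝ in atTop, c.η ≤ C ∧ ∀ (j : Fin d) (k : Fin L),
        ‖E.coeff j k 0‖ < C ∧ c.α j k ≤ C ∧ c.β j k ≤ C ∧ c.γ j k ≤ C :=
      (eventually_ge_atTop _).and (eventually_all.2 fun j => eventually_all.2 fun k =>
        (eventually_gt_atTop _).and ((eventually_ge_atTop _).and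
          ((eventually_ge_atTop _).and (eventually_ge_atTop _))))
    exact this.exists
  have hbound : ∀ᶠ t in 𝓝 (0 : Param m), ∀ (j : Fin d) (k : Fin L), ‖E.coeff j k t‖ < C :=
    eventually_all.2 fun j => eventually_all.2 fun k =>
      (hcont j k).norm.eventually_lt_const (hC.2 j k).1
  have hlow : ∀ᶠ t in 𝓝 (0 : Param m), ∀ (j : Fin d) (k : Fin E.N), E.coeff j k t = 0 :=
    eventually_all.2 fun j => eventually_all.2 fun k =>
      PuiseuxExpansion.coeff_eventually_zero_of_lt hP j k.2
  have hagree : ∀ᶠ t in 𝓝 (0 : Param m), ∀ (i j : Fin d) (k : Fin L), E.Agree i j (k + 1) →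
      E.coeff j k t = E.coeff i k t := by
    refine eventually_all.2 fun i => eventually_all.2 fun j => eventually_all.2 fun k => ?_
    by_cases h : E.Agree i j (k + 1)
    · filter_upwards [h k (Nat.lt_succ_self _)] with t ht _ using ht
    · simp [h]
  have hzero : ∀ᶠ t in 𝓝 (0 : Param m), ∀ (i : Fin d) (k : Fin L),
      (∀ᶠ t in 𝓝 (0 : Param m), E.coeff i k t = 0) → E.coeff i k t = 0 := by
    refine eventually_all.2 fun i => eventually_all.2 fun k => ?_
    by_cases h : ∀ᶠ t in 𝓝 (0 : Param m), E.coeff i k t = 0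
    · filter_upwards [h] with t ht _ using ht
    · simp [h]
  -- The roots of unity are taken from a finite set so that one neighborhood serves all of them.
  have hconj : ∀ᶠ t in 𝓝 (0 : Param m), ∀ (i j : Fin d) (ζ : (Polynomial.nthRootsFinset E.N (1 : ℂ)))
      (l : Fin L), (∀ᶠ q in 𝓝 (0 : Param m × ℂ), E.root j q.1 q.2 = E.root i q.1 (ζ * q.2)) →
      E.coeff j l t = (ζ : ℂ) ^ (l : ℕ) * E.coeff i l t := by
    refine eventually_all.2 fun i => eventually_all.2 fun j => eventually_all.2 fun ζ =>
      eventually_all.2 fun l => ?_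
    by_cases h : ∀ᶠ q in 𝓝 (0 : Param m × ℂ), E.root j q.1 q.2 = E.root i q.1 (ζ * q.2)
    · filter_upwards [PuiseuxExpansion.coeff_conj
        ((Polynomial.mem_nthRootsFinset E.N_pos _).1 ζ.2) h l] with t ht _ using ht
    · simp [h]
  refine ⟨τ, C, L, ⟨hL, hLN, hτ, h7.1, fun i k h => (h7.2 i ⟨k, h.lt hL⟩ h).1,
    fun i k h => (h7.2 i ⟨k, h.lt hL⟩ h).2, hC.1, fun i k h => (hC.2 i ⟨k, h.lt hL⟩).2.1,
    fun i k h => (hC.2 i ⟨k, h.lt hL⟩).2.2.1, fun i k h => (hC.2 i ⟨k, h.lt hL⟩).2.2.2⟩, ?_⟩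
  filter_upwards [h1, h2, h3, h4, h5, h6, hbound, hlow, hagree, hzero, hconj]
    with t h1 h2 h3 h4 h5 h6 hbound hlow hagree hzero hconj
  exact
    { low := fun i l hl => hlow i ⟨l, hl⟩
      agree := fun i j l hl => hagree i j ⟨l, hl⟩
      differ := fun i j l hl h h' => by have := h1 i j ⟨l, hl⟩ ⟨h, h'⟩; simp only at this; linarith
      zero := fun i l hl => hzero i ⟨l, hl⟩
      bound := fun i l hl => (hbound i ⟨l, hl⟩).le
      conj := fun i j ζ hζ h l hl =>
        hconj i j ⟨ζ, (Polynomial.mem_nthRootsFinset E.N_pos _).2 hζ⟩ ⟨l, hl⟩ h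
      cones := fun i j h => by linarith [h2 i j h]
      cones_le := fun i => by linarith [h3 i]
      core := fun i k j h h' h'' => by
        have := h4 i ⟨k, h.lt hL⟩ j ⟨h, h', h''⟩
        simp only at this
        linarith
      beta := fun i k j h h' => by
        have := h5 i ⟨k, h.lt hL⟩ j ⟨h, h'⟩
        simp only at this
        linarith
      disks := fun i k j j' h h' h'' h3 => by
        have := h6 i ⟨k, h.lt hL⟩ j j' ⟨h, h', h'', h3⟩
        simp only at this
        linarith }

end Carrousel

namespace Carrousel

/-! ### A cut-off function -/

/-- The function of `u` that is `z` on the disk of radius `g |z|` and vanishes outside the disk of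
radius `(g + τ) |z|`. -/
noncomputable def bump (g τ : ℝ) (u z : ℂ) : ℂ :=
  z * ((max 0 (min 1 ((g + τ - ‖u‖ / ‖z‖) / τ)) : ℝ) : ℂ)

section bump

variable {g τ : ℝ} {u z u' z' v : ℂ}

theorem bump_zero_right : bump g τ u 0 = 0 := by simp [bump]

theorem bump_of_le (hτ : 0 < τ) (h : ‖u‖ ≤ g * ‖z‖) : bump g τ u z = z := by
  rcases eq_or_ne z 0 with rfl | hz
  · exact bump_zero_right
  have h1 : ‖u‖ / ‖z‖ ≤ g := (div_le_iff₀ (norm_pos_iff.2 hz)).2 h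
  have h2 : 1 ≤ (g + τ - ‖u‖ / ‖z‖) / τ := by rw [le_div_iff₀ hτ]; linarith
  simp [bump, min_eq_left h2]

theorem bump_eq_zero (hτ : 0 < τ) (h : (g + τ) * ‖z‖ ≤ ‖u‖) : bump g τ u z = 0 := by
  rcases eq_or_ne z 0 with rfl | hz
  · exact bump_zero_right
  have h1 : g + τ ≤ ‖u‖ / ‖z‖ := (le_div_iff₀ (norm_pos_iff.2 hz)).2 h
  have h2 : (g + τ - ‖u‖ / ‖z‖) / τ ≤ 0 := div_nonpos_of_nonpos_of_nonneg (by linarith) hτ.le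
  rw [bump, max_eq_left ((min_le_right _ _).trans h2)]
  simp

/-- Homogeneity: on a curve y = f + a w ^ k the contribution of a disk at the same exponent is w ^ k
times a function of a alone. This is why leaves are mapped to leaves. -/
theorem bump_mul_left : bump g τ (v * z) z = z * bump g τ v 1 := by
  rcases eq_or_ne z 0 with rfl | hz
  · simp [bump_zero_right]
  have h1 : ‖v * z‖ / ‖z‖ = ‖v‖ := by
    rw [norm_mul, mul_div_cancel_right₀ _ (norm_ne_zero_iff.2 hz)]
  rw [bump, h1, bump, norm_one, div_one, one_mul]

theorem bump_mul_mul {s : ℂ} (hs : ‖s‖ = 1) : bump g τ u (s * z) = s * bump g τ u z := by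
  simp only [bump, norm_mul, hs, one_mul, mul_assoc]

theorem norm_bump_le : ‖bump g τ u z‖ ≤ ‖z‖ := by
  have h1 : ‖((max 0 (min 1 ((g + τ - ‖u‖ / ‖z‖) / τ)) : ℝ) : ℂ)‖ ≤ 1 := by
    rw [Complex.norm_real, Real.norm_of_nonneg (le_max_left _ _)]
    exact max_le zero_le_one (min_le_left _ _)
  rw [bump, norm_mul]
  exact mul_le_of_le_one_right (norm_nonneg _) h1

theorem bump_eq_div_mul (hτ : 0 < τ) (hz : z ≠ 0) : bump g τ u z =
    z / ‖z‖ * ((max 0 (min ‖z‖ (((g + τ) * ‖z‖ - ‖u‖) / τ)) : ℝ) : ℂ) := by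
  have hz' := norm_pos_iff.2 hz
  have h1 : max 0 (min ‖z‖ (((g + τ) * ‖z‖ - ‖u‖) / τ)) =
      ‖z‖ * max 0 (min 1 ((g + τ - ‖u‖ / ‖z‖) / τ)) := by
    rw [mul_max_of_nonneg _ _ hz'.le, mul_min_of_nonneg _ _ hz'.le, mul_zero, mul_one]
    congr 2
    field_simp
  rw [h1, bump]
  push_cast
  have : (‖z‖ : ℂ) ≠ 0 := by exact_mod_cast hz'.ne'
  field_simp

/-- Although u / z is not Lipschitz, the bump is: it is z / |z| times a Lipschitz real factor of
size at most |z|, which compensates the variation of the direction z / |z|. -/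
theorem norm_bump_sub_le (hτ : 0 < τ) (hg : 0 ≤ g) : ‖bump g τ u z - bump g τ u' z'‖ ≤
    ‖u - u'‖ / τ + ((g + τ) / τ + 2) * ‖z - z'‖ := by
  have h0 : 0 ≤ ‖u - u'‖ / τ := by positivity
  have h1 : 0 ≤ (g + τ) / τ := by positivity
  have h2 : 0 ≤ (g + τ) / τ * ‖z - z'‖ := by positivity
  rcases eq_or_ne z 0 with rfl | hz
  · rw [bump_zero_right, zero_sub, zero_sub, norm_neg, norm_neg] at *
    linarith [norm_bump_le (g := g) (τ := τ) (u := u') (z := z'), norm_nonneg z']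
  rcases eq_or_ne z' 0 with rfl | hz'
  · rw [bump_zero_right, sub_zero, sub_zero] at *
    linarith [norm_bump_le (g := g) (τ := τ) (u := u) (z := z), norm_nonneg z]
  have hzp := norm_pos_iff.2 hz
  have hzp' := norm_pos_iff.2 hz'
  rw [bump_eq_div_mul hτ hz, bump_eq_div_mul hτ hz']
  set h := max 0 (min ‖z‖ (((g + τ) * ‖z‖ - ‖u‖) / τ)) with hh
  set h' := max 0 (min ‖z'‖ (((g + τ) * ‖z'‖ - ‖u'‖) / τ)) with hh'
  have hd : |‖z‖ - ‖z'‖| ≤ ‖z - z'‖ := abs_norm_sub_norm_le z z'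
  have hdu : |‖u‖ - ‖u'‖| ≤ ‖u - u'‖ := abs_norm_sub_norm_le u u'
  have h3 : |h - h'| ≤ ‖u - u'‖ / τ + (g + τ) / τ * ‖z - z'‖ := by
    rw [hh, hh', max_comm 0, max_comm 0]
    refine (abs_max_sub_max_le_abs _ _ _).trans ((abs_min_sub_min_le_max _ _ _ _).trans
      (max_le ?_ ?_))
    · have : 1 * ‖z - z'‖ ≤ (g + τ) / τ * ‖z - z'‖ := by
        refine mul_le_mul_of_nonneg_right ?_ (norm_nonneg _)
        rw [le_div_iff₀ hτ]; linarith
      linarith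
    · rw [← sub_div, abs_div, abs_of_pos hτ, div_mul_eq_mul_div, ← add_div]
      refine div_le_div_of_nonneg_right ?_ hτ.le
      rw [show (g + τ) * ‖z‖ - ‖u‖ - ((g + τ) * ‖z'‖ - ‖u'‖) =
        (g + τ) * (‖z‖ - ‖z'‖) - (‖u‖ - ‖u'‖) by ring]
      refine (abs_sub _ _).trans ?_
      rw [abs_mul, abs_of_pos (by linarith : 0 < g + τ)]
      have := mul_le_mul_of_nonneg_left hd (by linarith : 0 ≤ g + τ)
      linarith
  have h4 : ‖(z / ‖z‖ : ℂ)‖ = 1 := by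
    rw [norm_div, Complex.norm_real, norm_norm, div_self hzp.ne']
  have h5 : ‖(h' : ℂ)‖ ≤ ‖z'‖ := by
    rw [Complex.norm_real, Real.norm_of_nonneg (le_max_left _ _)]
    exact max_le hzp'.le (min_le_left _ _)
  have h6 : ‖z'‖ * ‖(z / ‖z‖ - z' / ‖z'‖ : ℂ)‖ ≤ 2 * ‖z - z'‖ := by
    have e1 : ‖z'‖ * ‖(z / ‖z‖ - z' / ‖z'‖ : ℂ)‖ =
        ‖(z / ‖z‖ * ((‖z'‖ - ‖z‖ : ℝ) : ℂ) + (z - z') : ℂ)‖ := by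
      have e2 : ‖z'‖ * ‖(z / ‖z‖ - z' / ‖z'‖ : ℂ)‖ =
          ‖((‖z'‖ : ℝ) : ℂ) * (z / ‖z‖ - z' / ‖z'‖ : ℂ)‖ := by
        rw [norm_mul, Complex.norm_real, norm_norm]
      rw [e2]
      congr 1
      have n1 : (‖z‖ : ℂ) ≠ 0 := by exact_mod_cast hzp.ne'
      have n2 : (‖z'‖ : ℂ) ≠ 0 := by exact_mod_cast hzp'.ne'
      push_cast
      field_simp
      ring
    rw [e1]
    refine (norm_add_le _ _).trans ?_
    rw [norm_mul, h4, one_mul, Complex.norm_real, Real.norm_eq_abs, abs_sub_comm]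
    linarith
  calc _ = ‖(z / ‖z‖ : ℂ) * ((h - h' : ℝ) : ℂ) + h' * (z / ‖z‖ - z' / ‖z'‖ : ℂ)‖ := by
        congr 1; push_cast; ring
    _ ≤ |h - h'| + ‖z'‖ * ‖(z / ‖z‖ - z' / ‖z'‖ : ℂ)‖ := by
        refine (norm_add_le _ _).trans (add_le_add ?_ ?_)
        · rw [norm_mul, h4, one_mul, Complex.norm_real, Real.norm_eq_abs]
        · rw [norm_mul]
          exact mul_le_mul_of_nonneg_right h5 (norm_nonneg _)
    _ ≤ _ := by linarith

theorem SAFun.bump {E : Type*} [AddCommGroup E] [Module ℝ E] {f k : E → ℂ} (hf : SAFun f)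
    (hk : SAFun k) (g τ : ℝ) : SAFun fun x => bump g τ (f x) (k x) :=
  hk.mul (((SAFun.const 0).max ((SAFun.const 1).min (((SAFun.const (g + τ)).sub
    (hf.norm.mul_real hk.norm.inv_real)).mul_real (SAFun.const τ⁻¹)))).ofReal)

end bump

/-- A perturbation of the identity by a contraction is bijective. -/
theorem bijective_add_of_contraction {f : ℂ → ℂ} {K : ℝ} (hK : K < 1)
    (hf : ∀ a b, ‖f a - f b‖ ≤ K * ‖a - b‖) : Function.Bijective fun a => a + f a := by
  have hK' : LipschitzWith K.toNNReal f := LipschitzWith.of_dist_le_mul fun a b => by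
    rw [dist_eq_norm, dist_eq_norm]
    exact (hf a b).trans (mul_le_mul_of_nonneg_right (Real.le_coe_toNNReal K) (norm_nonneg _))
  constructor
  · intro a b hab
    have h1 : a - b = -(f a - f b) := by
      have : a + f a = b + f b := hab
      linear_combination this
    have h2 : ‖a - b‖ ≤ K * ‖a - b‖ := by
      conv_lhs => rw [h1, norm_neg]
      exact hf a b
    have h3 : ‖a - b‖ ≤ 0 := by nlinarith [norm_nonneg (a - b)]
    exact sub_eq_zero.1 (norm_le_zero_iff.1 h3)
  · intro y
    have hc : ContractingWith K.toNNReal fun a => y - f a := by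
      refine ⟨by rw [← NNReal.coe_lt_coe]; simp [hK], ?_⟩
      refine LipschitzWith.of_dist_le_mul fun a b => ?_
      rw [dist_sub_left]
      exact hK'.dist_le_mul a b
    have h1 := hc.fixedPoint_isFixedPt
    refine ⟨hc.fixedPoint _, ?_⟩
    have h2 : y - f (hc.fixedPoint _) = hc.fixedPoint _ := h1
    simp only
    linear_combination -h2

/-- A bijection that is the identity on `F` does not move points into or out of `F`. -/
theorem mem_iff_of_fixed {f : ℂ → ℂ} (hf : Function.Injective f) {F : Set ℂ}
    (hF : ∀ v ∈ F, f v = v) (a : ℂ) : f a ∈ F ↔ a ∈ F :=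
  ⟨fun h => by have := hf (hF _ h); rwa [← this], fun h => by rwa [hF a h]⟩

end Carrousel

/-! ### The displacement and its value on the curves of the carrousel -/

namespace Carrousel

variable {m d : ℕ} {P : Param m → ℂ → ℂ[X]} {E : PuiseuxExpansion d P}

/-- The disk about the `j`-th series at the exponent `l / N` is a cone or a disk `|y - f - a x ^ p|
≤ γ |x ^ p|` of the carrousel. -/
def Truncation.Nd (M : Truncation E) (j : Fin d) (l : ℕ) : Prop := l = E.N ∨ M.IsNode j l

/-- The radius of this disk. -/
noncomputable def rad (E : PuiseuxExpansion d P) (c : Constants d) (j : Fin d) (l : ℕ) : ℝ :=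
  if l = E.N then c.η else c.γ j l

open Classical in
/-- The series passing through this disk. -/
noncomputable def cls (M : Truncation E) (j : Fin d) (l : ℕ) : Finset (Fin d) :=
  Finset.univ.filter fun j' => E.Agree j j' (l + 1) ∧ M.Nd j' l

/-- The Puiseux polynomial of a system of coefficients. -/
noncomputable def psum (b : Fin d → ℕ → ℂ) (i : Fin d) (k : ℕ) (w : ℂ) : ℂ :=
  ∑ l ∈ Finset.range k, b i l * w ^ l

open Classical in
/-- The contribution of a disk to the displacement. -/
noncomputable def bumpTerm (M : Truncation E) (c : Constants d) (τ : ℝ) (b b' : Fin d → ℕ → ℂ)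
    (w y : ℂ) (j : Fin d) (l : ℕ) : ℂ :=
  if M.Nd j l then ((cls M j l).card : ℂ)⁻¹ * (b' j l - b j l) *
    bump (rad E c j l) τ (y - psum b j (l + 1) w) (w ^ l) else 0

/-- The displacement. -/
noncomputable def displacement (M : Truncation E) (c : Constants d) (τ : ℝ) (L : ℕ)
    (b b' : Fin d → ℕ → ℂ) (w y : ℂ) : ℂ :=
  ∑ l ∈ Finset.range L, ∑ j, bumpTerm M c τ b b' w y j l

/-- The part of the displacement due to the disks at exponents greater than `k / N`. -/
noncomputable def innerDisplacement (M : Truncation E) (c : Constants d) (τ : ℝ) (L : ℕ)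
    (b b' : Fin d → ℕ → ℂ) (w y : ℂ) (k : ℕ) : ℂ :=
  ∑ l ∈ Finset.Ico (k + 1) L, ∑ j, bumpTerm M c τ b b' w y j l

open Classical in
/-- The action of the deformation on the coefficient of `x ^ (k / N)`. -/
noncomputable def leafMap (M : Truncation E) (c : Constants d) (τ : ℝ) (b b' : Fin d → ℕ → ℂ)
    (i : Fin d) (k : ℕ) (a : ℂ) : ℂ :=
  a + ∑ j, if E.Agree i j k ∧ M.Nd j k then ((cls M j k).card : ℂ)⁻¹ * (b' j k - b j k) *
    bump (rad E c j k) τ (a - b j k) 1 else 0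

variable {M : Truncation E} {c : Constants d} {τ C : ℝ} {L : ℕ} {b b' : Fin d → ℕ → ℂ} {w y a : ℂ}
  {i j : Fin d} {k l : ℕ}

theorem mem_cls : j ∈ cls M i l ↔ E.Agree i j (l + 1) ∧ M.Nd j l := by simp [cls]

theorem cls_eq (h : E.Agree i j (l + 1)) : cls M i l = cls M j l := by
  ext j'
  rw [mem_cls, mem_cls]
  exact and_congr_left fun _ => ⟨h.symm.trans, h.trans⟩

theorem norm_card_inv_le (n : ℕ) : ‖((n : ℂ))⁻¹‖ ≤ 1 := by
  rw [norm_inv, Complex.norm_natCast]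
  rcases Nat.eq_zero_or_pos n with rfl | h
  · simp
  · exact inv_le_one_of_one_le₀ (by exact_mod_cast h)

namespace Bounds

variable (hB : Bounds M c τ C L)
include hB

theorem τ_le : τ ≤ C := by linarith [hB.τ_pos, hB.η_ge, hB.η_le]

theorem C_pos : 0 < C := hB.τ_pos.trans_le hB.τ_le

theorem lt_of_nd (h : M.Nd j l) : l < L := by
  rcases h with rfl | h
  · exact hB.N_lt
  · exact h.lt hB.last_lt

theorem rad_ge (h : M.Nd j l) : 2 * τ ≤ rad E c j l := by
  unfold rad
  split_ifs with hl
  · exact hB.η_ge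
  · exact hB.γ_ge j l (h.resolve_left hl)

theorem rad_le (h : M.Nd j l) : rad E c j l ≤ C := by
  unfold rad
  split_ifs with hl
  · exact hB.η_le
  · exact hB.γ_le j l (h.resolve_left hl)

theorem norm_le_one (hw : ‖w‖ * (8 * (L + 2) * C) ≤ τ) : ‖w‖ ≤ 1 := by
  have h1 := hB.C_pos
  have h2 : (0 : ℝ) ≤ L := Nat.cast_nonneg L
  have h3 : C ≤ 8 * (L + 2) * C := by nlinarith
  have h4 : ‖w‖ * C ≤ 1 * C := by
    rw [one_mul]
    exact (mul_le_mul_of_nonneg_left h3 (norm_nonneg w)).trans (hw.trans hB.τ_le)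
  exact le_of_mul_le_mul_right h4 h1

/-- The leading term v w ^ l clears the collar by τ |w| ^ l, and for small w this exceeds the terms
of higher order. -/
theorem far_of_eq {u v : ℂ} {g : ℝ} (hw : ‖w‖ * (8 * (L + 2) * C) ≤ τ)
    (hu : ‖u - v * w ^ l‖ ≤ (2 * L + 2) * C * ‖w‖ ^ (l + 1)) (hv : g + 2 * τ ≤ ‖v‖) :
    (g + τ) * ‖w‖ ^ l ≤ ‖u‖ := by
  have h1 : ‖v * w ^ l‖ - ‖u‖ ≤ ‖u - v * w ^ l‖ := by
    rw [norm_sub_rev]; exact norm_sub_norm_le _ _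
  rw [norm_mul, norm_pow] at h1
  have h2 : 0 ≤ ‖w‖ ^ l := by positivity
  have h3 : (2 * L + 2) * C * ‖w‖ ^ (l + 1) ≤ τ * ‖w‖ ^ l := by
    rw [pow_succ']
    have h4 : (2 * L + 2) * C * ‖w‖ ≤ τ := by
      have h5 := hB.C_pos
      have h6 : (0 : ℝ) ≤ L := Nat.cast_nonneg L
      have h7 : 0 ≤ ‖w‖ * C := by positivity
      nlinarith [mul_nonneg h7 h6]
    nlinarith
  nlinarith

/-- A difference of order w ^ k keeps at least τ / 2 |w| ^ k after the higher terms are subtracted,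
and this dominates any disk at a larger exponent. -/
theorem far_of_lt {u v : ℂ} {g : ℝ} (hw : ‖w‖ * (8 * (L + 2) * C) ≤ τ) (hg : g ≤ C) (hkl : k < l)
    (hu : ‖u - v * w ^ k‖ ≤ (2 * L + 2) * C * ‖w‖ ^ (k + 1)) (hv : τ ≤ ‖v‖) :
    (g + τ) * ‖w‖ ^ l ≤ ‖u‖ := by
  have h0 := hB.C_pos
  have h6 : (0 : ℝ) ≤ L := Nat.cast_nonneg L
  have h1 : ‖v * w ^ k‖ - ‖u‖ ≤ ‖u - v * w ^ k‖ := by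
    rw [norm_sub_rev]; exact norm_sub_norm_le _ _
  rw [norm_mul, norm_pow] at h1
  have h2 : 0 ≤ ‖w‖ ^ k := by positivity
  have h7 : 0 ≤ ‖w‖ * C := by positivity
  have h3 : (2 * L + 2) * C * ‖w‖ ^ (k + 1) ≤ τ / 2 * ‖w‖ ^ k := by
    rw [pow_succ']
    have h4 : (2 * L + 2) * C * ‖w‖ ≤ τ / 2 := by nlinarith [mul_nonneg h7 h6]
    nlinarith
  have h8 : ‖w‖ ^ l ≤ ‖w‖ * ‖w‖ ^ k := by
    rw [← pow_succ']
    exact pow_le_pow_of_le_one (norm_nonneg _) (hB.norm_le_one hw) hkl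
  have h9 : (g + τ) * ‖w‖ ^ l ≤ τ / 2 * ‖w‖ ^ k := by
    calc (g + τ) * ‖w‖ ^ l ≤ (2 * C) * (‖w‖ * ‖w‖ ^ k) := by
          refine mul_le_mul ?_ h8 (by positivity) (by linarith)
          linarith [hB.τ_le]
      _ = (2 * (‖w‖ * C)) * ‖w‖ ^ k := by ring
      _ ≤ _ := by
          refine mul_le_mul_of_nonneg_right ?_ h2
          nlinarith [mul_nonneg h7 h6]
  nlinarith

end Bounds

namespace Fit

variable (hB : Bounds M c τ C L) (F : Fit M c τ C L b)

include F in
theorem psum_congr (h : E.Agree i j k) (hk : k ≤ L) : psum b j k w = psum b i k w :=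
  Finset.sum_congr rfl fun l hl => by
    have hl := Finset.mem_range.1 hl
    rw [F.agree i j l (by omega) (h.mono hl)]

include hB F in
theorem norm_psum_sub_le (hw : ‖w‖ * (8 * (L + 2) * C) ≤ τ) (hlk : l ≤ k) (hk : k ≤ L) :
    ‖psum b i k w - psum b i l w‖ ≤ L * C * ‖w‖ ^ l := by
  rw [psum, psum, ← Finset.sum_Ico_eq_sub _ hlk]
  have h1 : ∀ l' ∈ Finset.Ico l k, ‖b i l' * w ^ l'‖ ≤ C * ‖w‖ ^ l := by
    intro l' hl'
    rw [Finset.mem_Ico] at hl'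
    rw [norm_mul, norm_pow]
    exact mul_le_mul (F.bound i l' (by omega))
      (pow_le_pow_of_le_one (norm_nonneg _) (hB.norm_le_one hw) hl'.1) (by positivity) hB.C_pos.le
  refine (norm_sum_le_of_le _ h1).trans ?_
  rw [Finset.sum_const, nsmul_eq_mul, Nat.card_Ico, mul_assoc]
  refine mul_le_mul_of_nonneg_right ?_ (mul_nonneg hB.C_pos.le (by positivity))
  exact_mod_cast (by omega : k - l ≤ L)

include F in
/-- Coefficients at exponents that do not occur vanish. -/
theorem eq_zero_of_not_nd (hB : Bounds M c τ C L) (hi : M.Nd i k) (hlk : l < k)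
    (h : ¬ M.Nd i l) : b i l = 0 := by
  rcases lt_trichotomy l E.N with h1 | h1 | h1
  · exact F.low i l h1
  · exact absurd (Or.inl h1) h
  · have h2 : M.IsNode i k := hi.resolve_left (by omega)
    refine F.zero i l (hlk.trans (hB.lt_of_nd hi)) ?_
    by_contra h3
    exact h (Or.inr ⟨h1, hlk.le.trans h2.2.1, h3⟩)

include F in
/-- Disks through which different series pass are far from each other. -/
theorem sep (hP : IsEquisingularFamily d P) (hB : Bounds M c τ C L) (hj : M.Nd j l)
    (hi : M.Nd i k) (hlk : l ≤ k) (h1 : E.Agree i j l) (h2 : ¬ E.Agree i j (l + 1)) :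
    rad E c j l + 2 * τ ≤ ‖b i l - b j l‖ := by
  unfold rad
  have hη := hB.η_ge
  have hτ := hB.τ_pos
  split_ifs with hl
  · subst hl
    linarith [F.cones i j h2]
  · have hj' : M.IsNode j l := hj.resolve_left hl
    have hγ := hB.γ_ge j l hj'
    -- If the exponent is missing in the i-th series, its coefficient there is 0 and
    -- `hasCore_of_missing` applies; the distance then comes from the inequality for α.
    by_cases h3 : M.IsNode i l
    · linarith [F.disks j l i j hj' ⟨h3, h1.symm⟩ ⟨hj', .refl _ _⟩ h2]
    · have hi' : M.IsNode i k := hi.resolve_left fun h => by have := hj'.1; omega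
      have h4 : ∀ᶠ t in 𝓝 (0 : Param m), E.coeff i l t = 0 := by
        by_contra h5
        exact h3 ⟨hj'.1, hlk.trans hi'.2.1, h5⟩
      rw [F.zero i l (hj'.lt hB.last_lt) h4, zero_sub, norm_neg]
      have := F.core j l j hj' (Truncation.hasCore_of_missing hP h1 h4) ⟨hj', .refl _ _⟩
      linarith [hB.α_ge j l hj']

end Fit

theorem rad_eq {c : Constants d} (hc : c.Admissible M) (h : E.Agree i j l) (hi : M.Nd i l)
    (hj : M.Nd j l) : rad E c i l = rad E c j l := by
  unfold rad
  split_ifs with hl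
  · rfl
  · refine (hc.well_defined i j l (hi.resolve_left hl) (hj.resolve_left hl) ⟨1, one_pow _, ?_⟩).2.2
    intro l' hl'
    filter_upwards [h l' hl'] with t ht
    rw [ht, one_pow, one_mul]

section key

variable (hP : IsEquisingularFamily d P) (hB : Bounds M c τ C L) (F : Fit M c τ C L b)
  (F' : Fit M c τ C L b') (hw : ‖w‖ * (8 * (L + 2) * C) ≤ τ)
  (hi : M.Nd i k) (ha : k = E.N ∨ ‖a‖ ≤ 2 * C)

include hP in
-- All series agree below N, so for k = N there is nothing to distinguish at smaller exponents. This
-- is why lines of arbitrary slope a are allowed in that case.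
theorem lt_exponent_of_agree (ha : k = E.N ∨ ‖a‖ ≤ 2 * C) (h : ¬ E.Agree i j (l + 1)) (hlk : l < k) :
    ‖a‖ ≤ 2 * C := by
  refine ha.resolve_left ?_
  rintro rfl
  exact h ((PuiseuxExpansion.agree_N hP i j).mono hlk)

include hB F hw hi ha in
-- The curve differs from the center of a larger disk around the i-th series by O(w ^ (l + 1)), so
-- it lies where the cut-off equals 1.
theorem bump_of_agree (hj : M.Nd j l) (hlk : l < k) (h : E.Agree i j (l + 1)) :
    bump (rad E c j l) τ (psum b i k w + a * w ^ k - psum b j (l + 1) w) (w ^ l) = w ^ l := by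
  refine bump_of_le hB.τ_pos ?_
  have hkL := hB.lt_of_nd hi
  have hCpos := hB.C_pos
  have hNl : E.N ≤ l := by
    rcases hj with h | h
    · exact h.ge
    · exact h.1.le
  have ha' : ‖a‖ ≤ 2 * C := ha.resolve_left (by omega)
  rw [F.psum_congr h (by omega), show psum b i k w + a * w ^ k - psum b i (l + 1) w =
    (psum b i k w - psum b i (l + 1) w) + a * w ^ k by ring, norm_pow]
  have h1 := F.norm_psum_sub_le (i := i) hB hw (Nat.succ_le_of_lt hlk) hkL.le
  have h2 : ‖a * w ^ k‖ ≤ 2 * C * ‖w‖ ^ (l + 1) := by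
    rw [norm_mul, norm_pow]
    exact mul_le_mul ha' (pow_le_pow_of_le_one (norm_nonneg _) (hB.norm_le_one hw) hlk)
      (by positivity) (by positivity)
  calc _ ≤ L * C * ‖w‖ ^ (l + 1) + 2 * C * ‖w‖ ^ (l + 1) := (norm_add_le _ _).trans (add_le_add h1 h2)
    _ = ‖w‖ * ((L + 2) * C) * ‖w‖ ^ l := by ring
    _ ≤ _ := by
      refine mul_le_mul_of_nonneg_right ?_ (by positivity)
      have h3 : (0 : ℝ) ≤ L := Nat.cast_nonneg L
      have h4 : 0 ≤ ‖w‖ * ((L + 2) * C) := by positivity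
      linarith [hB.rad_ge hj, hB.τ_pos]

include hP hB F hw hi ha in
-- Once the series have separated at l₀ < k, the curve stays at distance of order w ^ l₀ from every
-- disk of the j-th series at exponents l ≥ l₀.
theorem bump_of_not_agree (hj : M.Nd j l) {l₀ : ℕ} (hlk : l₀ < k) (hl : l₀ ≤ l)
    (h : E.Agree i j l₀) (h' : ¬ E.Agree i j (l₀ + 1)) :
    bump (rad E c j l) τ (psum b i k w + a * w ^ k - psum b j (l + 1) w) (w ^ l) = 0 := by
  refine bump_eq_zero hB.τ_pos ?_
  rw [norm_pow]
  have hkL := hB.lt_of_nd hi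
  have hCpos := hB.C_pos
  have hlL := hB.lt_of_nd hj
  have ha' := lt_exponent_of_agree hP ha h' hlk
  have hu : ‖psum b i k w + a * w ^ k - psum b j (l + 1) w - (b i l₀ - b j l₀) * w ^ l₀‖ ≤
      (2 * L + 2) * C * ‖w‖ ^ (l₀ + 1) := by
    have e1 : psum b i (l₀ + 1) w = psum b i l₀ w + b i l₀ * w ^ l₀ := Finset.sum_range_succ _ _
    have e2 : psum b j (l₀ + 1) w = psum b i l₀ w + b j l₀ * w ^ l₀ := by
      rw [← F.psum_congr h (by omega)]; exact Finset.sum_range_succ _ _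
    have h1 := F.norm_psum_sub_le (i := i) hB hw (Nat.succ_le_of_lt hlk) hkL.le
    have h2 := F.norm_psum_sub_le (i := j) hB hw (Nat.succ_le_succ hl) (by omega : l + 1 ≤ L)
    have h3 : ‖a * w ^ k‖ ≤ 2 * C * ‖w‖ ^ (l₀ + 1) := by
      rw [norm_mul, norm_pow]
      exact mul_le_mul ha' (pow_le_pow_of_le_one (norm_nonneg _) (hB.norm_le_one hw) hlk)
        (by positivity) (by positivity)
    rw [show psum b i k w + a * w ^ k - psum b j (l + 1) w - (b i l₀ - b j l₀) * w ^ l₀ =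
      (psum b i k w - psum b i (l₀ + 1) w) + a * w ^ k -
        (psum b j (l + 1) w - psum b j (l₀ + 1) w) by rw [e1, e2]; ring]
    refine (norm_sub_le _ _).trans ((add_le_add ((norm_add_le _ _).trans
      (add_le_add h1 h3)) h2).trans (le_of_eq ?_))
    simp only [Nat.succ_eq_add_one]
    ring
  rcases hl.eq_or_lt with rfl | hl
  · exact hB.far_of_eq hw hu (F.sep hP hB hj hi hlk.le h h')
  · exact hB.far_of_lt hw (hB.rad_le hj) hl hu (F.differ i j l₀ (by omega) h h')

include F F' in
-- The reciprocal of the number of series in a disk makes their equal contributions add up to a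
-- single one. If the i-th series has no disk at this exponent, both of its coefficients are 0.
theorem sum_cls (hB : Bounds M c τ C L) (hi : M.Nd i k) (hlk : l ≤ k) (x : ℂ) :
    ∑ j ∈ cls M i l, ((cls M j l).card : ℂ)⁻¹ * (b' j l - b j l) * x = (b' i l - b i l) * x := by
  have hlL : l < L := hlk.trans_lt (hB.lt_of_nd hi)
  have h1 : ∀ j ∈ cls M i l, ((cls M j l).card : ℂ)⁻¹ * (b' j l - b j l) * x =
      ((cls M i l).card : ℂ)⁻¹ * ((b' i l - b i l) * x) := by
    intro j hj
    have h := (mem_cls.1 hj).1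
    rw [F.agree i j l hlL h, F'.agree i j l hlL h, ← cls_eq h, mul_assoc]
  rw [Finset.sum_congr rfl h1, Finset.sum_const, nsmul_eq_mul]
  by_cases hl : M.Nd i l
  · have h2 : ((cls M i l).card : ℂ) ≠ 0 := by
      have : i ∈ cls M i l := mem_cls.2 ⟨.refl _ _, hl⟩
      exact_mod_cast (Finset.card_pos.2 ⟨i, this⟩).ne'
    rw [mul_inv_cancel_left₀ h2]
  · have hlk' : l < k := lt_of_le_of_ne hlk fun h => hl (h ▸ hi)
    rw [F.eq_zero_of_not_nd hB hi hlk' hl, F'.eq_zero_of_not_nd hB hi hlk' hl]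
    simp

theorem exists_first_difference {n : ℕ} (h : ¬ E.Agree i j n) :
    ∃ l₀ < n, E.Agree i j l₀ ∧ ¬ E.Agree i j (l₀ + 1) := by
  classical
  have hex : ∃ n, ¬ E.Agree i j n := ⟨n, h⟩
  have h1 := Nat.find_spec hex
  have h2 : Nat.find hex ≠ 0 := fun h0 => by
    rw [h0] at h1
    exact h1 fun l hl => absurd hl (Nat.not_lt_zero l)
  obtain ⟨l₀, hl₀⟩ := Nat.exists_eq_succ_of_ne_zero h2
  refine ⟨l₀, ?_, ?_, ?_⟩
  · have := Nat.find_min' hex h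
    omega
  · by_contra h3
    have := Nat.find_min' hex h3
    omega
  · rw [hl₀] at h1; exact h1

include hP hB F F' hw hi ha in
-- Split the sum over exponents at k. Below k, the disks containing the i-th series contribute fully
-- and all others nothing, which replaces the initial terms for b by those for b'. At k, homogeneity
-- yields `leafMap`. The rest is kept as it is.
theorem displacement_eq (hy : y = psum b i k w + a * w ^ k) :
    y + displacement M c τ L b b' w y = psum b' i k w + leafMap M c τ b b' i k a * w ^ k +
      innerDisplacement M c τ L b b' w y k := by
  classical
  subst hy
  have hkL := hB.lt_of_nd hi
  set y := psum b i k w + a * w ^ k with hy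
  have hlow : ∀ l ∈ Finset.range k, ∑ j, bumpTerm M c τ b b' w y j l =
      (b' i l - b i l) * w ^ l := by
    intro l hl
    have hlk := Finset.mem_range.1 hl
    rw [← sum_cls F F' hB hi hlk.le, cls, Finset.sum_filter]
    refine Finset.sum_congr rfl fun j _ => ?_
    unfold bumpTerm
    by_cases h1 : M.Nd j l
    · by_cases h2 : E.Agree i j (l + 1)
      · rw [if_pos h1, if_pos ⟨h2, h1⟩, bump_of_agree hB F hw hi ha h1 hlk h2]
      · rw [if_pos h1, if_neg (fun h => h2 h.1)]
        obtain ⟨l₀, h3, h4, h5⟩ := exists_first_difference h2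
        rw [bump_of_not_agree hP hB F hw hi ha h1 (by omega) (by omega) h4 h5, mul_zero]
    · rw [if_neg h1, if_neg (fun h => h1 h.2)]
  have hmid : ∑ j, bumpTerm M c τ b b' w y j k = (leafMap M c τ b b' i k a - a) * w ^ k := by
    rw [leafMap, add_sub_cancel_left, Finset.sum_mul]
    refine Finset.sum_congr rfl fun j _ => ?_
    unfold bumpTerm
    by_cases h1 : M.Nd j k
    · by_cases h2 : E.Agree i j k
      · rw [if_pos h1, if_pos ⟨h2, h1⟩]
        have e1 : y - psum b j (k + 1) w = (a - b j k) * w ^ k := by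
          have : psum b j (k + 1) w = psum b j k w + b j k * w ^ k := Finset.sum_range_succ _ _
          rw [this, F.psum_congr h2 hkL.le, hy]
          ring
        rw [e1, bump_mul_left]
        ring
      · rw [if_pos h1, if_neg (fun h => h2 h.1)]
        obtain ⟨l₀, h3, h4, h5⟩ := exists_first_difference h2
        rw [bump_of_not_agree hP hB F hw hi ha h1 h3 h3.le h4 h5, mul_zero, zero_mul]
    · rw [if_neg h1, if_neg (fun h => h1 h.2), zero_mul]
  have hsplit : displacement M c τ L b b' w y = ∑ l ∈ Finset.range k, (b' i l - b i l) * w ^ l +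
      (leafMap M c τ b b' i k a - a) * w ^ k + innerDisplacement M c τ L b b' w y k := by
    rw [displacement, innerDisplacement, ← Finset.sum_congr rfl hlow, ← hmid,
      ← Finset.sum_range_succ (fun l => ∑ j, bumpTerm M c τ b b' w y j l),
      Finset.sum_range_add_sum_Ico _ (by omega)]
  rw [hsplit, hy]
  simp only [sub_mul, Finset.sum_sub_distrib, psum]
  ring

include hP hB F hw hi ha in
/-- Only the disks inside the given one contribute to the inner displacement. -/
theorem innerDisplacement_eq_zero (hy : y = psum b i k w + a * w ^ k)
    (h : ∀ j l, E.Agree i j k → M.Nd j l → k < l →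
      (rad E c j l + τ) * ‖w‖ ^ l ≤ ‖y - psum b j (l + 1) w‖) :
    innerDisplacement M c τ L b b' w y k = 0 := by
  refine Finset.sum_eq_zero fun l hl => Finset.sum_eq_zero fun j _ => ?_
  unfold bumpTerm
  split_ifs with h1
  · rw [Finset.mem_Ico] at hl
    have : bump (rad E c j l) τ (y - psum b j (l + 1) w) (w ^ l) = 0 := by
      by_cases h2 : E.Agree i j k
      · exact bump_eq_zero hB.τ_pos (by rw [norm_pow]; exact h j l h2 h1 (by omega))
      · obtain ⟨l₀, h3, h4, h5⟩ := exists_first_difference h2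
        rw [hy]
        exact bump_of_not_agree hP hB F hw hi ha h1 h3 (by omega) h4 h5
    rw [this, mul_zero]
  · rfl

include hB F hw hi in
-- A coefficient a at distance τ from that of the j-th series already keeps the curve out of all
-- smaller disks around this series.
theorem far_of_agree (hy : y = psum b i k w + a * w ^ k) (h : E.Agree i j k) (hj : M.Nd j l)
    (hkl : k < l) (hab : τ ≤ ‖a - b j k‖) :
    (rad E c j l + τ) * ‖w‖ ^ l ≤ ‖y - psum b j (l + 1) w‖ := by
  have hkL := hB.lt_of_nd hi
  have hCpos := hB.C_pos
  have hlL := hB.lt_of_nd hj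
  refine hB.far_of_lt hw (hB.rad_le hj) hkl ?_ hab
  have h1 := F.norm_psum_sub_le (i := j) hB hw (by omega : k + 1 ≤ l + 1) (by omega)
  have e1 : psum b j (k + 1) w = psum b i k w + b j k * w ^ k := by
    rw [← F.psum_congr h hkL.le]; exact Finset.sum_range_succ _ _
  rw [hy, show psum b i k w + a * w ^ k - psum b j (l + 1) w - (a - b j k) * w ^ k =
    -(psum b j (l + 1) w - psum b j (k + 1) w) by rw [e1]; ring, norm_neg]
  refine h1.trans (mul_le_mul_of_nonneg_right ?_ (by positivity))
  have : (0 : ℝ) ≤ L := Nat.cast_nonneg L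
  nlinarith

include hB in
theorem norm_bumpTerm_le {κ : ℝ} (hκ : ∀ j, ∀ l < L, ‖b' j l - b j l‖ ≤ κ) :
    ‖bumpTerm M c τ b b' w y j l‖ ≤ κ * ‖w‖ ^ l := by
  have hκ0 : 0 ≤ κ := (norm_nonneg _).trans (hκ j E.N hB.N_lt)
  unfold bumpTerm
  split_ifs with h
  · rw [norm_mul, norm_mul, ← norm_pow]
    refine mul_le_mul ?_ norm_bump_le (norm_nonneg _) hκ0
    exact (mul_le_mul (norm_card_inv_le _) (hκ j l (hB.lt_of_nd h)) (norm_nonneg _)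
      zero_le_one).trans (one_mul κ).le
  · rw [norm_zero]; positivity

include hB hw in
theorem norm_innerDisplacement_le {κ : ℝ} (hκ : ∀ j, ∀ l < L, ‖b' j l - b j l‖ ≤ κ)
    (hκτ : 2 * (L * (d * κ)) ≤ τ) (hd : 0 ≤ κ) :
    ‖innerDisplacement M c τ L b b' w y k‖ ≤ τ * ‖w‖ ^ k := by
  have h1 : ∀ l ∈ Finset.Ico (k + 1) L, ‖∑ j, bumpTerm M c τ b b' w y j l‖ ≤ d * κ * ‖w‖ ^ k := by
    intro l hl
    rw [Finset.mem_Ico] at hl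
    refine (norm_sum_le_of_le _ fun j _ => (norm_bumpTerm_le hB hκ).trans
      (mul_le_mul_of_nonneg_left (pow_le_pow_of_le_one (norm_nonneg _) (hB.norm_le_one hw)
        (by omega : k ≤ l)) hd)).trans (le_of_eq ?_)
    simp [mul_assoc]
  refine (norm_sum_le_of_le _ h1).trans ?_
  rw [Finset.sum_const, nsmul_eq_mul, Nat.card_Ico, ← mul_assoc]
  refine mul_le_mul_of_nonneg_right ?_ (by positivity)
  have h2 : ((L - (k + 1) : ℕ) : ℝ) ≤ L := by exact_mod_cast Nat.sub_le _ _
  have h3 : ((L - (k + 1) : ℕ) : ℝ) * (d * κ) ≤ L * (d * κ) :=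
    mul_le_mul_of_nonneg_right h2 (by positivity)
  have h4 : (0 : ℝ) ≤ L * (d * κ) := by positivity
  linarith

end key

end Carrousel

/-! ### Action of the deformation on leaf coefficients and on disks -/

namespace Carrousel

variable {m d : ℕ} {P : Param m → ℂ → ℂ[X]} {E : PuiseuxExpansion d P}
variable {M : Truncation E} {c : Constants d} {τ C κ : ℝ} {L : ℕ} {b b' : Fin d → ℕ → ℂ} {w y a : ℂ}
  {i j : Fin d} {k l : ℕ}

/-- Two systems of coefficients that fit and are close to each other. -/
structure Close (M : Truncation E) (c : Constants d) (τ C κ : ℝ) (L : ℕ) (b b' : Fin d → ℕ → ℂ) :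
    Prop where
  adm : c.Admissible M
  bounds : Bounds M c τ C L
  fit : Fit M c τ C L b
  fit' : Fit M c τ C L b'
  κ_nonneg : 0 ≤ κ
  close : ∀ j, ∀ l < L, ‖b' j l - b j l‖ ≤ κ
  small : 2 * (L * (d * κ)) ≤ τ

/-- The set of leaves of `B_κ` for a system of coefficients. -/
def leafSet (M : Truncation E) (c : Constants d) (i : Fin d) (k : ℕ) (b : Fin d → ℕ → ℂ) : Set ℂ :=
  {a | ‖a‖ ≤ c.β i k ∧ (M.HasCore i k → c.α i k ≤ ‖a‖) ∧
    ∀ j, M.Fits i k j → c.γ i k ≤ ‖a - b j k‖}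

/-- Here both disks belong to the carrousel at the same exponent, so the distance covers both radii,
and a closed disk misses the collar of the other. -/
theorem Fit.sep_nd (hc : c.Admissible M) (F : Fit M c τ C L b) (hi : M.Nd i l)
    (hj : M.Nd j l) (h1 : E.Agree i j l) (h2 : ¬ E.Agree i j (l + 1)) :
    rad E c i l + rad E c j l + 2 * τ ≤ ‖b i l - b j l‖ := by
  rw [rad_eq hc h1 hi hj]
  unfold rad
  split_ifs with hl
  · subst hl
    linarith [F.cones i j h2]
  · have hj' := hj.resolve_left hl
    linarith [F.disks j l i j hj' ⟨hi.resolve_left hl, h1.symm⟩ ⟨hj', .refl _ _⟩ h2]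

theorem Fit.psum_N (F : Fit M c τ C L b) : psum b i E.N w = 0 :=
  Finset.sum_eq_zero fun l hl => by rw [F.low i l (Finset.mem_range.1 hl), zero_mul]

namespace Close

variable (H : Close M c τ C κ L b b')
include H

theorem leafMap_bijective : Function.Bijective (leafMap M c τ b b' i k) := by
  classical
  have hB := H.bounds
  have hτ := hB.τ_pos
  refine bijective_add_of_contraction (K := 1 / 2) (by norm_num) fun a a' => ?_
  rw [← Finset.sum_sub_distrib]
  have h1 : ∀ j ∈ (Finset.univ : Finset (Fin d)),
      ‖(if E.Agree i j k ∧ M.Nd j k then ((cls M j k).card : ℂ)⁻¹ * (b' j k - b j k) *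
        bump (rad E c j k) τ (a - b j k) 1 else 0) -
      (if E.Agree i j k ∧ M.Nd j k then ((cls M j k).card : ℂ)⁻¹ * (b' j k - b j k) *
        bump (rad E c j k) τ (a' - b j k) 1 else 0)‖ ≤ κ * (‖a - a'‖ / τ) := by
    intro j _
    split_ifs with h
    · rw [← mul_sub, norm_mul, norm_mul]
      refine mul_le_mul ?_ ?_ (norm_nonneg _) H.κ_nonneg
      · exact (mul_le_mul (norm_card_inv_le _) (H.close j k (hB.lt_of_nd h.2)) (norm_nonneg _)
          zero_le_one).trans (one_mul κ).le
      · have := norm_bump_sub_le (u := a - b j k) (u' := a' - b j k) (z := 1) (z' := 1) hτ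
          (by linarith [hB.rad_ge h.2] : 0 ≤ rad E c j k)
        simpa using this
    · rw [sub_zero, norm_zero]
      exact mul_nonneg H.κ_nonneg (by positivity)
  refine (norm_sum_le_of_le _ h1).trans ?_
  rw [Finset.sum_const, nsmul_eq_mul, Finset.card_univ, Fintype.card_fin]
  have hL : (1 : ℝ) ≤ L := by exact_mod_cast Nat.one_le_of_lt hB.N_lt
  have h2 : (d : ℝ) * κ ≤ L * (d * κ) := by
    have : 0 ≤ (d : ℝ) * κ := mul_nonneg (Nat.cast_nonneg d) H.κ_nonneg
    nlinarith
  calc (d : ℝ) * (κ * (‖a - a'‖ / τ)) = (d * κ / τ) * ‖a - a'‖ := by ring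
    _ ≤ 1 / 2 * ‖a - a'‖ := by
      refine mul_le_mul_of_nonneg_right ?_ (norm_nonneg _)
      rw [div_le_iff₀ hτ]
      linarith [H.small]

theorem leafMap_of_far (h : ∀ j, E.Agree i j k → M.Nd j k → rad E c j k + τ ≤ ‖a - b j k‖) :
    leafMap M c τ b b' i k a = a := by
  rw [leafMap, Finset.sum_eq_zero, add_zero]
  intro j _
  split_ifs with hj
  · rw [bump_eq_zero H.bounds.τ_pos (by simpa using h j hj.1 hj.2), mul_zero]
  · rfl

/-- In this disk only the series of the same class act. Their cut-offs are 1 and their shares sum to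
one translation; the collars of the other disks do not reach it. -/
theorem leafMap_of_mem (h : E.Agree i j k) (hj : M.Nd j k) (ha : ‖a - b j k‖ ≤ rad E c j k) :
    leafMap M c τ b b' i k a = a - b j k + b' j k := by
  classical
  have hτ := H.bounds.τ_pos
  have h1 := sum_cls (i := j) H.fit H.fit' H.bounds hj le_rfl 1
  rw [cls, Finset.sum_filter] at h1
  have h2 : ∀ j' ∈ (Finset.univ : Finset (Fin d)),
      (if E.Agree i j' k ∧ M.Nd j' k then ((cls M j' k).card : ℂ)⁻¹ * (b' j' k - b j' k) *
        bump (rad E c j' k) τ (a - b j' k) 1 else 0) =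
      if E.Agree j j' (k + 1) ∧ M.Nd j' k then
        ((cls M j' k).card : ℂ)⁻¹ * (b' j' k - b j' k) * 1 else 0 := by
    intro j' _
    by_cases hj' : M.Nd j' k
    · by_cases h3 : E.Agree j j' (k + 1)
      · rw [if_pos ⟨h.trans (h3.mono (Nat.le_succ k)), hj'⟩, if_pos ⟨h3, hj'⟩, bump_of_le hτ]
        rw [norm_one, mul_one, H.fit.agree j j' k (H.bounds.lt_of_nd hj) h3,
          ← rad_eq H.adm (h3.mono (Nat.le_succ k)) hj hj']
        exact ha
      · have hn : ¬ (E.Agree j j' (k + 1) ∧ M.Nd j' k) := fun h4 => h3 h4.1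
        rw [if_neg hn]
        split_ifs with h4
        · rw [bump_eq_zero hτ, mul_zero]
          rw [norm_one, mul_one]
          have h5 := H.fit.sep_nd H.adm hj hj' (h.symm.trans h4.1) h3
          have h6 : ‖b j k - b j' k‖ ≤ ‖a - b j' k‖ + ‖a - b j k‖ := by
            rw [show b j k - b j' k = (a - b j' k) - (a - b j k) by ring]
            exact norm_sub_le _ _
          linarith
        · rfl
    · rw [if_neg (fun h => hj' h.2), if_neg (fun h => hj' h.2)]
  rw [leafMap, Finset.sum_congr rfl h2, h1]
  ring

theorem leafMap_sub_lt_iff (h : E.Agree i j k) (hj : M.Nd j k) :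
    ‖leafMap M c τ b b' i k a - b' j k‖ < rad E c j k ↔ ‖a - b j k‖ < rad E c j k := by
  constructor
  · intro h1
    -- The point of the disk for b whose translate is the given image; injectivity identifies it
    -- with a.
    set v := leafMap M c τ b b' i k a - b' j k + b j k with hv
    have h2 : v - b j k = leafMap M c τ b b' i k a - b' j k := by rw [hv]; ring
    have h3 := H.leafMap_of_mem (a := v) h hj (by rw [h2]; exact h1.le)
    rw [h2, sub_add_cancel] at h3
    rw [← H.leafMap_bijective.1 h3, h2]
    exact h1
  · intro h1
    rw [H.leafMap_of_mem h hj h1.le, add_sub_cancel_right]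
    exact h1

theorem leafMap_of_norm_le (hik : M.IsNode i k) (hcore : M.HasCore i k) (ha : ‖a‖ ≤ c.α i k) :
    leafMap M c τ b b' i k a = a := by
  refine H.leafMap_of_far fun j h hj => ?_
  have hj' : M.IsNode j k := hj.resolve_left hik.1.ne'
  have h1 := H.fit.core i k j hik hcore ⟨hj', h⟩
  have h2 := rad_eq H.adm h (Or.inr hik) hj
  have h3 : rad E c i k = c.γ i k := if_neg hik.1.ne'
  have h4 : ‖b j k‖ - ‖a‖ ≤ ‖a - b j k‖ := by rw [norm_sub_rev]; exact norm_sub_norm_le _ _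
  linarith [H.bounds.τ_pos]

theorem leafMap_of_le_norm (hik : M.IsNode i k) (ha : c.β i k ≤ ‖a‖) :
    leafMap M c τ b b' i k a = a := by
  refine H.leafMap_of_far fun j h hj => ?_
  have hj' : M.IsNode j k := hj.resolve_left hik.1.ne'
  have h1 := H.fit.beta i k j hik ⟨hj', h⟩
  have h2 := rad_eq H.adm h (Or.inr hik) hj
  have h3 : rad E c i k = c.γ i k := if_neg hik.1.ne'
  have h4 : ‖a‖ - ‖b j k‖ ≤ ‖a - b j k‖ := norm_sub_norm_le _ _
  linarith [H.bounds.τ_pos]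

theorem leafMap_of_R_le_norm (ha : c.R ≤ ‖a‖) : leafMap M c τ b b' i E.N a = a := by
  refine H.leafMap_of_far fun j h hj => ?_
  have h1 := H.fit.cones_le j
  have h3 : rad E c j E.N = c.η := if_pos rfl
  have h4 : ‖a‖ - ‖b j E.N‖ ≤ ‖a - b j E.N‖ := norm_sub_norm_le _ _
  linarith [H.bounds.τ_pos]

/-- The outer region and the central disk are fixed pointwise, the removed disks are translated, and
the map is bijective; hence the region left over is matched as well. -/
theorem leafMap_mem_leafSet (hik : M.IsNode i k) :
    leafMap M c τ b b' i k a ∈ leafSet M c i k b' ↔ a ∈ leafSet M c i k b := by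
  have hinj := (H.leafMap_bijective (i := i) (k := k)).1
  have h3 : rad E c i k = c.γ i k := if_neg hik.1.ne'
  refine and_congr ?_ (and_congr (forall_congr' fun hcore => ?_)
    (forall₂_congr fun j hj => ?_))
  · have := mem_iff_of_fixed hinj (F := {v | c.β i k < ‖v‖})
      (fun v hv => H.leafMap_of_le_norm hik hv.le) a
    simp only [Set.mem_ofPred_eq] at this
    rw [← not_lt, this, not_lt]
  · have := mem_iff_of_fixed hinj (F := {v | ‖v‖ < c.α i k})
      (fun v hv => H.leafMap_of_norm_le hik hcore hv.le) a
    simp only [Set.mem_ofPred_eq] at this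
    rw [← not_lt, this, not_lt]
  · have := H.leafMap_sub_lt_iff (a := a) hj.2 (Or.inr hj.1)
    rw [← rad_eq H.adm hj.2 (Or.inr hik) (Or.inr hj.1), h3] at this
    rw [← not_lt, this, not_lt]

variable (hP : IsEquisingularFamily d P) (hw : ‖w‖ * (8 * (L + 2) * C) ≤ τ)
include hP hw

/-- The deformation maps the leaves of `B_κ` to leaves. -/
theorem add_displacement_leaf (hik : M.IsNode i k) (ha : a ∈ leafSet M c i k b) :
    psum b i k w + a * w ^ k + displacement M c τ L b b' w (psum b i k w + a * w ^ k) =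
      psum b' i k w + leafMap M c τ b b' i k a * w ^ k := by
  have hB := H.bounds
  have hτ := hB.τ_pos
  have hi : M.Nd i k := Or.inr hik
  have ha2 : k = E.N ∨ ‖a‖ ≤ 2 * C := Or.inr (by linarith [ha.1, hB.β_le i k hik, hB.C_pos])
  rw [displacement_eq hP hB H.fit H.fit' hw hi ha2 rfl,
    innerDisplacement_eq_zero hP hB H.fit hw hi ha2 rfl, add_zero]
  intro j l h hj hkl
  refine far_of_agree hB H.fit hw hi rfl h hj hkl ?_
  -- Either a avoids the disk of radius γ about the coefficient of the j-th series, or this series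
  -- lacks the exponent and runs through the central disk, which is then present and also avoided by
  -- a.
  by_cases hjk : M.IsNode j k
  · linarith [ha.2.2 j ⟨hjk, h⟩, hB.γ_ge i k hik]
  · have hj' : M.IsNode j l := hj.resolve_left (by have := hik.1; omega)
    have h0 : ∀ᶠ t in 𝓝 (0 : Param m), E.coeff j k t = 0 := by
      by_contra h5
      exact hjk ⟨hik.1, hkl.le.trans hj'.2.1, h5⟩
    rw [H.fit.zero j k (hik.lt hB.last_lt) h0, sub_zero]
    linarith [ha.2.1 (Truncation.hasCore_of_missing hP h.symm h0), hB.α_ge i k hik]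

/-- The deformation maps complex lines far from the tangent lines to complex lines. -/
theorem add_displacement_line (i : Fin d) (ha : ∀ j, τ ≤ ‖a - b j E.N‖) :
    a * w ^ E.N + displacement M c τ L b b' w (a * w ^ E.N) =
      leafMap M c τ b b' i E.N a * w ^ E.N := by
  have hB := H.bounds
  have hi : M.Nd i E.N := Or.inl rfl
  have hy : a * w ^ E.N = psum b i E.N w + a * w ^ E.N := by rw [H.fit.psum_N, zero_add]
  rw [displacement_eq hP hB H.fit H.fit' hw hi (Or.inl rfl) hy,
    innerDisplacement_eq_zero hP hB H.fit hw hi (Or.inl rfl) hy, add_zero, H.fit'.psum_N,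
    zero_add]
  intro j l h hj hkl
  exact far_of_agree hB H.fit hw hi hy h hj hkl (ha j)

/-- The deformation almost preserves complex lines. -/
theorem norm_add_displacement_sub_le (i : Fin d) (a : ℂ) :
    ‖a * w ^ E.N + displacement M c τ L b b' w (a * w ^ E.N) -
      leafMap M c τ b b' i E.N a * w ^ E.N‖ ≤ τ * ‖w ^ E.N‖ := by
  have hB := H.bounds
  have hi : M.Nd i E.N := Or.inl rfl
  have hy : a * w ^ E.N = psum b i E.N w + a * w ^ E.N := by rw [H.fit.psum_N, zero_add]
  rw [displacement_eq hP hB H.fit H.fit' hw hi (Or.inl rfl) hy, H.fit'.psum_N, zero_add,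
    add_sub_cancel_left, norm_pow]
  exact norm_innerDisplacement_le hB hw H.close H.small H.κ_nonneg

/-- The deformation translates the disks about the series. -/
theorem add_displacement_around (hi : M.Nd i k) {u : ℂ} (hu : ‖u‖ ≤ rad E c i k * ‖w‖ ^ k)
    (h : ∀ j l, E.Agree i j (k + 1) → M.Nd j l → k < l →
      (rad E c j l + τ) * ‖w‖ ^ l ≤ ‖psum b i (k + 1) w + u - psum b j (l + 1) w‖) :
    psum b i (k + 1) w + u + displacement M c τ L b b' w (psum b i (k + 1) w + u) =
      psum b' i (k + 1) w + u := by
  have hB := H.bounds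
  have hτ := hB.τ_pos
  obtain ⟨v, rfl, hv⟩ : ∃ v, u = v * w ^ k ∧ ‖v‖ ≤ rad E c i k := by
    by_cases hwk : w ^ k = 0
    · refine ⟨0, ?_, ?_⟩
      · rw [← norm_pow, hwk, norm_zero, mul_zero] at hu
        rw [norm_le_zero_iff.1 hu, zero_mul]
      · rw [norm_zero]; linarith [hB.rad_ge hi]
    · refine ⟨u / w ^ k, (div_mul_cancel₀ _ hwk).symm, ?_⟩
      rw [norm_div, norm_pow]
      exact (div_le_iff₀ (by rw [← norm_pow]; exact norm_pos_iff.2 hwk)).2 hu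
  have hy : psum b i (k + 1) w + v * w ^ k = psum b i k w + (b i k + v) * w ^ k := by
    have : psum b i (k + 1) w = psum b i k w + b i k * w ^ k := Finset.sum_range_succ _ _
    rw [this]; ring
  have ha2 : k = E.N ∨ ‖b i k + v‖ ≤ 2 * C := Or.inr ((norm_add_le _ _).trans (by
    linarith [hB.rad_le hi, H.fit.bound i k (hB.lt_of_nd hi)]))
  have hmem : ‖b i k + v - b i k‖ ≤ rad E c i k := by rwa [add_sub_cancel_left]
  rw [displacement_eq hP hB H.fit H.fit' hw hi ha2 hy,
    innerDisplacement_eq_zero hP hB H.fit hw hi ha2 hy, add_zero,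
    H.leafMap_of_mem (.refl _ _) hi hmem]
  · have : psum b' i (k + 1) w = psum b' i k w + b' i k * w ^ k := Finset.sum_range_succ _ _
    rw [this]; ring
  · intro j l hij hj hkl
    by_cases h1 : E.Agree i j (k + 1)
    · exact h j l h1 hj hkl
    · refine far_of_agree hB H.fit hw hi hy hij hj hkl ?_
      have h2 := H.fit.sep hP hB hi hj hkl.le hij.symm fun h => h1 h.symm
      have h3 : ‖b j k - b i k‖ ≤ ‖v‖ + ‖b i k + v - b j k‖ := by
        rw [show b j k - b i k = v - (b i k + v - b j k) by ring]
        exact norm_sub_le _ _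
      linarith

/-- The deformation translates the central disks. -/
theorem add_displacement_core (hik : M.IsNode i k) (hcore : M.HasCore i k) {u : ℂ}
    (hu : ‖u‖ ≤ c.α i k * ‖w‖ ^ k)
    (h : ∀ j l, E.Agree i j k → (∀ᶠ t in 𝓝 (0 : Param m), E.coeff j k t = 0) → M.Nd j l → k < l →
      (rad E c j l + τ) * ‖w‖ ^ l ≤ ‖psum b i k w + u - psum b j (l + 1) w‖) :
    psum b i k w + u + displacement M c τ L b b' w (psum b i k w + u) = psum b' i k w + u := by
  have hB := H.bounds
  have hτ := hB.τ_pos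
  have hi : M.Nd i k := Or.inr hik
  obtain ⟨v, rfl, hv⟩ : ∃ v, u = v * w ^ k ∧ ‖v‖ ≤ c.α i k := by
    by_cases hwk : w ^ k = 0
    · refine ⟨0, ?_, ?_⟩
      · rw [← norm_pow, hwk, norm_zero, mul_zero] at hu
        rw [norm_le_zero_iff.1 hu, zero_mul]
      · rw [norm_zero]; linarith [hB.α_ge i k hik]
    · refine ⟨u / w ^ k, (div_mul_cancel₀ _ hwk).symm, ?_⟩
      rw [norm_div, norm_pow]
      exact (div_le_iff₀ (by rw [← norm_pow]; exact norm_pos_iff.2 hwk)).2 hu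
  have ha2 : k = E.N ∨ ‖v‖ ≤ 2 * C := Or.inr (by linarith [hB.α_le i k hik, hB.C_pos])
  rw [displacement_eq hP hB H.fit H.fit' hw hi ha2 rfl,
    innerDisplacement_eq_zero hP hB H.fit hw hi ha2 rfl, add_zero,
    H.leafMap_of_norm_le hik hcore hv]
  intro j l hij hj hkl
  by_cases h1 : ∀ᶠ t in 𝓝 (0 : Param m), E.coeff j k t = 0
  · exact h j l hij h1 hj hkl
  · refine far_of_agree hB H.fit hw hi rfl hij hj hkl ?_
    have hj' : M.IsNode j l := hj.resolve_left (by have := hik.1; omega)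
    have h2 := H.fit.core i k j hik hcore ⟨⟨hik.1, hkl.le.trans hj'.2.1, h1⟩, hij⟩
    have h3 : ‖b j k‖ - ‖v‖ ≤ ‖v - b j k‖ := by rw [norm_sub_rev]; exact norm_sub_norm_le _ _
    linarith [hB.γ_ge i k hik]

end Close

end Carrousel

/-! ### A-pieces and D-pieces -/

namespace Carrousel

variable {m d : ℕ} {P : Param m → ℂ → ℂ[X]} {E : PuiseuxExpansion d P}
variable {M : Truncation E} {c : Constants d} {τ C κ : ℝ} {L : ℕ} {b b' : Fin d → ℕ → ℂ}
  {w y a u ζ : ℂ} {i j : Fin d} {k l : ℕ} {K : Disk d}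

namespace Disk

/-- The center of a disk for a system of coefficients. -/
noncomputable def ctr (E : PuiseuxExpansion d P) (b : Fin d → ℕ → ℂ) : Disk d → ℂ → ℂ
  | cone i => fun w => b i E.N * w ^ E.N
  | around i k => psum b i (k + 1)
  | core i k => psum b i k

theorem center_eq_ctr (t : Param m) : K.center E t = K.ctr E fun i l => E.coeff i l t := by
  cases K <;> rfl

theorem Valid.N_le_order (h : K.Valid M) : E.N ≤ K.order E := by
  cases K with
  | cone i => exact le_rfl
  | around i k => exact (show M.IsNode i k from h).1.le
  | core i k => exact h.1.1.le

theorem Valid.radius_ge (h : K.Valid M) (hB : Bounds M c τ C L) : 2 * τ ≤ K.radius c := by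
  cases K with
  | cone i => exact hB.η_ge
  | around i k => exact hB.γ_ge i k h
  | core i k => exact hB.α_ge i k h.1

theorem Enters.agree {j' : Fin d} (h : K.Enters E j) (h' : K.Enters E j') :
    E.Agree j j' (K.order E + 1) := by
  cases K with
  | cone i => exact PuiseuxExpansion.Agree.trans (PuiseuxExpansion.Agree.symm h) h'
  | around i k => exact PuiseuxExpansion.Agree.trans (PuiseuxExpansion.Agree.symm h) h'
  | core i k =>
    refine (h.1.symm.trans h'.1).succ ?_
    filter_upwards [h.2, h'.2] with t h1 h2
    rw [h1, h2]

theorem Enters.ctr_eq (h : K.Enters E j) (hK : K.Valid M) (hB : Bounds M c τ C L)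
    (F : Fit M c τ C L b) : K.ctr E b w = psum b j (K.order E + 1) w := by
  cases K with
  | cone i =>
    have h1 : psum b i (E.N + 1) w = psum b i E.N w + b i E.N * w ^ E.N := Finset.sum_range_succ _ _
    change b i E.N * w ^ E.N = psum b j (E.N + 1) w
    rw [F.psum_congr h hB.N_lt, h1, F.psum_N, zero_add]
  | around i k =>
    exact (F.psum_congr h ((show M.IsNode i k from hK).lt hB.last_lt)).symm
  | core i k =>
    have hk := hK.1.lt hB.last_lt
    have h1 : psum b j (k + 1) w = psum b j k w + b j k * w ^ k := Finset.sum_range_succ _ _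
    change psum b i k w = psum b j (k + 1) w
    rw [h1, F.zero j k hk h.2, zero_mul, add_zero, F.psum_congr h.1 hk.le]

end Disk

/-- No exponent between p and k' occurs in either series, so the center does not change up to k',
and y has a coefficient of modulus at least β there. The margin in β keeps it away from the
coefficient of the j-th series, and hence y from all smaller disks. -/
theorem far_from_next (hc : c.Admissible M) (hB : Bounds M c τ C L) (F : Fit M c τ C L b)
    (hw : ‖w‖ * (8 * (L + 2) * C) ≤ τ) {j₀ : Fin d} {p k' : ℕ} (hNp : E.N ≤ p) (hpk : p < k')
    (hj₀ : M.IsNode j₀ k') (h₀ : E.Agree j₀ j (p + 1))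
    (hgap₀ : ∀ l, p < l → l < k' → ¬ M.IsNode j₀ l)
    (hgap : ∀ l, p < l → l < k' → ¬ M.IsNode j l) (hj : M.IsNode j l) (hl : k' ≤ l)
    (hu : c.β j₀ k' * ‖w‖ ^ k' ≤ ‖y - psum b j (p + 1) w‖) :
    (rad E c j l + τ) * ‖w‖ ^ l ≤ ‖y - psum b j (l + 1) w‖ := by
  have hlL := hj.lt hB.last_lt
  have hτ := hB.τ_pos
  have hCpos := hB.C_pos
  rcases eq_or_ne w 0 with rfl | hw0
  · have hl0 : l ≠ 0 := by have := E.N_pos; omega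
    rw [norm_zero, zero_pow hl0, mul_zero]
    exact norm_nonneg _
  have hgz₀ : ∀ l, p < l → l < k' → ∀ᶠ t in 𝓝 (0 : Param m), E.coeff j₀ l t = 0 := by
    intro l' h1 h2
    by_contra h3
    exact hgap₀ l' h1 h2 ⟨by omega, h2.le.trans hj₀.2.1, h3⟩
  have hgz : ∀ l, p < l → l < k' → ∀ᶠ t in 𝓝 (0 : Param m), E.coeff j l t = 0 := by
    intro l' h1 h2
    by_contra h3
    exact hgap l' h1 h2 ⟨by omega, (h2.le.trans hl).trans hj.2.1, h3⟩
  have hagree : E.Agree j₀ j k' := by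
    intro l' hl'
    rcases Nat.lt_or_ge l' (p + 1) with h1 | h1
    · exact h₀ l' h1
    · filter_upwards [hgz₀ l' h1 hl', hgz l' h1 hl'] with t h2 h3
      rw [h2, h3]
  have hpk' : psum b j k' w = psum b j (p + 1) w := by
    rw [psum, psum, ← Finset.sum_range_add_sum_Ico _ (by omega : p + 1 ≤ k'),
      add_eq_left]
    refine Finset.sum_eq_zero fun l' hl' => ?_
    rw [Finset.mem_Ico] at hl'
    rw [F.zero j l' (by omega) (hgz l' (by omega) hl'.2), zero_mul]
  set v := (y - psum b j (p + 1) w) / w ^ k' - b j k' with hv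
  have hpow := pow_ne_zero k' hw0
  have hval : c.β j₀ k' ≤ ‖(y - psum b j (p + 1) w) / w ^ k'‖ := by
    rw [norm_div, norm_pow]
    exact (le_div_iff₀ (pow_pos (norm_pos_iff.2 hw0) _)).2 hu
  have hvn : c.β j₀ k' - ‖b j k'‖ ≤ ‖v‖ := by
    have : ‖(y - psum b j (p + 1) w) / w ^ k'‖ - ‖b j k'‖ ≤ ‖v‖ := norm_sub_norm_le _ _
    linarith
  have hdiff : ‖y - psum b j (l + 1) w - v * w ^ k'‖ ≤ (2 * L + 2) * C * ‖w‖ ^ (k' + 1) := by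
    have h1 := F.norm_psum_sub_le (i := j) hB hw (by omega : k' + 1 ≤ l + 1) (by omega)
    have e1 : psum b j (k' + 1) w = psum b j (p + 1) w + b j k' * w ^ k' := by
      rw [← hpk']; exact Finset.sum_range_succ _ _
    have e2 : y - psum b j (l + 1) w - v * w ^ k' = -(psum b j (l + 1) w - psum b j (k' + 1) w) := by
      rw [e1, hv, sub_mul, div_mul_cancel₀ _ hpow]; ring
    rw [e2, norm_neg]
    refine h1.trans (mul_le_mul_of_nonneg_right ?_ (by positivity))
    have : (0 : ℝ) ≤ L := Nat.cast_nonneg L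
    nlinarith
  have hβ₀ := F.beta j₀ k' j₀ hj₀ ⟨hj₀, .refl _ _⟩
  have hγ₀ := hB.γ_ge j₀ k' hj₀
  rcases hl.eq_or_lt with rfl | hl
  · refine hB.far_of_eq hw hdiff ?_
    have h1 := F.beta j₀ k' j hj₀ ⟨hj, hagree⟩
    have h2 := rad_eq hc hagree (Or.inr hj₀) (Or.inr hj)
    have h3 : rad E c j₀ k' = c.γ j₀ k' := if_neg hj₀.1.ne'
    linarith
  · refine hB.far_of_lt hw (hB.rad_le (Or.inr hj)) hl hdiff ?_
    by_cases h1 : M.IsNode j k'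
    · linarith [F.beta j₀ k' j hj₀ ⟨h1, hagree⟩]
    · have h2 : ∀ᶠ t in 𝓝 (0 : Param m), E.coeff j k' t = 0 := by
        by_contra h3
        exact h1 ⟨hj₀.1, hl.le.trans hj.2.1, h3⟩
      rw [F.zero j k' (hj₀.lt hB.last_lt) h2, norm_zero] at hvn
      linarith [norm_nonneg (b j₀ k')]

namespace Close

variable (H : Close M c τ C κ L b b') (hP : IsEquisingularFamily d P)
  (hw : ‖w‖ * (8 * (L + 2) * C) ≤ τ)
include H hP hw

theorem add_displacement_disk (hK : K.Valid M) (hu : ‖u‖ ≤ K.radius c * ‖w‖ ^ K.order E)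
    (h : ∀ j l, K.Enters E j → M.Nd j l → K.order E < l →
      (rad E c j l + τ) * ‖w‖ ^ l ≤ ‖K.ctr E b w + u - psum b j (l + 1) w‖) :
    K.ctr E b w + u + displacement M c τ L b b' w (K.ctr E b w + u) = K.ctr E b' w + u := by
  cases K with
  | cone i =>
    have hent : (Disk.cone i : Disk d).Enters E i := PuiseuxExpansion.Agree.refl _ _
    have e1 := hent.ctr_eq (w := w) hK H.bounds H.fit
    have e2 := hent.ctr_eq (w := w) hK H.bounds H.fit'
    simp only [e1] at h
    rw [e1, e2]
    refine H.add_displacement_around hP hw (Or.inl rfl) ?_ h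
    rw [rad, if_pos rfl]
    exact hu
  | around i k =>
    have hik : M.IsNode i k := hK
    refine H.add_displacement_around hP hw (Or.inr hik) ?_ h
    rw [rad, if_neg hik.1.ne']
    exact hu
  | core i k =>
    exact H.add_displacement_core hP hw hK.1 hK.2 hu fun j l h1 h2 => h j l ⟨h1, h2⟩

theorem add_displacement_D (hK : K.Valid M) (hK' : ¬ ∃ j k', K.IsNext M j k')
    (hu : ‖u‖ ≤ K.radius c * ‖w‖ ^ K.order E) :
    K.ctr E b w + u + displacement M c τ L b b' w (K.ctr E b w + u) = K.ctr E b' w + u := by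
  classical
  refine H.add_displacement_disk hP hw hK hu fun j l hj hjl hl => absurd ?_ hK'
  have hjl' : M.IsNode j l := hjl.resolve_left (by have := hK.N_le_order; omega)
  -- A smaller disk inside would yield, at the least exponent that occurs, a next pair.
  have hex : ∃ k', ∃ j, K.Enters E j ∧ M.IsNode j k' ∧ K.order E < k' := ⟨l, j, hj, hjl', hl⟩
  obtain ⟨j', h1, h2, h3⟩ := Nat.find_spec hex
  exact ⟨j', Nat.find hex, h1, h2, h3, fun j'' k'' h4 h5 h6 => Nat.find_min' hex ⟨j'', h4, h5, h6⟩⟩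

theorem add_displacement_A (hK : K.Valid M) {j₀ : Fin d} {k' : ℕ} (hnext : K.IsNext M j₀ k')
    (hu : ‖u‖ ≤ K.radius c * ‖w‖ ^ K.order E) (hu' : c.β j₀ k' * ‖w‖ ^ k' ≤ ‖u‖) :
    K.ctr E b w + u + displacement M c τ L b b' w (K.ctr E b w + u) = K.ctr E b' w + u := by
  refine H.add_displacement_disk hP hw hK hu fun j l hj hjl hl => ?_
  have hNo := hK.N_le_order
  have hjl' : M.IsNode j l := hjl.resolve_left (by omega)
  obtain ⟨h1, h2, h3, h4⟩ := hnext
  refine far_from_next H.adm H.bounds H.fit hw hNo h3 h2 (h1.agree hj)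
    (fun l hl hl' h => absurd (h4 j₀ l h1 h hl) hl'.not_ge)
    (fun l hl hl' h => absurd (h4 j l hj h hl) hl'.not_ge) hjl' (h4 j l hj hjl' hl) ?_
  rw [hj.ctr_eq hK H.bounds H.fit, add_sub_cancel_left]
  exact hu'

end Close

/-! ### Independence of the determination -/

theorem PuiseuxExpansion.agree_conj_iff (hζ : ζ ^ E.N = 1) {σ : Equiv.Perm (Fin d)}
    (hσ : ∀ i, ∀ᶠ q in 𝓝 (0 : Param m × ℂ), E.root (σ i) q.1 q.2 = E.root i q.1 (ζ * q.2)) :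
    E.Agree (σ i) (σ j) k ↔ E.Agree i j k := by
  have hζ0 : ζ ≠ 0 := by
    rintro rfl
    rw [zero_pow E.N_pos.ne'] at hζ
    exact zero_ne_one hζ
  refine forall₂_congr fun l _ => ⟨fun h => ?_, fun h => ?_⟩
  · filter_upwards [h, coeff_conj hζ (hσ i) l, coeff_conj hζ (hσ j) l] with t h1 h2 h3
    rw [h2, h3] at h1
    exact mul_left_cancel₀ (pow_ne_zero _ hζ0) h1
  · filter_upwards [h, coeff_conj hζ (hσ i) l, coeff_conj hζ (hσ j) l] with t h1 h2 h3
    rw [h2, h3, h1]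

theorem Truncation.isNode_conj_iff (hζ : ζ ^ E.N = 1)
    (hj : ∀ᶠ q in 𝓝 (0 : Param m × ℂ), E.root j q.1 q.2 = E.root i q.1 (ζ * q.2)) :
    M.IsNode j k ↔ M.IsNode i k := by
  have hζ0 : ζ ≠ 0 := by
    rintro rfl
    rw [zero_pow E.N_pos.ne'] at hζ
    exact zero_ne_one hζ
  unfold IsNode
  rw [M.conj i j ζ hζ hj]
  refine and_congr_right fun _ => and_congr_right fun _ => not_congr ?_
  constructor <;> intro h
  · filter_upwards [h, PuiseuxExpansion.coeff_conj hζ hj k] with t h1 h2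
    rw [h2] at h1
    exact (mul_eq_zero.1 h1).resolve_left (pow_ne_zero _ hζ0)
  · filter_upwards [h, PuiseuxExpansion.coeff_conj hζ hj k] with t h1 h2
    rw [h2, h1, mul_zero]

/-- The summand of σ j at w equals that of j at ζ w: the factor ζ ^ l moves from the coefficient to
the argument of the bump. Truncation and radii are the same for both determinations, so reindexing
by σ gives the claim. -/
theorem Close.displacement_mul (H : Close M c τ C κ L b b') (hP : IsEquisingularFamily d P)
    (hζ : ζ ^ E.N = 1) (w y : ℂ) :
    displacement M c τ L b b' (ζ * w) y = displacement M c τ L b b' w y := by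
  classical
  obtain ⟨σ, hσ⟩ := E.exists_conj hP hζ
  have hζn : ‖ζ‖ = 1 := Complex.norm_eq_one_of_pow_eq_one hζ E.N_pos.ne'
  refine Finset.sum_congr rfl fun l hl => ?_
  have hl := Finset.mem_range.1 hl
  symm
  rw [← Equiv.sum_comp σ]
  refine Finset.sum_congr rfl fun j _ => ?_
  have hnd : ∀ i, M.Nd (σ i) l ↔ M.Nd i l := fun i =>
    or_congr_right (Truncation.isNode_conj_iff hζ (hσ i))
  have hcard : (cls M (σ j) l).card = (cls M j l).card := by
    have : cls M (σ j) l = (cls M j l).map σ.toEmbedding := by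
      ext j'
      obtain ⟨j', rfl⟩ := σ.surjective j'
      rw [Finset.mem_map_equiv, Equiv.symm_apply_apply, mem_cls, mem_cls, hnd,
        PuiseuxExpansion.agree_conj_iff hζ hσ]
    rw [this, Finset.card_map]
  have hpsum : psum b (σ j) (l + 1) w = psum b j (l + 1) (ζ * w) :=
    Finset.sum_congr rfl fun l' hl' => by
      rw [H.fit.conj j (σ j) ζ hζ (hσ j) l' (by have := Finset.mem_range.1 hl'; omega), mul_pow]
      ring
  unfold bumpTerm
  by_cases h : M.Nd j l
  · rw [if_pos ((hnd j).2 h), if_pos h, hcard, hpsum, H.fit.conj j (σ j) ζ hζ (hσ j) l hl,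
      H.fit'.conj j (σ j) ζ hζ (hσ j) l hl, mul_pow,
      bump_mul_mul (by rw [norm_pow, hζn, one_pow])]
    have hrad : rad E c (σ j) l = rad E c j l := by
      unfold rad
      split_ifs with hlN
      · rfl
      · refine (H.adm.well_defined j (σ j) l (h.resolve_left hlN)
          (((hnd j).2 h).resolve_left hlN) ⟨ζ, hζ, fun l' _ => ?_⟩).2.2.symm
        exact PuiseuxExpansion.coeff_conj hζ (hσ j) l'
    rw [hrad]
    ring
  · rw [if_neg (fun h' => h ((hnd j).1 h')), if_neg h]

end Carrousel

/-! ### Bijectivity on fibers; the ball, the conical piece and the cones -/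

namespace Carrousel

variable {m d : ℕ} {P : Param m → ℂ → ℂ[X]} {E : PuiseuxExpansion d P}
variable {M : Truncation E} {c : Constants d} {τ C κ : ℝ} {L : ℕ} {b b' : Fin d → ℕ → ℂ}
  {w y a u ζ : ℂ} {i j : Fin d} {k l : ℕ} {K : Disk d}

theorem displacement_zero_left (y : ℂ) : displacement M c τ L b b' 0 y = 0 := by
  refine Finset.sum_eq_zero fun l _ => Finset.sum_eq_zero fun j _ => ?_
  unfold bumpTerm
  split_ifs with h
  · have hl : l ≠ 0 := by
      rcases h with rfl | h
      · exact E.N_pos.ne'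
      · have := h.1; omega
    rw [zero_pow hl, bump_zero_right, mul_zero]
  · rfl

namespace Close

variable (H : Close M c τ C κ L b b')
include H

theorem norm_displacement_sub_le (w y y' : ℂ) :
    ‖displacement M c τ L b b' w y - displacement M c τ L b b' w y'‖ ≤ 1 / 2 * ‖y - y'‖ := by
  have hB := H.bounds
  have hτ := hB.τ_pos
  have h1 : ∀ j l, ‖bumpTerm M c τ b b' w y j l - bumpTerm M c τ b b' w y' j l‖ ≤
      κ * (‖y - y'‖ / τ) := by
    intro j l
    unfold bumpTerm
    split_ifs with h
    · rw [← mul_sub, norm_mul, norm_mul]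
      refine mul_le_mul ?_ ?_ (norm_nonneg _) H.κ_nonneg
      · exact (mul_le_mul (norm_card_inv_le _) (H.close j l (hB.lt_of_nd h)) (norm_nonneg _)
          zero_le_one).trans (one_mul κ).le
      · have := norm_bump_sub_le (u := y - psum b j (l + 1) w) (u' := y' - psum b j (l + 1) w)
          (z := w ^ l) (z' := w ^ l) hτ (by linarith [hB.rad_ge h] : 0 ≤ rad E c j l)
        simpa using this
    · rw [sub_zero, norm_zero]
      exact mul_nonneg H.κ_nonneg (by positivity)
  rw [displacement, displacement, ← Finset.sum_sub_distrib]
  have h2 : ∀ l ∈ Finset.range L, ‖∑ j, bumpTerm M c τ b b' w y j l -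
      ∑ j, bumpTerm M c τ b b' w y' j l‖ ≤ d * (κ * (‖y - y'‖ / τ)) := by
    intro l _
    rw [← Finset.sum_sub_distrib]
    refine (norm_sum_le_of_le _ fun j _ => h1 j l).trans (le_of_eq ?_)
    simp
  refine (norm_sum_le_of_le _ h2).trans ?_
  rw [Finset.sum_const, nsmul_eq_mul, Finset.card_range]
  calc (L : ℝ) * (d * (κ * (‖y - y'‖ / τ))) = (L * (d * κ) / τ) * ‖y - y'‖ := by ring
    _ ≤ 1 / 2 * ‖y - y'‖ := by
      refine mul_le_mul_of_nonneg_right ?_ (norm_nonneg _)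
      rw [div_le_iff₀ hτ]
      linarith [H.small]

theorem add_displacement_bijective (w : ℂ) :
    Function.Bijective fun y => y + displacement M c τ L b b' w y :=
  bijective_add_of_contraction (K := 1 / 2) (by norm_num) (H.norm_displacement_sub_le w)

variable (hP : IsEquisingularFamily d P)
include hP

/-- The action of the deformation on lines through the origin. -/
theorem exists_lineMap : ∃ g : ℂ → ℂ, Function.Bijective g ∧
    (∀ a j, ‖g a - b' j E.N‖ < c.η ↔ ‖a - b j E.N‖ < c.η) ∧
    (∀ a j, ‖a - b j E.N‖ ≤ c.η → g a = a - b j E.N + b' j E.N) ∧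
    (∀ a, c.R ≤ ‖a‖ → g a = a ∧ ∀ j, τ ≤ ‖a - b j E.N‖) ∧
    (∀ w : ℂ, ‖w‖ * (8 * (L + 2) * C) ≤ τ → ∀ a,
      ‖a * w ^ E.N + displacement M c τ L b b' w (a * w ^ E.N) - g a * w ^ E.N‖ ≤
        τ * ‖w ^ E.N‖ ∧
      ((∀ j, τ ≤ ‖a - b j E.N‖) →
        a * w ^ E.N + displacement M c τ L b b' w (a * w ^ E.N) = g a * w ^ E.N)) := by
  have hτ := H.bounds.τ_pos
  -- `leafMap` needs the index of some series; without any series nothing moves. Otherwise the index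
  -- is irrelevant, because all series agree below N.
  by_cases hd : d = 0
  · subst hd
    have h0 : ∀ w y, displacement M c τ L b b' w y = 0 := fun w y => by simp [displacement]
    refine ⟨id, Function.bijective_id, fun _ j => j.elim0, fun _ j => j.elim0,
      fun a _ => ⟨rfl, fun j => j.elim0⟩, fun w _ a => ⟨?_, fun _ => ?_⟩⟩
    · rw [h0, add_zero, id, sub_self, norm_zero]; positivity
    · rw [h0, add_zero, id]
  · set i : Fin d := ⟨0, Nat.pos_of_ne_zero hd⟩
    have hN : ∀ j, E.Agree i j E.N := fun j => PuiseuxExpansion.agree_N hP i j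
    have hr : ∀ j, rad E c j E.N = c.η := fun j => if_pos rfl
    refine ⟨leafMap M c τ b b' i E.N, H.leafMap_bijective, fun a j => ?_, fun a j h => ?_,
      fun a h => ⟨H.leafMap_of_R_le_norm h, fun j => ?_⟩,
      fun w hw a => ⟨H.norm_add_displacement_sub_le hP hw i a, H.add_displacement_line hP hw i⟩⟩
    · rw [← hr j]; exact H.leafMap_sub_lt_iff (hN j) (Or.inl rfl)
    · exact H.leafMap_of_mem (hN j) (Or.inl rfl) (by rwa [hr j])
    · have h1 := H.fit.cones_le j
      have h2 : ‖a‖ - ‖b j E.N‖ ≤ ‖a - b j E.N‖ := norm_sub_norm_le _ _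
      linarith [H.bounds.η_ge]

theorem displacement_of_R_le (hw : ‖w‖ * (8 * (L + 2) * C) ≤ τ) (hy : c.R * ‖w ^ E.N‖ ≤ ‖y‖) :
    displacement M c τ L b b' w y = 0 := by
  rcases eq_or_ne w 0 with rfl | hw0
  · exact displacement_zero_left y
  obtain ⟨g, -, -, -, hg, hg'⟩ := H.exists_lineMap hP
  have hpow := pow_ne_zero E.N hw0
  have ha : c.R ≤ ‖y / w ^ E.N‖ := by
    rw [norm_div]; exact (le_div_iff₀ (norm_pos_iff.2 hpow)).2 hy
  have h1 := (hg' w hw (y / w ^ E.N)).2 (hg _ ha).2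
  rw [(hg _ ha).1, div_mul_cancel₀ _ hpow] at h1
  exact add_eq_left.1 h1

/-- All points with |y| ≥ R |x| are fixed, so an injective map cannot carry other points among them.
-/
theorem norm_le_iff {r : ℝ} (hw : ‖w‖ * (8 * (L + 2) * C) ≤ τ) (hr : c.R * ‖w ^ E.N‖ ≤ r) :
    ‖y + displacement M c τ L b b' w y‖ ≤ r ↔ ‖y‖ ≤ r := by
  have h1 := mem_iff_of_fixed (H.add_displacement_bijective w).1 (F := {v | r < ‖v‖})
    (fun v hv => by
      show v + displacement M c τ L b b' w v = v
      rw [H.displacement_of_R_le hP hw (hr.trans (le_of_lt hv)), add_zero]) y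
  simp only [Set.mem_ofPred_eq] at h1
  rw [← not_lt, h1, not_lt]

theorem conical_iff (hw : ‖w‖ * (8 * (L + 2) * C) ≤ τ) :
    (∀ j, c.η * ‖w ^ E.N‖ ≤ ‖y + displacement M c τ L b b' w y - b' j E.N * w ^ E.N‖) ↔
      ∀ j, c.η * ‖w ^ E.N‖ ≤ ‖y - b j E.N * w ^ E.N‖ := by
  have hB := H.bounds
  rcases eq_or_ne w 0 with rfl | hw0
  · simp [E.N_pos.ne']
  obtain ⟨g, hg, hg1, -, -, hg4⟩ := H.exists_lineMap hP
  have hpow := pow_ne_zero E.N hw0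
  have hpos := norm_pos_iff.2 hpow
  have key : ∀ a v : ℂ, c.η * ‖w ^ E.N‖ ≤ ‖a * w ^ E.N - v * w ^ E.N‖ ↔ c.η ≤ ‖a - v‖ := by
    intro a v
    rw [← sub_mul, norm_mul, mul_le_mul_iff_left₀ hpos]
  have hfar : ∀ a, (∀ j, c.η ≤ ‖a - b j E.N‖) → ∀ j, τ ≤ ‖a - b j E.N‖ := fun a h j => by
    linarith [h j, hB.η_ge, hB.τ_pos]
  have hmem : ∀ a, (∀ j, c.η ≤ ‖g a - b' j E.N‖) ↔ ∀ j, c.η ≤ ‖a - b j E.N‖ := fun a =>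
    forall_congr' fun j => by rw [← not_lt, hg1, not_lt]
  obtain ⟨a, rfl⟩ : ∃ a, y = a * w ^ E.N := ⟨y / w ^ E.N, (div_mul_cancel₀ _ hpow).symm⟩
  constructor
  · intro h
    -- A line of the conical piece through the image has a preimage line under g; injectivity on the
    -- fiber shows that the given point lies on it.
    obtain ⟨a', ha'⟩ : ∃ a', a * w ^ E.N + displacement M c τ L b b' w (a * w ^ E.N) =
      a' * w ^ E.N := ⟨_, (div_mul_cancel₀ _ hpow).symm⟩
    obtain ⟨a₂, rfl⟩ := hg.2 a'
    simp only [ha', key] at h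
    have h2 := (hmem a₂).1 h
    have h3 := (hg4 w hw a₂).2 (hfar a₂ h2)
    have h4 := (H.add_displacement_bijective w).1 (ha'.trans h3.symm)
    rw [h4]
    simpa only [key] using h2
  · intro h
    simp only [key] at h
    rw [(hg4 w hw a).2 (hfar a h)]
    simp only [key]
    exact (hmem a).2 h

theorem cone_iff (hw : ‖w‖ * (8 * (L + 2) * C) ≤ τ) (j : Fin d) :
    ‖y + displacement M c τ L b b' w y - b' j E.N * w ^ E.N‖ ≤ c.η * ‖w ^ E.N‖ ↔
      ‖y - b j E.N * w ^ E.N‖ ≤ c.η * ‖w ^ E.N‖ := by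
  have hB := H.bounds
  have hτ := hB.τ_pos
  have hη := hB.η_ge
  rcases eq_or_ne w 0 with rfl | hw0
  · rw [displacement_zero_left]; simp [E.N_pos.ne']
  obtain ⟨g, hg, hg1, hg2, -, hg4⟩ := H.exists_lineMap hP
  have hpow := pow_ne_zero E.N hw0
  have hpos := norm_pos_iff.2 hpow
  have key : ∀ a v : ℂ, ‖a * w ^ E.N - v * w ^ E.N‖ ≤ c.η * ‖w ^ E.N‖ ↔ ‖a - v‖ ≤ c.η := by
    intro a v
    rw [← sub_mul, norm_mul, mul_le_mul_iff_left₀ hpos]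
  have fwd : ∀ a j, ‖a - b j E.N‖ ≤ c.η →
      ‖a * w ^ E.N + displacement M c τ L b b' w (a * w ^ E.N) - b' j E.N * w ^ E.N‖ ≤
        c.η * ‖w ^ E.N‖ := by
    intro a j ha
    obtain ⟨h1, h2⟩ := hg4 w hw a
    have h3 := hg2 a j ha
    -- Near the axis of the cone the smaller disks may bend the lines, but there the error and the
    -- distance of g a from the new axis are each at most τ, and 2 τ ≤ η.
    by_cases h4 : τ ≤ ‖a - b j E.N‖
    · rw [h2, key, h3, add_sub_cancel_right]
      · exact ha
      · intro j'
        by_cases h5 : E.Agree j j' (E.N + 1)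
        · rwa [H.fit.agree j j' E.N hB.N_lt h5]
        · have h6 := H.fit.cones j j' h5
          have h7 : ‖b j E.N - b j' E.N‖ ≤ ‖a - b j' E.N‖ + ‖a - b j E.N‖ := by
            rw [show b j E.N - b j' E.N = (a - b j' E.N) - (a - b j E.N) by ring]
            exact norm_sub_le _ _
          linarith
    · have h5 : ‖g a * w ^ E.N - b' j E.N * w ^ E.N‖ ≤ τ * ‖w ^ E.N‖ := by
        rw [← sub_mul, norm_mul, h3, add_sub_cancel_right]
        exact mul_le_mul_of_nonneg_right (not_le.1 h4).le hpos.le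
      refine (norm_sub_le_norm_sub_add_norm_sub _ (g a * w ^ E.N) _).trans
        ((add_le_add h1 h5).trans ?_)
      rw [← add_mul]
      exact mul_le_mul_of_nonneg_right (by linarith) hpos.le
  obtain ⟨a, rfl⟩ : ∃ a, y = a * w ^ E.N := ⟨y / w ^ E.N, (div_mul_cancel₀ _ hpow).symm⟩
  constructor
  · intro h
    rw [key]
    by_contra h1
    rw [not_le] at h1
    -- A point outside the j-th cone lies in another cone, whose image is disjoint from the j-th
    -- cone away from the origin, or outside all cones, where lines are mapped exactly by the
    -- injective g.
    by_cases h2 : ∃ j', ‖a - b j' E.N‖ ≤ c.η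
    · obtain ⟨j', hj'⟩ := h2
      have h3 := fwd a j' hj'
      have h4 : ¬ E.Agree j j' (E.N + 1) := by
        intro h5
        rw [H.fit.agree j j' E.N hB.N_lt h5] at hj'
        linarith
      have h5 := H.fit'.cones j j' h4
      have h6 : ‖b' j E.N * w ^ E.N - b' j' E.N * w ^ E.N‖ ≤ 2 * c.η * ‖w ^ E.N‖ := by
        refine (norm_sub_le_norm_sub_add_norm_sub _
          (a * w ^ E.N + displacement M c τ L b b' w (a * w ^ E.N)) _).trans ?_
        rw [norm_sub_rev (b' j E.N * w ^ E.N)]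
        linarith
      rw [← sub_mul, norm_mul, mul_le_mul_iff_left₀ hpos] at h6
      linarith
    · push Not at h2
      obtain ⟨-, h3⟩ := hg4 w hw a
      rw [h3 fun j' => by linarith [h2 j'], key] at h
      set v := g a - b' j E.N + b j E.N with hv
      have h4 : v - b j E.N = g a - b' j E.N := by rw [hv]; ring
      have h5 := hg2 v j (by rw [h4]; exact h)
      rw [h4, sub_add_cancel] at h5
      have h6 := hg.1 h5
      rw [← h6, h4] at h1
      linarith
  · intro h
    rw [key] at h
    exact fwd a j h

end Close

end Carrousel

/-! ### Images of pieces and leaves -/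

namespace Carrousel

variable {m d : ℕ} {P : Param m → ℂ → ℂ[X]} {E : PuiseuxExpansion d P}
variable {M : Truncation E} {c : Constants d} {τ C κ ε : ℝ} {L : ℕ} {b b' : Fin d → ℕ → ℂ}
  {w y a u ζ : ℂ} {i j : Fin d} {k l : ℕ} {K : Disk d} {t t' : Param m}

/-- The deformation of the plane. -/
noncomputable def deform (M : Truncation E) (c : Constants d) (τ : ℝ) (L : ℕ)
    (b b' : Fin d → ℕ → ℂ) (p : ℂ × ℂ) : ℂ × ℂ :=
  (p.1, p.2 + displacement M c τ L b b' (p.1 ^ ((E.N : ℂ)⁻¹)) p.2)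

/-- The deformation that carries the carrousel for `Δ_t` to the one for `Δ_t'`. -/
noncomputable abbrev carry (M : Truncation E) (c : Constants d) (τ : ℝ) (L : ℕ) (t t' : Param m) :
    ℂ × ℂ → ℂ × ℂ :=
  deform M c τ L (fun i l => E.coeff i l t) (fun i l => E.coeff i l t')

/-- The bounds that make an immersed leaf stay in its piece. -/
theorem leaf_bounds {ρ β s x : ℝ} (hτ : 0 < τ) (hρ : τ ≤ ρ) (hβ : 0 ≤ β) (hβC : β ≤ C)
    (hs : 0 ≤ s) (hs1 : s ≤ 1) (hx : x ≤ -(C / τ)) :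
    ((1 - s) * ρ + s * β) * Real.exp (s * x) ≤ ρ ∧
      β * Real.exp ((1 - s) * x) ≤ (1 - s) * ρ + s * β := by
  have hρ0 : 0 < ρ := hτ.trans_le hρ
  have hC : 0 ≤ C := hβ.trans hβC
  constructor
  · have h1 : (1 - s) * ρ + s * β ≤ ρ * Real.exp (s * (C / τ)) := by
      have h2 : s * (C / τ) + 1 ≤ Real.exp (s * (C / τ)) := Real.add_one_le_exp _
      have h3 : β ≤ ρ * (C / τ) := by
        rw [mul_div_assoc', le_div_iff₀ hτ]
        nlinarith
      have h4 : (1 - s) * ρ + s * β ≤ ρ * (s * (C / τ) + 1) := by nlinarith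
      exact h4.trans (mul_le_mul_of_nonneg_left h2 hρ0.le)
    calc _ ≤ ρ * Real.exp (s * (C / τ)) * Real.exp (s * x) :=
          mul_le_mul_of_nonneg_right h1 (Real.exp_pos _).le
      _ = ρ * Real.exp (s * (C / τ + x)) := by rw [mul_assoc, ← Real.exp_add]; ring_nf
      _ ≤ ρ * 1 := by
          refine mul_le_mul_of_nonneg_left (Real.exp_le_one_iff.2 ?_) hρ0.le
          exact mul_nonpos_of_nonneg_of_nonpos hs (by linarith)
      _ = ρ := mul_one _
  · have h1 : Real.exp ((1 - s) * x) ≤ Real.exp ((1 - s) * -(C / τ)) :=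
      Real.exp_le_exp.2 (mul_le_mul_of_nonneg_left hx (by linarith))
    have h2 : Real.exp ((1 - s) * -(C / τ)) ≤ (1 - s) * Real.exp (-(C / τ)) + s := by
      have := convexOn_exp.2 (Set.mem_univ (-(C / τ))) (Set.mem_univ 0)
        (by linarith : 0 ≤ 1 - s) hs (by ring)
      simpa using this
    have h3 : β * Real.exp (-(C / τ)) ≤ ρ := by
      rw [Real.exp_neg, ← div_eq_mul_inv, div_le_iff₀ (Real.exp_pos _)]
      have h4 := Real.add_one_le_exp (C / τ)
      have h5 : C = τ * (C / τ) := (mul_div_cancel₀ _ hτ.ne').symm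
      nlinarith [Real.exp_pos (C / τ)]
    nlinarith

theorem Fit.psum_zero (F : Fit M c τ C L b) : psum b i k 0 = 0 :=
  Finset.sum_eq_zero fun l _ => by
    rcases Nat.eq_zero_or_pos l with rfl | hl
    · rw [F.low i 0 E.N_pos, zero_mul]
    · rw [zero_pow hl.ne', mul_zero]

/-- At w = 0 all the curves pass through the origin, so a is restricted only for w ≠ 0; otherwise
the origin would require `leafSet` to be nonempty. -/
theorem carrier_B_eq (hik : M.IsNode i k) (t : Param m) :
    (Piece.B i k).carrier M c ε t = {p | ‖p.1‖ ≤ ε ∧ ∃ w, w ^ E.N = p.1 ∧ ∃ a,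
      (w ≠ 0 → a ∈ leafSet M c i k fun i l => E.coeff i l t) ∧
        p.2 = psum (fun i l => E.coeff i l t) i k w + a * w ^ k} := by
  ext p
  refine and_congr_right fun _ => exists_congr fun w => and_congr_right fun _ => ?_
  have hk : k ≠ 0 := by have := hik.1; omega
  have hps : E.partialSum i k t w = psum (fun i l => E.coeff i l t) i k w := rfl
  rw [hps]
  set S := psum (fun i l => E.coeff i l t) i k w
  rcases eq_or_ne w 0 with rfl | hw
  · simp only [norm_zero, zero_pow hk, mul_zero, norm_nonneg, implies_true, and_true, add_zero,
      ne_eq, not_true_eq_false, false_imp_iff, true_and, exists_const, norm_le_zero_iff, sub_eq_zero]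
  · have hpow : 0 < ‖w‖ ^ k := pow_pos (norm_pos_iff.2 hw) k
    have key : ∀ a : ℂ, (‖S + a * w ^ k - S‖ ≤ c.β i k * ‖w‖ ^ k ∧
        (M.HasCore i k → c.α i k * ‖w‖ ^ k ≤ ‖S + a * w ^ k - S‖) ∧
        ∀ j, M.Fits i k j →
          c.γ i k * ‖w‖ ^ k ≤ ‖S + a * w ^ k - (S + E.coeff j k t * w ^ k)‖) ↔
        a ∈ leafSet M c i k fun i l => E.coeff i l t := by
      intro a
      refine and_congr ?_ (and_congr (forall_congr' fun _ => ?_) (forall₂_congr fun j _ => ?_))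
      · rw [add_sub_cancel_left, norm_mul, norm_pow, mul_le_mul_iff_left₀ hpow]
      · rw [add_sub_cancel_left, norm_mul, norm_pow, mul_le_mul_iff_left₀ hpow]
      · rw [add_sub_add_left_eq_sub, ← sub_mul, norm_mul, norm_pow, mul_le_mul_iff_left₀ hpow]
    constructor
    · intro h
      have hp : p.2 = S + (p.2 - S) / w ^ k * w ^ k := by
        rw [div_mul_cancel₀ _ (pow_ne_zero k hw), add_sub_cancel]
      refine ⟨_, fun _ => ?_, hp⟩
      rw [hp] at h
      exact (key _).1 h
    · rintro ⟨a, ha, hp⟩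
      rw [hp]
      exact (key a).2 (ha hw)

namespace Close

section

variable (H : Close M c τ C κ L b b') (hP : IsEquisingularFamily d P)
include H hP

/-- By `Close.displacement_mul` the principal root in the definition can be replaced by any root of
x, such as the one in the equation of a piece. -/
theorem deform_apply {x : ℂ} (hw : w ^ E.N = x) (y : ℂ) :
    deform M c τ L b b' (x, y) = (x, y + displacement M c τ L b b' w y) := by
  have h1 : (x ^ ((E.N : ℂ)⁻¹)) ^ E.N = x := Complex.cpow_nat_inv_pow x E.N_pos.ne'
  set v := x ^ ((E.N : ℂ)⁻¹) with hv
  have h2 : displacement M c τ L b b' v y = displacement M c τ L b b' w y := by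
    rcases eq_or_ne w 0 with rfl | hw0
    · rw [zero_pow E.N_pos.ne'] at hw
      rw [← hw] at h1
      rw [eq_zero_of_pow_eq_zero h1]
    · rw [← H.displacement_mul hP (ζ := v / w) (by
        rw [div_pow, h1, ← hw, div_self (pow_ne_zero _ hw0)]) w y, div_mul_cancel₀ _ hw0]
  rw [deform]
  simp only
  rw [← hv, h2]

theorem image_deform {S S' : Set (ℂ × ℂ)}
    (h : ∀ p ∈ S, ∃ w, w ^ E.N = p.1 ∧ (p.1, p.2 + displacement M c τ L b b' w p.2) ∈ S')
    (h' : ∀ p ∈ S', ∃ w y, w ^ E.N = p.1 ∧ y + displacement M c τ L b b' w y = p.2 ∧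
      (p.1, y) ∈ S) : deform M c τ L b b' '' S = S' := by
  ext p
  constructor
  · rintro ⟨⟨x, y⟩, hq, rfl⟩
    obtain ⟨w, hw, h1⟩ := h _ hq
    rw [H.deform_apply hP hw]
    exact h1
  · intro hp
    obtain ⟨w, y, hw, hy, h1⟩ := h' p hp
    refine ⟨_, h1, ?_⟩
    rw [H.deform_apply hP hw, hy]

theorem image_deform_of_iff {S S' : Set (ℂ × ℂ)}
    (h : ∀ w y, (w ^ E.N, y + displacement M c τ L b b' w y) ∈ S' ↔ (w ^ E.N, y) ∈ S) :
    deform M c τ L b b' '' S = S' := by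
  have hroot : ∀ x : ℂ, ∃ w, w ^ E.N = x := fun x =>
    ⟨_, Complex.cpow_nat_inv_pow x E.N_pos.ne'⟩
  refine H.image_deform hP (fun p hp => ?_) fun p hp => ?_
  · obtain ⟨w, hw⟩ := hroot p.1
    refine ⟨w, hw, ?_⟩
    rw [← hw, h, hw]
    exact hp
  · obtain ⟨w, hw⟩ := hroot p.1
    obtain ⟨y, hy⟩ := (H.add_displacement_bijective w).2 p.2
    refine ⟨w, y, hw, hy, ?_⟩
    have hy : y + displacement M c τ L b b' w y = p.2 := hy
    rw [← hw, ← h, hy, hw]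
    exact hp

end

variable (H : Close M c τ C κ L (fun i l => E.coeff i l t) (fun i l => E.coeff i l t'))
  (hP : IsEquisingularFamily d P)
  (hε : ∀ w : ℂ, ‖w‖ ^ E.N ≤ ε → ‖w‖ * (8 * (L + 2) * C) ≤ τ ∧ ‖w‖ ≤ Real.exp (-(C / τ)))

include H hP

/-- Sets swept out by curves. -/
theorem image_curves {S : Type*} {Q Q' : ℂ → S → Prop} {g : S → S} {f f' : ℂ → S → ℂ}
    (h : ∀ w s, ‖w‖ ^ E.N ≤ ε → Q w s → Q' w (g s) ∧ f w s +
      displacement M c τ L (fun i l => E.coeff i l t) (fun i l => E.coeff i l t') w (f w s) =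
        f' w (g s))
    (h' : ∀ w s', Q' w s' → ∃ s, Q w s ∧ g s = s') :
    carry M c τ L t t' '' {p | ‖p.1‖ ≤ ε ∧ ∃ w, w ^ E.N = p.1 ∧ ∃ s, Q w s ∧ p.2 = f w s} =
      {p | ‖p.1‖ ≤ ε ∧ ∃ w, w ^ E.N = p.1 ∧ ∃ s, Q' w s ∧ p.2 = f' w s} := by
  refine H.image_deform hP ?_ ?_
  · rintro ⟨x, y⟩ ⟨hx, w, rfl, s, hs, rfl⟩
    simp only at hx ⊢
    have hx' : ‖w‖ ^ E.N ≤ ε := by rwa [← norm_pow]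
    obtain ⟨h1, h2⟩ := h w s hx' hs
    exact ⟨w, rfl, hx, w, rfl, g s, h1, h2⟩
  · rintro ⟨x, y⟩ ⟨hx, w, rfl, s', hs, rfl⟩
    simp only at hx ⊢
    have hx' : ‖w‖ ^ E.N ≤ ε := by rwa [← norm_pow]
    obtain ⟨s, hs', rfl⟩ := h' w s' hs
    exact ⟨w, f w s, rfl, (h w s hx' hs').2, hx, w, rfl, s, hs', rfl⟩

theorem image_curve {f f' : ℂ → ℂ} (h : ∀ w, ‖w‖ ^ E.N ≤ ε → f w +
      displacement M c τ L (fun i l => E.coeff i l t) (fun i l => E.coeff i l t') w (f w) = f' w) :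
    carry M c τ L t t' '' {p | ‖p.1‖ ≤ ε ∧ ∃ w, w ^ E.N = p.1 ∧ p.2 = f w} =
      {p | ‖p.1‖ ≤ ε ∧ ∃ w, w ^ E.N = p.1 ∧ p.2 = f' w} := by
  have := H.image_curves hP (S := Unit) (Q := fun _ _ => True) (Q' := fun _ _ => True) (g := id)
    (f := fun w _ => f w) (f' := fun w _ => f' w) (fun w _ hw _ => ⟨trivial, h w hw⟩)
    (fun w s _ => ⟨s, trivial, rfl⟩)
  simpa using this

include hε

theorem image_cone (i : Fin d) : carry M c τ L t t' '' cone E c ε t i = cone E c ε t' i := by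
  refine H.image_deform_of_iff hP fun w y => ?_
  refine and_congr_right fun hx => ?_
  have hx : ‖w ^ E.N‖ ≤ ε := hx
  rw [norm_pow] at hx
  exact H.cone_iff hP (hε w hx).1 i

theorem ball_iff (w y : ℂ) : (w ^ E.N, y + displacement M c τ L (fun i l => E.coeff i l t)
    (fun i l => E.coeff i l t') w y) ∈ ball c.R ε ↔ (w ^ E.N, y) ∈ ball c.R ε := by
  refine and_congr_right fun hx => ?_
  have hx : ‖w ^ E.N‖ ≤ ε := hx
  rcases Nat.eq_zero_or_pos d with rfl | hd
  · simp [displacement]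
  · have hR : 0 ≤ c.R := by
      have := H.fit.cones_le ⟨0, hd⟩
      linarith [norm_nonneg (E.coeff ⟨0, hd⟩ E.N t), H.bounds.η_ge, H.bounds.τ_pos]
    exact H.norm_le_iff hP (hε w (by rwa [← norm_pow])).1 (mul_le_mul_of_nonneg_left hx hR)

theorem image_ball : carry M c τ L t t' '' ball c.R ε = ball c.R ε :=
  H.image_deform_of_iff hP (H.ball_iff hP hε)

theorem image_carrier (Q : Piece d) (hQ : Q.Valid M) :
    carry M c τ L t t' '' Q.carrier M c ε t = Q.carrier M c ε t' := by
  cases Q with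
  | conical =>
    refine H.image_deform_of_iff hP fun w y => ?_
    have h0 := H.ball_iff hP hε w y
    constructor
    · rintro ⟨h1, h2⟩
      have hx : ‖w ^ E.N‖ ≤ ε := h1.1
      exact ⟨h0.1 h1, (H.conical_iff hP (hε w (by rwa [← norm_pow])).1).1 h2⟩
    · rintro ⟨h1, h2⟩
      have hx : ‖w ^ E.N‖ ≤ ε := h1.1
      exact ⟨h0.2 h1, (H.conical_iff hP (hε w (by rwa [← norm_pow])).1).2 h2⟩
  | B i k =>
    have hik : M.IsNode i k := hQ
    rw [carrier_B_eq hik, carrier_B_eq hik]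
    refine H.image_curves hP (g := leafMap M c τ (fun i l => E.coeff i l t)
      (fun i l => E.coeff i l t') i k) (fun w a hw ha => ?_) fun w a' ha' => ?_
    · rcases eq_or_ne w 0 with rfl | hw0
      · refine ⟨fun h => absurd rfl h, ?_⟩
        have hk : k ≠ 0 := by have := hik.1; omega
        rw [displacement_zero_left, H.fit.psum_zero, H.fit'.psum_zero]
        simp [hk]
      · exact ⟨fun _ => (H.leafMap_mem_leafSet hik).2 (ha hw0),
          H.add_displacement_leaf hP (hε w hw).1 hik (ha hw0)⟩
    · obtain ⟨a, rfl⟩ := (H.leafMap_bijective (i := i) (k := k)).2 a'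
      exact ⟨a, fun h => (H.leafMap_mem_leafSet hik).1 (ha' h), rfl⟩
  | A K j k' =>
    have key : ∀ t : Param m, (Piece.A K j k').carrier M c ε t = {p | ‖p.1‖ ≤ ε ∧ ∃ w,
        w ^ E.N = p.1 ∧ ∃ u : ℂ, (c.β j k' * ‖w‖ ^ k' ≤ ‖u‖ ∧ ‖u‖ ≤ K.radius c * ‖w‖ ^ K.order E) ∧
          p.2 = K.ctr E (fun i l => E.coeff i l t) w + u} := by
      intro t
      ext p
      refine and_congr_right fun _ => exists_congr fun w => and_congr_right fun _ => ?_
      rw [Disk.center_eq_ctr]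
      constructor
      · intro h
        exact ⟨_, h, (add_sub_cancel _ _).symm⟩
      · rintro ⟨u, h, hu⟩
        rwa [hu, add_sub_cancel_left]
    rw [key, key]
    refine H.image_curves hP (g := id) (fun w u hw hu => ⟨hu, ?_⟩) fun w u hu => ⟨u, hu, rfl⟩
    exact H.add_displacement_A hP (hε w hw).1 hQ.1 hQ.2 hu.2 hu.1
  | D K =>
    have key : ∀ t : Param m, (Piece.D K).carrier M c ε t = {p | ‖p.1‖ ≤ ε ∧ ∃ w,
        w ^ E.N = p.1 ∧ ∃ u : ℂ, ‖u‖ ≤ K.radius c * ‖w‖ ^ K.order E ∧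
          p.2 = K.ctr E (fun i l => E.coeff i l t) w + u} := by
      intro t
      ext p
      refine and_congr_right fun _ => exists_congr fun w => and_congr_right fun _ => ?_
      rw [Disk.center_eq_ctr]
      constructor
      · intro h
        exact ⟨_, h, (add_sub_cancel _ _).symm⟩
      · rintro ⟨u, h, hu⟩
        rwa [hu, add_sub_cancel_left]
    rw [key, key]
    refine H.image_curves hP (g := id) (fun w u hw hu => ⟨hu, ?_⟩) fun w u hu => ⟨u, hu, rfl⟩
    exact H.add_displacement_D hP (hε w hw).1 hQ.1 hQ.2 hu

/-- By `leaf_bounds` the immersed curve stays in the A-piece, where the map is a translation by the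
difference of the centers and so keeps the term in x ^ r. -/
theorem image_leaf_A {K : Disk d} {j : Fin d} {k' : ℕ} (hK : K.Valid M) (hn : K.IsNext M j k')
    {r θ : ℝ} (hr : (K.order E / E.N : ℝ) ≤ r) (hr' : r ≤ (k' / E.N : ℝ)) :
    carry M c τ L t t' '' {p | p = 0 ∨ ‖p.1‖ ≤ ε ∧ ∃ z : ℂ, Complex.exp z = p.1 ∧
        p.2 = K.center E t (Complex.exp (z / E.N)) +
          ((c.β j k' + ((k' / E.N : ℝ) - r) / ((k' / E.N : ℝ) - (K.order E / E.N : ℝ)) *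
            (K.radius c - c.β j k') : ℝ) : ℂ) * Complex.exp (θ * Complex.I) *
            Complex.exp (r * z)} =
      {p | p = 0 ∨ ‖p.1‖ ≤ ε ∧ ∃ z : ℂ, Complex.exp z = p.1 ∧
        p.2 = K.center E t' (Complex.exp (z / E.N)) +
          ((c.β j k' + ((k' / E.N : ℝ) - r) / ((k' / E.N : ℝ) - (K.order E / E.N : ℝ)) *
            (K.radius c - c.β j k') : ℝ) : ℂ) * Complex.exp (θ * Complex.I) *
            Complex.exp (r * z)} := by
  have hB := H.bounds
  have hτ := hB.τ_pos
  have hN : (0 : ℝ) < E.N := by exact_mod_cast E.N_pos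
  set B : ℝ := c.β j k' + ((k' / E.N : ℝ) - r) / ((k' / E.N : ℝ) - (K.order E / E.N : ℝ)) *
            (K.radius c - c.β j k') with hBdef
  have hzpow : ∀ z : ℂ, Complex.exp (z / E.N) ^ E.N = Complex.exp z := fun z => by
    rw [← Complex.exp_nat_mul, mul_div_cancel₀ _ (by exact_mod_cast E.N_pos.ne')]
  have key : ∀ z : ℂ, ‖Complex.exp z‖ ≤ ε →
      K.center E t (Complex.exp (z / E.N)) + B * Complex.exp (θ * Complex.I) * Complex.exp (r * z) +
        displacement M c τ L (fun i l => E.coeff i l t) (fun i l => E.coeff i l t')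
          (Complex.exp (z / E.N)) (K.center E t (Complex.exp (z / E.N)) +
            B * Complex.exp (θ * Complex.I) * Complex.exp (r * z)) =
      K.center E t' (Complex.exp (z / E.N)) +
        B * Complex.exp (θ * Complex.I) * Complex.exp (r * z) := by
    intro z hz
    obtain ⟨h1, h2⟩ := hε (Complex.exp (z / E.N)) (by rwa [← norm_pow, hzpow])
    have hwn : ∀ n : ℕ, ‖Complex.exp (z / E.N)‖ ^ n = Real.exp (n * (z.re / E.N)) := by
      intro n
      rw [Complex.norm_exp, ← Real.exp_nat_mul]
      congr 2
      exact Complex.div_natCast_re z E.N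
    have hx : z.re / E.N ≤ -(C / τ) := by
      have := hwn 1
      rw [pow_one, Nat.cast_one, one_mul] at this
      rw [this] at h2
      exact Real.exp_le_exp.1 h2
    have hpk : (K.order E : ℝ) + 1 ≤ k' := by exact_mod_cast hn.2.2.1
    set n : ℝ := (k' : ℝ) - K.order E with hnd
    have hn1 : 1 ≤ n := by linarith
    -- The position of r between the two exponents; the coefficient b(r) is then (1 - s) ρ + s β.
    set s : ℝ := (r - K.order E / E.N) / (n / E.N) with hs
    have hnN : 0 < n / E.N := by positivity
    have hs0 : 0 ≤ s := div_nonneg (by linarith) hnN.le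
    have hs1 : s ≤ 1 := by
      rw [hs, div_le_one hnN, hnd, sub_div]
      linarith
    have hrs : r = K.order E / E.N + s * (n / E.N) := by
      rw [hs, div_mul_cancel₀ _ hnN.ne']; ring
    have hBs : B = (1 - s) * K.radius c + s * c.β j k' := by
      have e1 : ((k' / E.N : ℝ) - r) / ((k' / E.N : ℝ) - (K.order E / E.N : ℝ)) = 1 - s := by
        rw [← sub_div, ← hnd, hrs, div_eq_iff hnN.ne', hnd]
        field_simp
        ring
      rw [hBdef, e1]; ring
    have hρ := hK.radius_ge hB
    have hβ : 0 ≤ c.β j k' := by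
      have := H.fit.beta j k' j hn.2.1 ⟨hn.2.1, .refl _ _⟩
      have := hB.γ_ge j k' hn.2.1
      linarith [norm_nonneg (E.coeff j k' t)]
    have hCτ : 0 ≤ C / τ := div_nonneg hB.C_pos.le hτ.le
    obtain ⟨hb1, hb2⟩ := leaf_bounds (x := n * (z.re / E.N)) hτ (by linarith : τ ≤ K.radius c) hβ
      (hB.β_le j k' hn.2.1) hs0 hs1 (by nlinarith)
    rw [← hBs] at hb1 hb2
    have hB0 : 0 ≤ B := by
      rw [hBs]
      exact add_nonneg (mul_nonneg (by linarith) (by linarith)) (mul_nonneg hs0 hβ)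
    have hu : ‖(B : ℂ) * Complex.exp (θ * Complex.I) * Complex.exp (r * z)‖ =
        B * Real.exp (r * z.re) := by
      rw [norm_mul, norm_mul, Complex.norm_exp_ofReal_mul_I, mul_one, Complex.norm_real,
        Real.norm_of_nonneg hB0, Complex.norm_exp, Complex.re_ofReal_mul]
    have hfin := H.add_displacement_A (u := (B : ℂ) * Complex.exp (θ * Complex.I) *
      Complex.exp (r * z)) hP h1 hK hn ?_ ?_
    · rw [Disk.center_eq_ctr, Disk.center_eq_ctr]
      exact hfin
    · rw [hu, hwn]
      have e1 : Real.exp (r * z.re) = Real.exp (s * (n * (z.re / E.N))) *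
          Real.exp (K.order E * (z.re / E.N)) := by
        rw [← Real.exp_add]; congr 1; rw [hrs]; ring
      rw [e1, ← mul_assoc]
      exact mul_le_mul_of_nonneg_right hb1 (Real.exp_pos _).le
    · rw [hu, hwn]
      have e1 : Real.exp (k' * (z.re / E.N)) = Real.exp ((1 - s) * (n * (z.re / E.N))) *
          Real.exp (r * z.re) := by
        rw [← Real.exp_add]; congr 1; rw [hrs, hnd]; ring
      rw [e1, ← mul_assoc]
      exact mul_le_mul_of_nonneg_right hb2 (Real.exp_pos _).le
  refine H.image_deform hP ?_ ?_
  · rintro ⟨x, y⟩ (h0 | ⟨hx, z, hz, hy⟩)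
    · rw [Prod.mk_eq_zero] at h0
      obtain ⟨rfl, rfl⟩ := h0
      exact ⟨0, zero_pow E.N_pos.ne', Or.inl (by rw [displacement_zero_left]; simp)⟩
    · simp only at hx hz hy
      subst hz
      subst hy
      exact ⟨_, hzpow z, Or.inr ⟨hx, z, rfl, key z hx⟩⟩
  · rintro ⟨x, y⟩ (h0 | ⟨hx, z, hz, hy⟩)
    · rw [Prod.mk_eq_zero] at h0
      obtain ⟨rfl, rfl⟩ := h0
      exact ⟨0, 0, zero_pow E.N_pos.ne', by rw [displacement_zero_left]; simp, Or.inl rfl⟩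
    · simp only at hx hz hy
      subst hz
      subst hy
      exact ⟨_, _, hzpow z, key z hx, Or.inr ⟨hx, z, rfl, rfl⟩⟩

theorem image_line {g : ℂ → ℂ} {a : ℂ}
    (hg : ∀ w : ℂ, ‖w‖ * (8 * (L + 2) * C) ≤ τ → a * w ^ E.N +
      displacement M c τ L (fun i l => E.coeff i l t) (fun i l => E.coeff i l t') w (a * w ^ E.N) =
        g a * w ^ E.N) :
    carry M c τ L t t' '' {p | p ∈ ball c.R ε ∧ p.2 = a * p.1} =
      {p | p ∈ ball c.R ε ∧ p.2 = g a * p.1} := by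
  refine H.image_deform_of_iff hP fun w y => ?_
  have h0 := H.ball_iff hP hε w y
  constructor
  · rintro ⟨h1, h2⟩
    have hx : ‖w ^ E.N‖ ≤ ε := h1.1
    refine ⟨h0.1 h1, ?_⟩
    refine (H.add_displacement_bijective w).1 (h2.trans ?_)
    exact (hg w (hε w (by rwa [← norm_pow])).1).symm
  · rintro ⟨h1, h2⟩
    have hx : ‖w ^ E.N‖ ≤ ε := h1.1
    refine ⟨h0.2 h1, ?_⟩
    simp only at h2
    rw [h2]
    exact hg w (hε w (by rwa [← norm_pow])).1

theorem image_leaves (Q : Piece d) (hQ : Q.Valid M) :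
    (fun L' => carry M c τ L t t' '' L') '' Q.leaves M c ε t = Q.leaves M c ε t' := by
  have hB := H.bounds
  have hτ := hB.τ_pos
  cases Q with
  | conical =>
    obtain ⟨g, hg, hg1, -, -, hg4⟩ := H.exists_lineMap hP
    have hmem : ∀ a, (∀ j, c.η ≤ ‖g a - E.coeff j E.N t'‖) ↔ ∀ j, c.η ≤ ‖a - E.coeff j E.N t‖ :=
      fun a => forall_congr' fun j => by rw [← not_lt, hg1, not_lt]
    have hvert : carry M c τ L t t' '' {p | p ∈ ball c.R ε ∧ p.1 = 0} =
        {p | p ∈ ball c.R ε ∧ p.1 = 0} :=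
      H.image_deform_of_iff hP fun w y => and_congr_left fun _ => H.ball_iff hP hε w y
    have hline : ∀ a, (∀ j, c.η ≤ ‖a - E.coeff j E.N t‖) →
        carry M c τ L t t' '' {p | p ∈ ball c.R ε ∧ p.2 = a * p.1} =
          {p | p ∈ ball c.R ε ∧ p.2 = g a * p.1} := fun a ha =>
      H.image_line hP hε fun w hw => (hg4 w hw a).2 fun j => by
        have := ha j
        linarith [hB.η_ge]
    ext L'
    constructor
    · rintro ⟨L₁, rfl | ⟨a, ha, rfl⟩, rfl⟩
      · exact Or.inl hvert
      · exact Or.inr ⟨g a, (hmem a).2 ha, hline a ha⟩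
    · rintro (rfl | ⟨a', ha', rfl⟩)
      · exact ⟨_, Or.inl rfl, hvert⟩
      · obtain ⟨a, rfl⟩ := hg.2 a'
        have ha := (hmem a).1 ha'
        exact ⟨_, Or.inr ⟨a, ha, rfl⟩, hline a ha⟩
  | B i k =>
    have hik : M.IsNode i k := hQ
    have hcurve : ∀ a ∈ leafSet M c i k fun i l => E.coeff i l t, carry M c τ L t t' ''
        {p | ‖p.1‖ ≤ ε ∧ ∃ w : ℂ, w ^ E.N = p.1 ∧ p.2 = E.partialSum i k t w + a * w ^ k} =
        {p | ‖p.1‖ ≤ ε ∧ ∃ w : ℂ, w ^ E.N = p.1 ∧ p.2 = E.partialSum i k t' w +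
          leafMap M c τ (fun i l => E.coeff i l t) (fun i l => E.coeff i l t') i k a * w ^ k} :=
      fun a ha => H.image_curve hP fun w hw => H.add_displacement_leaf hP (hε w hw).1 hik ha
    ext L'
    constructor
    · rintro ⟨L₁, ⟨a, ha, rfl⟩, rfl⟩
      exact ⟨_, (H.leafMap_mem_leafSet hik).2 ha, hcurve a ha⟩
    · rintro ⟨a', ha', rfl⟩
      obtain ⟨a, rfl⟩ := (H.leafMap_bijective (i := i) (k := k)).2 a'
      have ha := (H.leafMap_mem_leafSet hik).1 ha'
      exact ⟨_, ⟨a, ha, rfl⟩, hcurve a ha⟩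
  | A K j k' =>
    ext L'
    constructor
    · rintro ⟨L₁, ⟨r, θ, hr, hr', rfl⟩, rfl⟩
      exact ⟨r, θ, hr, hr', H.image_leaf_A hP hε hQ.1 hQ.2 hr hr'⟩
    · rintro ⟨r, θ, hr, hr', rfl⟩
      exact ⟨_, ⟨r, θ, hr, hr', rfl⟩, H.image_leaf_A hP hε hQ.1 hQ.2 hr hr'⟩
  | D K =>
    have hcurve : ∀ a : ℂ, ‖a‖ ≤ K.radius c → carry M c τ L t t' ''
        {p | ‖p.1‖ ≤ ε ∧ ∃ w : ℂ, w ^ E.N = p.1 ∧ p.2 = K.center E t w + a * w ^ K.order E} =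
        {p | ‖p.1‖ ≤ ε ∧ ∃ w : ℂ, w ^ E.N = p.1 ∧ p.2 = K.center E t' w + a * w ^ K.order E} := by
      intro a ha
      refine H.image_curve hP fun w hw => ?_
      rw [Disk.center_eq_ctr, Disk.center_eq_ctr]
      refine H.add_displacement_D hP (hε w hw).1 hQ.1 hQ.2 ?_
      rw [norm_mul, norm_pow]
      exact mul_le_mul_of_nonneg_right ha (by positivity)
    ext L'
    constructor
    · rintro ⟨L₁, ⟨a, ha, rfl⟩, rfl⟩
      exact ⟨a, ha, hcurve a ha⟩
    · rintro ⟨a, ha, rfl⟩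
      exact ⟨_, ⟨a, ha, rfl⟩, hcurve a ha⟩

theorem boundary_line (i : Fin d) {a : ℂ} (ha : ‖a - E.coeff i E.N t‖ = c.η) :
    ∃ a' : ℂ, ‖a' - E.coeff i E.N t'‖ = c.η ∧
      ∀ x : ℂ, ‖x‖ ≤ ε → carry M c τ L t t' (x, a * x) = (x, a' * x) := by
  have hB := H.bounds
  have hτ := hB.τ_pos
  have hη := hB.η_ge
  obtain ⟨g, -, -, hg2, -, hg4⟩ := H.exists_lineMap hP
  have h1 := hg2 a i ha.le
  refine ⟨g a, by rw [h1, add_sub_cancel_right, ha], fun x hx => ?_⟩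
  have hw : (x ^ ((E.N : ℂ)⁻¹)) ^ E.N = x := Complex.cpow_nat_inv_pow x E.N_pos.ne'
  set w := x ^ ((E.N : ℂ)⁻¹)
  rw [carry, H.deform_apply hP hw, ← hw, (hg4 w (hε w (by rwa [← norm_pow, hw])).1 a).2]
  intro j
  by_cases h5 : E.Agree i j (E.N + 1)
  · rw [H.fit.agree i j E.N hB.N_lt h5, ha]
    linarith
  · have h6 := H.fit.cones i j h5
    have h7 : ‖E.coeff i E.N t - E.coeff j E.N t‖ ≤
        ‖a - E.coeff j E.N t‖ + ‖a - E.coeff i E.N t‖ := by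
      rw [show E.coeff i E.N t - E.coeff j E.N t =
        (a - E.coeff j E.N t) - (a - E.coeff i E.N t) by ring]
      exact norm_sub_le _ _
    linarith

end Close

end Carrousel

/-! ### Lipschitz dependence on x and t -/

namespace Carrousel

variable {m d : ℕ} {P : Param m → ℂ → ℂ[X]} {E : PuiseuxExpansion d P}
variable {M : Truncation E} {c : Constants d} {τ C κ ε : ℝ} {L : ℕ} {b b₁ b₂ b' : Fin d → ℕ → ℂ}
  {w w' y : ℂ} {j : Fin d} {l : ℕ}

theorem norm_pow_sub_pow_le {r : ℝ} (hw : ‖w‖ ≤ r) (hw' : ‖w'‖ ≤ r) (n : ℕ) :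
    ‖w ^ (n + 1) - w' ^ (n + 1)‖ ≤ (n + 1) * r ^ n * ‖w - w'‖ := by
  have hr : 0 ≤ r := (norm_nonneg w).trans hw
  induction n with
  | zero => simp
  | succ n ih =>
    have e : w ^ (n + 1 + 1) - w' ^ (n + 1 + 1) =
        w * (w ^ (n + 1) - w' ^ (n + 1)) + w' ^ (n + 1) * (w - w') := by ring
    rw [e]
    refine (norm_add_le _ _).trans ?_
    rw [norm_mul, norm_mul, norm_pow]
    have h1 : ‖w‖ * ‖w ^ (n + 1) - w' ^ (n + 1)‖ ≤ r * ((n + 1) * r ^ n * ‖w - w'‖) :=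
      mul_le_mul hw ih (norm_nonneg _) hr
    have h2 : ‖w'‖ ^ (n + 1) * ‖w - w'‖ ≤ r ^ (n + 1) * ‖w - w'‖ :=
      mul_le_mul_of_nonneg_right (pow_le_pow_left₀ (norm_nonneg _) hw' _) (norm_nonneg _)
    refine (add_le_add h1 h2).trans (le_of_eq ?_)
    push_cast
    ring

/-- Roots of two numbers can be chosen such that their powers of exponent at least `N` depend on
the numbers in a Lipschitz way. -/
theorem exists_close_roots (N : ℕ) (hN : 0 < N) (L : ℕ) : ∃ A : ℝ, 0 ≤ A ∧ ∀ x x' : ℂ,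
    ‖x‖ ≤ 1 → ‖x'‖ ≤ 1 → ∃ w w' : ℂ, w ^ N = x ∧ w' ^ N = x' ∧
      ∀ l, N ≤ l → l < L → ‖w ^ l - w' ^ l‖ ≤ A * ‖x - x'‖ := by
  classical
  set Z : Finset ℂ := Polynomial.nthRootsFinset N (1 : ℂ) with hZ
  have hmemZ : ∀ ζ, ζ ∈ Z ↔ ζ ^ N = 1 := fun ζ => Polynomial.mem_nthRootsFinset hN _
  obtain ⟨μ, hμ0, hμ⟩ : ∃ μ : ℝ, 0 < μ ∧ ∀ ζ ∈ Z, ζ ≠ 1 → μ ≤ ‖1 - ζ‖ := by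
    have h2 : ∀ᶠ x in 𝓝[>] (0 : ℝ), ∀ ζ ∈ Z, ζ ≠ 1 → x ≤ ‖1 - ζ‖ := by
      refine (Finset.eventually_all Z).2 fun ζ _ => ?_
      by_cases h : ζ = 1
      · simp [h]
      · filter_upwards [nhdsWithin_le_nhds (eventually_le_nhds
          (norm_pos_iff.2 (sub_ne_zero.2 (Ne.symm h))))] with x hx _ using hx
    obtain ⟨x, hx, hx0⟩ := (h2.and self_mem_nhdsWithin).exists
    exact ⟨x, hx0, hx⟩
  set q : ℝ := μ / (μ + 2) with hq
  have hq0 : 0 < q := by positivity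
  refine ⟨L / q ^ (N - 1), by positivity, fun x x' hx hx' => ?_⟩
  obtain ⟨w', hw'⟩ : ∃ w' : ℂ, w' ^ N = x' := ⟨_, Complex.cpow_nat_inv_pow x' hN.ne'⟩
  obtain ⟨w₀, hw₀⟩ : ∃ w : ℂ, w ^ N = x := ⟨_, Complex.cpow_nat_inv_pow x hN.ne'⟩
  have h1Z : (1 : ℂ) ∈ Z := (hmemZ 1).2 (one_pow N)
  -- Among the roots of x the one nearest to w' is taken.
  obtain ⟨ξ, hξ, hmin⟩ := Z.exists_min_image (fun ζ => ‖w' - ζ * w₀‖) ⟨1, h1Z⟩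
  have hξ1 := (hmemZ ξ).1 hξ
  set w := ξ * w₀ with hwdef
  have hw : w ^ N = x := by rw [hwdef, mul_pow, hξ1, one_mul, hw₀]
  have hmin' : ∀ ζ ∈ Z, ‖w' - w‖ ≤ ‖w' - ζ * w‖ := fun ζ hζ => by
    have := hmin (ζ * ξ) ((hmemZ _).2 (by rw [mul_pow, hξ1, (hmemZ ζ).1 hζ, one_mul]))
    simpa [hwdef, mul_assoc] using this
  have hprod : x' - x = ∏ ζ ∈ Z, (w' - ζ * w) := by
    rw [← hw, ← hw']
    exact (Complex.isPrimitiveRoot_exp N hN.ne').pow_sub_pow_eq_prod_sub_mul _ _ hN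
  set r := max ‖w‖ ‖w'‖ with hr
  have hr0 : 0 ≤ r := (norm_nonneg w).trans (le_max_left _ _)
  have hr1 : r ≤ 1 := by
    have : ∀ v z : ℂ, v ^ N = z → ‖z‖ ≤ 1 → ‖v‖ ≤ 1 := fun v z h hz => by
      rw [← h, norm_pow] at hz
      exact (pow_le_one_iff_of_nonneg (norm_nonneg _) hN.ne').1 hz
    exact max_le (this _ _ hw hx) (this _ _ hw' hx')
  -- By minimality the other factors of x' - x are at least a fixed multiple of r. Hence |w - w'| r
  -- ^ (N - 1) is O(|x - x'|), which is enough for powers l ≥ N.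
  have hfac : ∀ ζ ∈ Z.erase 1, q * r ≤ ‖w' - ζ * w‖ := by
    intro ζ hζ
    obtain ⟨hζ1, hζZ⟩ := Finset.mem_erase.1 hζ
    have hA := hmin' ζ hζZ
    have h3 := hμ ζ hζZ hζ1
    have h4 : ‖1 - ζ‖ * ‖w‖ ≤ 2 * ‖w' - ζ * w‖ := by
      rw [← norm_mul, show (1 - ζ) * w = (w' - ζ * w) - (w' - w) by ring]
      refine (norm_sub_le _ _).trans ?_
      linarith
    have h5 : μ * ‖w‖ ≤ 2 * ‖w' - ζ * w‖ :=
      (mul_le_mul_of_nonneg_right h3 (norm_nonneg _)).trans h4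
    have h6 : ‖w'‖ ≤ ‖w' - w‖ + ‖w‖ := by
      simpa using norm_add_le (w' - w) w
    have hpos : 0 ≤ ‖w' - ζ * w‖ := norm_nonneg _
    rw [hq, div_mul_eq_mul_div, div_le_iff₀ (by linarith)]
    have h7 : r ≤ ‖w' - w‖ + ‖w‖ := max_le (by linarith [norm_nonneg (w' - w)]) h6
    nlinarith
  have hlow : ‖w' - w‖ * (q * r) ^ (N - 1) ≤ ‖x' - x‖ := by
    rw [hprod, norm_prod, ← Finset.mul_prod_erase Z _ h1Z, one_mul]
    refine mul_le_mul_of_nonneg_left ?_ (norm_nonneg _)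
    have hcard : (Z.erase 1).card = N - 1 := by
      rw [Finset.card_erase_of_mem h1Z, hZ,
        (Complex.isPrimitiveRoot_exp N hN.ne').card_nthRootsFinset]
    rw [← hcard, ← Finset.prod_const]
    exact Finset.prod_le_prod (fun ζ _ => by positivity) hfac
  refine ⟨w, w', hw, hw', fun l hl hlL => ?_⟩
  obtain ⟨n, rfl⟩ : ∃ n, l = n + 1 := ⟨l - 1, by omega⟩
  calc ‖w ^ (n + 1) - w' ^ (n + 1)‖ ≤ (n + 1) * r ^ n * ‖w - w'‖ :=
        norm_pow_sub_pow_le (le_max_left _ _) (le_max_right _ _) n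
    _ ≤ L * r ^ (N - 1) * ‖w - w'‖ := by
        refine mul_le_mul_of_nonneg_right ?_ (norm_nonneg _)
        refine mul_le_mul (by exact_mod_cast hlL.le)
          (pow_le_pow_of_le_one hr0 hr1 (by omega)) (by positivity) (by positivity)
    _ = L / q ^ (N - 1) * (‖w' - w‖ * (q * r) ^ (N - 1)) := by
        rw [mul_pow, norm_sub_rev]
        field_simp
    _ ≤ L / q ^ (N - 1) * ‖x - x'‖ := by
        rw [norm_sub_rev x]
        exact mul_le_mul_of_nonneg_left hlow (by positivity)

/-- The displacement depends on the coefficients and on the root in a Lipschitz way. -/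
theorem norm_displacement_sub_le_of_close {Λ A X : ℝ} (hB : Bounds M c τ C L)
    (F₁ : Fit M c τ C L b₁) (F₂ : Fit M c τ C L b₂) (hκ : ∀ j, ∀ l < L, ‖b' j l - b₂ j l‖ ≤ κ)
    (hκ0 : 0 ≤ κ) (hX : 0 ≤ X) (hΛ0 : 0 ≤ Λ) (hA0 : 0 ≤ A) (hw : ‖w‖ ≤ 1) (hw' : ‖w'‖ ≤ 1)
    (hA : ∀ l, E.N ≤ l → l < L → ‖w ^ l - w' ^ l‖ ≤ A * X)
    (hΛ : ∀ j, ∀ l < L, ‖b₁ j l - b₂ j l‖ ≤ Λ * X) (y : ℂ) :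
    ‖displacement M c τ L b₁ b' w y - displacement M c τ L b₂ b' w' y‖ ≤
      L * (d * (Λ + κ * (L * (Λ + C * A) / τ + ((C + τ) / τ + 2) * A))) * X := by
  have hτ := hB.τ_pos
  have hC := hB.C_pos
  set K₀ := Λ + κ * (L * (Λ + C * A) / τ + ((C + τ) / τ + 2) * A) with hK
  have hps : ∀ j l, l < L → ‖psum b₂ j (l + 1) w' - psum b₁ j (l + 1) w‖ ≤ L * (Λ + C * A) * X := by
    intro j l hl
    rw [psum, psum, ← Finset.sum_sub_distrib]
    have h1 : ∀ l' ∈ Finset.range (l + 1), ‖b₂ j l' * w' ^ l' - b₁ j l' * w ^ l'‖ ≤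
        (Λ + C * A) * X := by
      intro l' hl'
      have hl' : l' < L := by have := Finset.mem_range.1 hl'; omega
      -- Powers of w below N need not be Lipschitz in x, but their coefficients vanish.
      rcases Nat.lt_or_ge l' E.N with h | h
      · rw [F₁.low j l' h, F₂.low j l' h, zero_mul, zero_mul, sub_self, norm_zero]
        positivity
      · rw [show b₂ j l' * w' ^ l' - b₁ j l' * w ^ l' =
          -((b₁ j l' - b₂ j l') * w' ^ l' + b₁ j l' * (w ^ l' - w' ^ l')) by ring, norm_neg]
        refine (norm_add_le _ _).trans ?_
        rw [norm_mul, norm_mul, norm_pow, add_mul, mul_assoc C]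
        refine add_le_add ?_ (mul_le_mul (F₁.bound j l' hl') (hA l' h hl') (norm_nonneg _) hC.le)
        exact (mul_le_mul (hΛ j l' hl') (pow_le_one₀ (norm_nonneg _) hw') (by positivity)
          (by positivity)).trans (mul_one _).le
    refine (norm_sum_le_of_le _ h1).trans ?_
    rw [Finset.sum_const, nsmul_eq_mul, Finset.card_range, mul_assoc]
    refine mul_le_mul_of_nonneg_right ?_ (by positivity)
    exact_mod_cast hl
  have hterm : ∀ j l, l < L → ‖bumpTerm M c τ b₁ b' w y j l - bumpTerm M c τ b₂ b' w' y j l‖ ≤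
      K₀ * X := by
    intro j l hl
    unfold bumpTerm
    split_ifs with h
    · have hNl : E.N ≤ l := by
        rcases h with h | h
        · exact h.ge
        · exact h.1.le
      set u₁ := bump (rad E c j l) τ (y - psum b₁ j (l + 1) w) (w ^ l) with hu₁
      set u₂ := bump (rad E c j l) τ (y - psum b₂ j (l + 1) w') (w' ^ l) with hu₂
      have h1 : ‖u₁‖ ≤ 1 := norm_bump_le.trans (by
        rw [norm_pow]; exact pow_le_one₀ (norm_nonneg _) hw)
      have hg := hB.rad_ge h
      have hg' := hB.rad_le h
      have h2 : ‖u₁ - u₂‖ ≤ (L * (Λ + C * A) / τ + ((C + τ) / τ + 2) * A) * X := by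
        refine (norm_bump_sub_le hτ (by linarith)).trans ?_
        rw [show (L * (Λ + C * A) / τ + ((C + τ) / τ + 2) * A) * X =
          L * (Λ + C * A) * X / τ + ((C + τ) / τ + 2) * (A * X) by ring]
        refine add_le_add (div_le_div_of_nonneg_right ?_ hτ.le) ?_
        · rw [sub_sub_sub_cancel_left]
          exact hps j l hl
        · refine mul_le_mul ?_ (hA l hNl hl) (norm_nonneg _) (by positivity)
          have : (rad E c j l + τ) / τ ≤ (C + τ) / τ :=
            div_le_div_of_nonneg_right (by linarith) hτ.le
          linarith
      rw [mul_assoc, mul_assoc, ← mul_sub, norm_mul]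
      refine (mul_le_of_le_one_left (norm_nonneg _) (norm_card_inv_le _)).trans ?_
      rw [show (b' j l - b₁ j l) * u₁ - (b' j l - b₂ j l) * u₂ =
        -(b₁ j l - b₂ j l) * u₁ + (b' j l - b₂ j l) * (u₁ - u₂) by ring]
      refine (norm_add_le _ _).trans ?_
      rw [norm_mul, norm_mul, norm_neg, hK, add_mul, mul_assoc κ]
      refine add_le_add ?_ (mul_le_mul (hκ j l hl) h2 (norm_nonneg _) hκ0)
      exact (mul_le_mul (hΛ j l hl) h1 (norm_nonneg _) (by positivity)).trans (mul_one _).le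
    · rw [sub_self, norm_zero]
      positivity
  rw [displacement, displacement, ← Finset.sum_sub_distrib]
  have h2 : ∀ l ∈ Finset.range L, ‖∑ j, bumpTerm M c τ b₁ b' w y j l -
      ∑ j, bumpTerm M c τ b₂ b' w' y j l‖ ≤ d * (K₀ * X) := by
    intro l hl
    rw [← Finset.sum_sub_distrib]
    refine (norm_sum_le_of_le _ fun j _ => hterm j l (Finset.mem_range.1 hl)).trans (le_of_eq ?_)
    simp
  refine (norm_sum_le_of_le _ h2).trans (le_of_eq ?_)
  rw [Finset.sum_const, nsmul_eq_mul, Finset.card_range]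
  ring

theorem displacement_congr (h : ∀ j, ∀ l < L, b₁ j l = b₂ j l) (w y : ℂ) :
    displacement M c τ L b₁ b' w y = displacement M c τ L b₂ b' w y := by
  refine Finset.sum_congr rfl fun l hl => Finset.sum_congr rfl fun j _ => ?_
  have hl := Finset.mem_range.1 hl
  have hps : psum b₁ j (l + 1) w = psum b₂ j (l + 1) w := Finset.sum_congr rfl fun l' hl' => by
    rw [h j l' (by have := Finset.mem_range.1 hl'; omega)]
  rw [bumpTerm, bumpTerm, h j l hl, hps]

theorem SAFun.displacement {V : Type*} [AddCommGroup V] [Module ℝ V] {β : Fin d → ℕ → V → ℂ}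
    (hβ : ∀ j l, SAFun (β j l)) {f g : V → ℂ} (hf : SAFun f) (hg : SAFun g) (M : Truncation E)
    (c : Constants d) (τ : ℝ) (L : ℕ) (b' : Fin d → ℕ → ℂ) :
    SAFun fun v => displacement M c τ L (fun j l => β j l v) b' (f v) (g v) := by
  refine SAFun.sum _ fun l _ => SAFun.sum _ fun j _ => ?_
  unfold bumpTerm
  by_cases h : M.Nd j l
  · simp only [if_pos h]
    refine ((SAFun.const _).mul ((SAFun.const _).sub (hβ j l))).mul (SAFun.bump (hg.sub ?_)
      (hf.pow l) _ _)
    exact SAFun.sum _ fun l' _ => (hβ j l').mul (hf.pow l')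
  · simp only [if_neg h]
    exact SAFun.const 0

end Carrousel

/-! ### The trivialization of the family -/

namespace Carrousel

variable {m d : ℕ} {P : Param m → ℂ → ℂ[X]} {E : PuiseuxExpansion d P}
variable {M : Truncation E} {c : Constants d} {τ C κ ε δ : ℝ} {L : ℕ}

theorem PuiseuxExpansion.exists_coeff_lipschitz (E : PuiseuxExpansion d P) (L : ℕ) :
    ∃ Λ : ℝ, 0 ≤ Λ ∧ ∃ U ∈ 𝓝 (0 : Param m), ∀ t ∈ U, ∀ t' ∈ U, ∀ j, ∀ l < L,
      ‖E.coeff j l t - E.coeff j l t'‖ ≤ Λ * ‖t - t'‖ := by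
  choose K U hU hK using fun (q : Fin d × Fin L) =>
    ((E.analyticAt_coeff q.1 q.2).contDiffAt (n := 1)).exists_lipschitzOnWith
  refine ⟨∑ q, (K q : ℝ), Finset.sum_nonneg fun q _ => (K q).2, ⋂ q, U q,
    Filter.iInter_mem.2 hU, fun t ht t' ht' j l hl => ?_⟩
  have h1 := (hK (j, ⟨l, hl⟩)).dist_le_mul t (Set.mem_iInter.1 ht _) t' (Set.mem_iInter.1 ht' _)
  rw [dist_eq_norm, dist_eq_norm] at h1
  refine h1.trans (mul_le_mul_of_nonneg_right ?_ (norm_nonneg _))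
  exact Finset.single_le_sum (f := fun q => (K q : ℝ)) (fun q _ => (K q).2) (Finset.mem_univ _)

/-- The deformation of the family. -/
noncomputable def familyCarry (M : Truncation E) (c : Constants d) (τ : ℝ) (L : ℕ)
    (p : ℂ × ℂ × Param m) : ℂ × ℂ × Param m :=
  (p.1, p.2.1 + displacement M c τ L (fun i l => E.coeff i l p.2.2) (fun i l => E.coeff i l 0)
    (p.1 ^ ((E.N : ℂ)⁻¹)) p.2.1, p.2.2)

theorem SA.ball {V : Type*} [AddCommGroup V] [Module ℝ V] {f g : V → ℂ} (hf : SAFun f)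
    (hg : SAFun g) (R ε : ℝ) : SA {v | (f v, g v) ∈ ball R ε} :=
  (hf.norm.setOf_le (SAFun.const ε)).and (hg.norm.setOf_le (SAFun.const (R * ε)))

section

variable (hP : IsEquisingularFamily d P)
  (H : ∀ t ∈ Metric.ball (0 : Param m) δ,
    Close M c τ C κ L (fun i l => E.coeff i l t) (fun i l => E.coeff i l 0))
include hP H

theorem familyCarry_apply {p : ℂ × ℂ × Param m} (hp : p ∈ domain m c.R ε δ) {w : ℂ}
    (hw : w ^ E.N = p.1) : familyCarry M c τ L p = (p.1, p.2.1 +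
      displacement M c τ L (fun i l => E.coeff i l p.2.2) (fun i l => E.coeff i l 0) w p.2.1,
        p.2.2) := by
  have h := (H p.2.2 hp.2).deform_apply hP hw p.2.1
  exact Prod.ext rfl (Prod.ext (congrArg (fun q : ℂ × ℂ => q.2) h) rfl)

/-- The graph is described with an existentially quantified root w of x. As any root gives the same
value, nothing has to be known about the principal branch. For fixed t the coefficients are
constants, so no assumption on the family is needed. -/
theorem semialgebraic_carry {t : Param m} (ht : t ∈ Metric.ball (0 : Param m) δ) :
    IsSemialgebraicMapOn (carry M c τ L t 0) (ball c.R ε) := by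
  have vx : SAFun fun v : ((ℂ × ℂ) × ℂ × ℂ) × ℂ => v.1.1.1 :=
    SAFun.linear (LinearMap.fst ℝ ℂ ℂ ∘ₗ LinearMap.fst ℝ _ (ℂ × ℂ) ∘ₗ LinearMap.fst ℝ _ ℂ)
  have vy : SAFun fun v : ((ℂ × ℂ) × ℂ × ℂ) × ℂ => v.1.1.2 :=
    SAFun.linear (LinearMap.snd ℝ ℂ ℂ ∘ₗ LinearMap.fst ℝ _ (ℂ × ℂ) ∘ₗ LinearMap.fst ℝ _ ℂ)
  have vq : SAFun fun v : ((ℂ × ℂ) × ℂ × ℂ) × ℂ => v.1.2 :=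
    SAFun.linear (LinearMap.snd ℝ (ℂ × ℂ) (ℂ × ℂ) ∘ₗ LinearMap.fst ℝ _ ℂ)
  have vw : SAFun fun v : ((ℂ × ℂ) × ℂ × ℂ) × ℂ => v.2 := SAFun.snd
  have h1 : SA {p : (ℂ × ℂ) × ℂ × ℂ | ∃ w : ℂ, (p.1.1, p.1.2) ∈ ball c.R ε ∧ w ^ E.N = p.1.1 ∧
      p.2 = (p.1.1, p.1.2 + displacement M c τ L (fun i l => E.coeff i l t)
        (fun i l => E.coeff i l 0) w p.1.2)} :=
    SA.exists_pred ((SA.ball vx vy c.R ε).and (((vw.pow E.N).setOf_eq vx).and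
      (vq.setOf_eq (vx.prodMk (vy.add (SAFun.displacement (β := fun j l _ => E.coeff j l t)
        (fun j l => SAFun.const _) vw vy M c τ L _))))))
  refine (h1.congr fun p => ?_).isSemialgebraic
  constructor
  · rintro ⟨hp, hq⟩
    have hw := Complex.cpow_nat_inv_pow p.1.1 E.N_pos.ne'
    refine ⟨_, hp, hw, hq.trans ?_⟩
    exact (H t ht).deform_apply hP hw p.1.2
  · rintro ⟨w, hp, hw, hq⟩
    exact ⟨hp, hq.trans ((H t ht).deform_apply hP hw p.1.2).symm⟩

theorem semialgebraic_familyCarry {g : Fin d → ℕ → Param m → ℂ} (hg : ∀ j l, SAFun (g j l))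
    (hgE : ∀ t ∈ Metric.ball (0 : Param m) δ, ∀ j, ∀ l < L, E.coeff j l t = g j l t) :
    IsSemialgebraicMapOn (familyCarry M c τ L) (domain m c.R ε δ) := by
  let V := ((ℂ × ℂ × Param m) × ℂ × ℂ × Param m) × ℂ
  have vp : SAFun fun v : V => v.1.1 := SAFun.comp SAFun.fst SAFun.fst
  have vx : SAFun fun v : V => v.1.1.1 := SAFun.comp SAFun.fst vp
  have vyt : SAFun fun v : V => v.1.1.2 := SAFun.comp SAFun.snd vp
  have vy : SAFun fun v : V => v.1.1.2.1 := SAFun.comp SAFun.fst vyt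
  have vt : SAFun fun v : V => v.1.1.2.2 := SAFun.comp SAFun.snd vyt
  have vq : SAFun fun v : V => v.1.2 := SAFun.comp SAFun.snd SAFun.fst
  have vw : SAFun fun v : V => v.2 := SAFun.snd
  have h1 : SA {p : (ℂ × ℂ × Param m) × ℂ × ℂ × Param m | ∃ w : ℂ,
      ((p.1.1, p.1.2.1) ∈ ball c.R ε ∧ ‖p.1.2.2‖ < δ) ∧ w ^ E.N = p.1.1 ∧
      p.2 = (p.1.1, p.1.2.1 + displacement M c τ L (fun i l => g i l p.1.2.2)
        (fun i l => E.coeff i l 0) w p.1.2.1, p.1.2.2)} :=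
    SA.exists_pred (((SA.ball vx vy c.R ε).and (vt.setOf_norm_lt δ)).and
      (((vw.pow E.N).setOf_eq vx).and
      (vq.setOf_eq (vx.prodMk ((vy.add (SAFun.displacement (β := fun j l (v : V) => g j l v.1.1.2.2)
        (fun j l => SAFun.comp (hg j l) vt) vw vy M c τ L _)).prodMk vt)))))
  refine (h1.congr fun p => ?_).isSemialgebraic
  have hdom : p.1 ∈ domain m c.R ε δ ↔ (p.1.1, p.1.2.1) ∈ ball c.R ε ∧ ‖p.1.2.2‖ < δ :=
    and_congr_right fun _ => mem_ball_zero_iff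
  constructor
  · rintro ⟨hp, hq⟩
    have hw := Complex.cpow_nat_inv_pow p.1.1 E.N_pos.ne'
    refine ⟨_, hdom.1 hp, hw, hq.trans ?_⟩
    rw [familyCarry_apply hP H hp hw, displacement_congr (hgE _ hp.2)]
  · rintro ⟨w, hp, hw, hq⟩
    refine ⟨hdom.2 hp, hq.trans ?_⟩
    rw [familyCarry_apply hP H (hdom.2 hp) hw, displacement_congr (hgE _ (hdom.2 hp).2)]

/-- The y-component changes by at most half the variation of y plus a multiple of that of (x, t),
while x and t are fixed. The factor 1 / 2 is absorbed for the lower bound. -/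
theorem bilipschitz_familyCarry
    (hε : ∀ w : ℂ, ‖w‖ ^ E.N ≤ ε → ‖w‖ * (8 * (L + 2) * C) ≤ τ) {Λ : ℝ} (hΛ0 : 0 ≤ Λ)
    (hΛ : ∀ t ∈ Metric.ball (0 : Param m) δ, ∀ t' ∈ Metric.ball (0 : Param m) δ, ∀ j, ∀ l < L,
      ‖E.coeff j l t - E.coeff j l t'‖ ≤ Λ * ‖t - t'‖) :
    ∃ K : ℝ, 0 < K ∧ ∀ p ∈ domain m c.R ε δ, ∀ q ∈ domain m c.R ε δ,
      dist (familyCarry M c τ L p) (familyCarry M c τ L q) ≤ K * dist p q ∧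
      dist p q ≤ K * dist (familyCarry M c τ L p) (familyCarry M c τ L q) := by
  obtain ⟨A, hA0, hA⟩ := exists_close_roots E.N E.N_pos L
  by_cases hne : δ ≤ 0
  · refine ⟨1, one_pos, fun p hp => ?_⟩
    have := hp.2
    rw [Metric.ball_eq_empty.2 hne] at this
    exact absurd this (Set.notMem_empty _)
  have h0 := H 0 (Metric.mem_ball_self (not_le.1 hne))
  have hτ := h0.bounds.τ_pos
  have hC := h0.bounds.C_pos
  set K₁ : ℝ := L * (d * (Λ + κ * (L * (Λ + C * A) / τ + ((C + τ) / τ + 2) * A))) with hK₁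
  have hK₁0 : 0 ≤ K₁ := by
    have := h0.κ_nonneg
    positivity
  have key : ∀ p ∈ domain m c.R ε δ, ∀ q ∈ domain m c.R ε δ,
      ‖((familyCarry M c τ L p).2.1 - (familyCarry M c τ L q).2.1) - (p.2.1 - q.2.1)‖ ≤
        1 / 2 * ‖p.2.1 - q.2.1‖ + K₁ * max ‖p.1 - q.1‖ ‖p.2.2 - q.2.2‖ := by
    intro p hp q hq
    have hone : ∀ w : ℂ, ‖w ^ E.N‖ ≤ ε → ‖w‖ ≤ 1 := fun w hw =>
      h0.bounds.norm_le_one (hε w (by rwa [← norm_pow]))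
    have hone' : ∀ x : ℂ, ‖x‖ ≤ ε → ‖x‖ ≤ 1 := fun x hx => by
      have h1 := Complex.cpow_nat_inv_pow x E.N_pos.ne'
      have h2 := hone _ (by rwa [h1])
      rw [← h1, norm_pow]
      exact pow_le_one₀ (norm_nonneg _) h2
    obtain ⟨w, w', hw, hw', hww⟩ := hA p.1 q.1 (hone' _ hp.1.1) (hone' _ hq.1.1)
    rw [familyCarry_apply hP H hp hw, familyCarry_apply hP H hq hw']
    simp only
    set X := max ‖p.1 - q.1‖ ‖p.2.2 - q.2.2‖ with hX
    have hX0 : 0 ≤ X := (norm_nonneg _).trans (le_max_left _ _)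
    have h1 := (H p.2.2 hp.2).norm_displacement_sub_le w p.2.1 q.2.1
    have h2 := norm_displacement_sub_le_of_close (b' := fun i l => E.coeff i l 0) (X := X)
      h0.bounds (H p.2.2 hp.2).fit
      (H q.2.2 hq.2).fit (H q.2.2 hq.2).close h0.κ_nonneg hX0 hΛ0 hA0
      (hone w (by rw [hw]; exact hp.1.1)) (hone w' (by rw [hw']; exact hq.1.1))
      (fun l hl hl' => (hww l hl hl').trans (mul_le_mul_of_nonneg_left (le_max_left _ _) hA0))
      (fun j l hl => (hΛ _ hp.2 _ hq.2 j l hl).trans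
        (mul_le_mul_of_nonneg_left (le_max_right _ _) hΛ0)) q.2.1
    refine le_trans (le_of_eq ?_) ((norm_add_le _ _).trans (add_le_add h1 h2))
    congr 1
    ring
  refine ⟨2 * (2 + K₁), by positivity, fun p hp q hq => ?_⟩
  have h1 := key p hp q hq
  set p' := familyCarry M c τ L p with hp'
  set q' := familyCarry M c τ L q with hq'
  have ex : p'.1 - q'.1 = p.1 - q.1 := rfl
  have et : p'.2.2 - q'.2.2 = p.2.2 - q.2.2 := rfl
  have hdist : ∀ p q : ℂ × ℂ × Param m, dist p q =
      max ‖p.1 - q.1‖ (max ‖p.2.1 - q.2.1‖ ‖p.2.2 - q.2.2‖) := fun p q => by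
    rw [Prod.dist_eq, Prod.dist_eq, dist_eq_norm, dist_eq_norm, dist_eq_norm]
  have hle1 : ∀ p q : ℂ × ℂ × Param m, ‖p.1 - q.1‖ ≤ dist p q := fun p q => by
    rw [hdist]; exact le_max_left _ _
  have hle2 : ∀ p q : ℂ × ℂ × Param m, ‖p.2.1 - q.2.1‖ ≤ dist p q := fun p q => by
    rw [hdist]; exact (le_max_left _ _).trans (le_max_right _ _)
  have hle3 : ∀ p q : ℂ × ℂ × Param m, ‖p.2.2 - q.2.2‖ ≤ dist p q := fun p q => by
    rw [hdist]; exact (le_max_right _ _).trans (le_max_right _ _)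
  have hmul : ∀ r : ℝ, 0 ≤ r → r ≤ 2 * (2 + K₁) * r := fun r hr => by nlinarith
  have hXle : max ‖p.1 - q.1‖ ‖p.2.2 - q.2.2‖ ≤ dist p q := max_le (hle1 p q) (hle3 p q)
  have hXle' : max ‖p.1 - q.1‖ ‖p.2.2 - q.2.2‖ ≤ dist p' q' := by
    rw [← ex, ← et]; exact max_le (hle1 p' q') (hle3 p' q')
  have hD : 0 ≤ dist p q := dist_nonneg
  have hD' : 0 ≤ dist p' q' := dist_nonneg
  constructor
  · rw [hdist p' q', ex, et]
    refine max_le ((hle1 p q).trans (hmul _ hD)) (max_le ?_ ((hle3 p q).trans (hmul _ hD)))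
    have h2 : ‖p'.2.1 - q'.2.1‖ ≤
        ‖(p'.2.1 - q'.2.1) - (p.2.1 - q.2.1)‖ + ‖p.2.1 - q.2.1‖ := by
      simpa using norm_add_le ((p'.2.1 - q'.2.1) - (p.2.1 - q.2.1)) (p.2.1 - q.2.1)
    have h3 := mul_le_mul_of_nonneg_left hXle hK₁0
    nlinarith [hle2 p q]
  · rw [hdist p q]
    refine max_le ?_ (max_le ?_ ?_)
    · rw [← ex]; exact (hle1 p' q').trans (hmul _ hD')
    · have h2 : ‖p.2.1 - q.2.1‖ ≤
          ‖(p'.2.1 - q'.2.1) - (p.2.1 - q.2.1)‖ + ‖p'.2.1 - q'.2.1‖ := by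
        rw [norm_sub_rev (p'.2.1 - q'.2.1)]
        simpa using norm_add_le ((p.2.1 - q.2.1) - (p'.2.1 - q'.2.1)) (p'.2.1 - q'.2.1)
      have h3 := mul_le_mul_of_nonneg_left hXle' hK₁0
      nlinarith [hle2 p' q']
    · rw [← et]; exact (hle3 p' q').trans (hmul _ hD')

theorem bijOn_familyCarry
    (hε : ∀ w : ℂ, ‖w‖ ^ E.N ≤ ε → ‖w‖ * (8 * (L + 2) * C) ≤ τ ∧ ‖w‖ ≤ Real.exp (-(C / τ))) :
    Set.BijOn (familyCarry M c τ L) (domain m c.R ε δ) (domain m c.R ε δ) := by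
  refine ⟨fun p hp => ⟨?_, hp.2⟩, fun p hp q hq hpq => ?_, fun p hp => ?_⟩
  · rw [← (H p.2.2 hp.2).image_ball hP hε]
    exact ⟨(p.1, p.2.1), hp.1, rfl⟩
  · have hw := Complex.cpow_nat_inv_pow p.1 E.N_pos.ne'
    have h1 : (familyCarry M c τ L p).1 = (familyCarry M c τ L q).1 := by rw [hpq]
    have h2 : (familyCarry M c τ L p).2.2 = (familyCarry M c τ L q).2.2 := by rw [hpq]
    change p.1 = q.1 at h1
    change p.2.2 = q.2.2 at h2
    rw [familyCarry_apply hP H hp hw, familyCarry_apply hP H hq (hw.trans h1)] at hpq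
    have h3 := congrArg (fun v => v.2.1) hpq
    simp only [← h2] at h3
    exact Prod.ext h1 (Prod.ext (((H p.2.2 hp.2).add_displacement_bijective _).1 h3) h2)
  · have h1 := hp.1
    rw [← (H p.2.2 hp.2).image_ball hP hε] at h1
    obtain ⟨q, hq, hqp⟩ := h1
    refine ⟨(q.1, q.2, p.2.2), ⟨hq, hp.2⟩, ?_⟩
    have h2 : (carry M c τ L p.2.2 0 q).1 = p.1 := by rw [hqp]
    have h3 : (carry M c τ L p.2.2 0 q).2 = p.2.1 := by rw [hqp]
    exact Prod.ext h2 (Prod.ext h3 rfl)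

end

theorem exists_trivialization (hP : IsEquisingularFamily d P) (hc : c.Admissible M) :
    ∃ ε₀ : ℝ, 0 < ε₀ ∧ ∀ ε : ℝ, 0 < ε → ε ≤ ε₀ → ∃ δ₀ : ℝ, 0 < δ₀ ∧ ∀ δ : ℝ, 0 < δ → δ ≤ δ₀ →
      ∃ φ : ℂ × ℂ × Param m → ℂ × ℂ × Param m, IsTrivialization M c ε δ φ := by
  classical
  obtain ⟨τ, C, L, hB, hF⟩ := exists_fit hP hc
  have hτ := hB.τ_pos
  have hC := hB.C_pos
  -- The first bound on |w| lets leading terms dominate; the second keeps the immersed leaves inside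
  -- their A-pieces.
  set s : ℝ := min (τ / (8 * (L + 2) * C)) (Real.exp (-(C / τ))) with hs
  have hs0 : 0 < s := lt_min (by positivity) (Real.exp_pos _)
  refine ⟨s ^ E.N, pow_pos hs0 _, fun ε _ hεs => ?_⟩
  have hε : ∀ w : ℂ, ‖w‖ ^ E.N ≤ ε →
      ‖w‖ * (8 * (L + 2) * C) ≤ τ ∧ ‖w‖ ≤ Real.exp (-(C / τ)) := by
    intro w hw
    have h1 : ‖w‖ ≤ s := le_of_pow_le_pow_left₀ E.N_pos.ne' hs0.le (hw.trans hεs)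
    refine ⟨?_, h1.trans (min_le_right _ _)⟩
    exact (le_div_iff₀ (by positivity)).1 (h1.trans (min_le_left _ _))
  -- Small enough for the Lipschitz constant 1 / 2 in y; the added ones avoid division by zero when
  -- d = 0.
  set κ : ℝ := τ / (2 * ((L + 1) * (d + 1))) with hκ
  have hκ0 : 0 < κ := by positivity
  have hsmall : 2 * (L * (d * κ)) ≤ τ := by
    rw [hκ, show 2 * ((L : ℝ) * (d * (τ / (2 * ((L + 1) * (d + 1)))))) =
      τ * ((L * d) / ((L + 1) * (d + 1))) by field_simp]
    refine mul_le_of_le_one_right hτ.le (div_le_one_of_le₀ ?_ (by positivity))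
    have h1 : (0 : ℝ) ≤ L := Nat.cast_nonneg L
    have h2 : (0 : ℝ) ≤ d := Nat.cast_nonneg d
    nlinarith
  have hclose : ∀ᶠ t in 𝓝 (0 : Param m), ∀ (j : Fin d) (l : Fin L),
      ‖E.coeff j l 0 - E.coeff j l t‖ < κ := by
    refine eventually_all.2 fun j => eventually_all.2 fun l => ?_
    filter_upwards [Metric.continuousAt_iff'.1 (E.analyticAt_coeff j l).continuousAt κ hκ0]
      with t ht
    rwa [← dist_eq_norm, dist_comm]
  obtain ⟨Λ, hΛ0, U, hU, hΛ⟩ := E.exists_coeff_lipschitz L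
  -- Semi-algebraicity of the family is a hypothesis inside the conclusion, but δ₀ must be chosen
  -- before. So g is fixed here, with the value 0 if the hypothesis fails.
  have hsa : ∃ g : Fin d → ℕ → Param m → ℂ,
      (∀ k : ℕ, ∃ U ∈ 𝓝 (0 : Param m × ℂ),
        IsSemialgebraicMapOn (fun q : Param m × ℂ => (P q.1 q.2).coeff k) U) →
      (∀ j l, SAFun (g j l)) ∧
        ∀ᶠ t in 𝓝 (0 : Param m), ∀ (j : Fin d) (l : Fin L), E.coeff j l t = g j l t := by
    by_cases h : ∀ k : ℕ, ∃ U ∈ 𝓝 (0 : Param m × ℂ),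
        IsSemialgebraicMapOn (fun q : Param m × ℂ => (P q.1 q.2).coeff k) U
    · choose g hg hgE using fun (j : Fin d) (l : ℕ) => E.germSA_coeff hP h j l
      exact ⟨g, fun _ => ⟨hg, eventually_all.2 fun j => eventually_all.2 fun l => hgE j l⟩⟩
    · exact ⟨fun _ _ _ => 0, fun h' => absurd h' h⟩
  obtain ⟨g, hg⟩ := hsa
  have hgev : ∀ᶠ t in 𝓝 (0 : Param m), (∀ k : ℕ, ∃ U ∈ 𝓝 (0 : Param m × ℂ),
        IsSemialgebraicMapOn (fun q : Param m × ℂ => (P q.1 q.2).coeff k) U) →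
      ∀ (j : Fin d) (l : Fin L), E.coeff j l t = g j l t := by
    by_cases h : ∀ k : ℕ, ∃ U ∈ 𝓝 (0 : Param m × ℂ),
        IsSemialgebraicMapOn (fun q : Param m × ℂ => (P q.1 q.2).coeff k) U
    · filter_upwards [(hg h).2] with t ht _ using ht
    · exact Eventually.of_forall fun t h' => absurd h' h
  obtain ⟨δ₀, hδ₀, hball⟩ := Metric.eventually_nhds_iff_ball.1
    ((hF.and hclose).and ((eventually_mem_set.2 hU).and hgev))
  refine ⟨δ₀, hδ₀, fun δ hδ hδδ₀ => ⟨familyCarry M c τ L, ?_⟩⟩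
  have hsub : ∀ t ∈ Metric.ball (0 : Param m) δ, t ∈ Metric.ball (0 : Param m) δ₀ :=
    fun t ht => Metric.ball_subset_ball hδδ₀ ht
  have H : ∀ t ∈ Metric.ball (0 : Param m) δ,
      Close M c τ C κ L (fun i l => E.coeff i l t) (fun i l => E.coeff i l 0) := fun t ht =>
    { adm := hc
      bounds := hB
      fit := (hball t (hsub t ht)).1.1
      fit' := (hball 0 (Metric.mem_ball_self hδ₀)).1.1
      κ_nonneg := hκ0.le
      close := fun j l hl => ((hball t (hsub t ht)).1.2 j ⟨l, hl⟩).le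
      small := hsmall }
  exact
    { bijOn := bijOn_familyCarry hP H hε
      bilipschitz := bilipschitz_familyCarry hP H (fun w hw => (hε w hw).1) hΛ0
        fun t ht t' ht' => hΛ t (hball t (hsub t ht)).2.1 t' (hball t' (hsub t' ht')).2.1
      semialgebraic_slice := fun t ht => semialgebraic_carry hP H ht
      semialgebraic := fun h => semialgebraic_familyCarry hP H (hg h).1
        fun t ht j l hl => (hball t (hsub t ht)).2.2 h j ⟨l, hl⟩
      x_eq := fun p _ => rfl
      t_eq := fun p _ => rfl
      image_cone := fun t ht i => (H t ht).image_cone hP hε i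
      image_piece := fun t ht Q hQ => (H t ht).image_carrier hP hε Q hQ
      image_leaves := fun t ht Q hQ => (H t ht).image_leaves hP hε Q hQ
      boundary_lines := fun t ht i a ha => (H t ht).boundary_line hP hε i ha }

end Carrousel

theorem mainTheorem8 (m d : ℕ) (P : Param m → ℂ → ℂ[X]) (hP : IsEquisingularFamily d P) :
    Nonempty (PuiseuxExpansion d P) ∧
    ∀ (E : PuiseuxExpansion d P) (M : Truncation E),
      (∃ c : Constants d, c.Admissible M) ∧
      ∀ c : Constants d, c.Admissible M →
        ∃ ε₀ : ℝ, 0 < ε₀ ∧ ∀ ε : ℝ, 0 < ε → ε ≤ ε₀ →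
          ∃ δ₀ : ℝ, 0 < δ₀ ∧ ∀ δ : ℝ, 0 < δ → δ ≤ δ₀ →
            ∃ φ : ℂ × ℂ × Param m → ℂ × ℂ × Param m, IsTrivialization M c ε δ φ := by
  refine ⟨nonempty_puiseuxExpansion hP, fun E M => ⟨exists_admissible hP M, fun c hc => ?_⟩⟩
  exact exists_trivialization hP hc
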